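/- Let $V=\mathbb{R}^n$ with its standard inner product and let $G\subset O(V)$ be a reflection group, i.e. a finite group of orthogonal transformations generated by reflections, of type $I_2(m)$ ($m\ge 2$), $A_r$, $B_r$, $D_r$ ($r\ge 2$), $H_3$ or $F_4$; that is, $G$ is generated by the reflections in unit vectors $\alpha_i$ with $\langle\alpha_i,\alpha_j\rangle=-\cos(\pi/m_{ij})$, where $(m_{ij})$ is the Coxeter matrix of that type. $G$ need not be essential; let $V^G$ be its subspace of fixed vectors. (For example, $\mathfrak{S}_n$ permuting the coordinates of $\mathbb{R}^n$ is of type $A_{n-1}$ with $\dim V^G=1$.) The flats of $G$ are the intersections of reflection hyperplanes of $G$ (including $V$, the empty intersection), and $\mathcal{H}_k(G)\subseteq V$ is the set of points that lie on a flat of dimension $k$. A set of basic invariants of $G$ is a family $\pi_1,\dots,\pi_n$ of algebraically independent homogeneous generators of the invariant ring $\mathbb{R}[V]^G$, labelled such that $\deg\pi_1\le\dots\le\deg\pi_n$. A $G$-invariant real variety $X\subseteq V$ is called $k$-sparse if, for some choice of basic invariants, $X=\{p\in V: f_1(p)=\dots=f_s(p)=0\}$ for some $f_1,\dots,f_s\in\mathbb{R}[\pi_1,\dots,\pi_k]$.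 Theorem. Let $G$ be as above, let $\dim V^G\le k\le n$, and let $X\subseteq V$ be a nonempty $G$-invariant real variety. If $X$ is $k$-sparse, then $X\cap\mathcal{H}_k(G)\ne\emptyset$. -/

import Mathlib

noncomputable section

/-- The ambient space `V = ℝⁿ` with its standard inner product. -/
abbrev Space (n : ℕ) : Type := EuclideanSpace ℝ (Fin n)

/-- The group `O(V)` of orthogonal transformations of `V = ℝⁿ`. -/
abbrev OrthGroup (n : ℕ) : Type := Space n ≃ₗᵢ[ℝ] Space n

/-- The orthogonal reflection in the hyperplane perpendicular to `v` (meant for `v ≠ 0`). -/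
def hyperplaneReflection {n : ℕ} (v : Space n) : OrthGroup n :=
  (Submodule.span ℝ {v})ᗮ.reflection

/-- A (real) reflection group: a finite group of orthogonal transformations of `V` that is
generated by the reflections it contains. -/
def IsReflectionGroup {n : ℕ} (G : Subgroup (OrthGroup n)) : Prop :=
  Finite G ∧
    G = Subgroup.closure {g | g ∈ G ∧ ∃ v : Space n, v ≠ 0 ∧ g = hyperplaneReflection v}

/-- `G` is of the type given by the Coxeter matrix `M`: it is generated by the reflections in
unit vectors `α i` (simple roots), where the hyperplanes of `α i` and `α j` meet in the angle
`π / M i j`, that is, `⟪α i, α j⟫ = - cos (π / M i j)`. For `i = j` this says `‖α i‖ = 1`.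
The roots need not span `V`, so `G` need not be essential. -/
def HasCoxeterType {n : ℕ} (G : Subgroup (OrthGroup n)) {B : Type} (M : CoxeterMatrix B) :
    Prop :=
  ∃ α : B → Space n,
    (∀ i j, inner ℝ (α i) (α j) = - Real.cos (Real.pi / (M i j : ℝ))) ∧
    G = Subgroup.closure (Set.range fun i => hyperplaneReflection (α i))

/-- Adjacency of `i < j` in the Coxeter diagram of type `D_r` on the nodes `0, …, r - 1`: a path
`0, 1, …, r - 2`, and the node `r - 1` joined to `r - 3`. -/
def adjD (r : ℕ) (i j : Fin r) : Prop :=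
  ((i : ℕ) + 1 = j ∧ (j : ℕ) + 1 < r) ∨ ((i : ℕ) + 3 = r ∧ (j : ℕ) + 1 = r)

open Classical in
/-- The Coxeter matrix of type `D_r`. (The matrix `CoxeterMatrix.D` of the library also joins the
nodes `r - 2` and `r - 1`, which is not the diagram `D_r`.) -/
def coxeterMatrixD (r : ℕ) : CoxeterMatrix (Fin r) where
  M := Matrix.of fun i j => if i = j then 1 else if adjD r i j ∨ adjD r j i then 3 else 2
  isSymm := by
    ext i j
    simp only [Matrix.transpose_apply, Matrix.of_apply, eq_comm (a := i), or_comm]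
  diagonal := by simp
  off_diagonal := by
    intro i j h
    simp only [Matrix.of_apply, h, if_false]
    split_ifs <;> decide

/-- `G` is of one of the types `I₂(m)` with `m ≥ 2`, `A_r`, `B_r`, `D_r` with `r ≥ 2`, `H₃`, `F₄`.
(`CoxeterMatrix.I m` is the matrix of `I₂(m + 2)`.) -/
def HasListedType {n : ℕ} (G : Subgroup (OrthGroup n)) : Prop :=
  (∃ m : ℕ, HasCoxeterType G (CoxeterMatrix.I m)) ∨
  (∃ r : ℕ, HasCoxeterType G (CoxeterMatrix.A r)) ∨
  (∃ r : ℕ, HasCoxeterType G (CoxeterMatrix.B r)) ∨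
  (∃ r : ℕ, 2 ≤ r ∧ HasCoxeterType G (coxeterMatrixD r)) ∨
  HasCoxeterType G CoxeterMatrix.H₃ ∨
  HasCoxeterType G CoxeterMatrix.F₄

/-- The subspace `V^G` of vectors fixed by `G`; `G` is essential iff it is `0`. -/
def fixedSubspace {n : ℕ} (G : Subgroup (OrthGroup n)) : Submodule ℝ (Space n) where
  carrier := {p | ∀ g ∈ G, g p = p}
  add_mem' := by
    intro a b ha hb g hg
    rw [map_add, ha g hg, hb g hg]
  zero_mem' := by
    intro g _
    exact map_zero g
  smul_mem' := by
    intro c a ha g hg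
    rw [map_smul, ha g hg]

/-- The reflection arrangement: the set of the hyperplanes of the reflections in `G`. -/
def reflectionArrangement {n : ℕ} (G : Subgroup (OrthGroup n)) :
    Set (Submodule ℝ (Space n)) :=
  {H | ∃ v : Space n, v ≠ 0 ∧ hyperplaneReflection v ∈ G ∧ H = (Submodule.span ℝ {v})ᗮ}

/-- The flats: all intersections of hyperplanes of the arrangement (`V` is the empty one). -/
def IsFlat {n : ℕ} (G : Subgroup (OrthGroup n)) (F : Submodule ℝ (Space n)) : Prop :=
  ∃ A ⊆ reflectionArrangement G, F = sInf A

/-- The stratum `H_k(G)`: the points that lie on a flat of dimension `k`. -/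
def stratum {n : ℕ} (G : Subgroup (OrthGroup n)) (k : ℕ) : Set (Space n) :=
  {p | ∃ F : Submodule ℝ (Space n), IsFlat G F ∧ Module.finrank ℝ F = k ∧ p ∈ F}

/-- The value of a polynomial at a point of `V`. -/
def evalAt {n : ℕ} (p : Space n) (f : MvPolynomial (Fin n) ℝ) : ℝ :=
  MvPolynomial.eval (fun i => p i) f

/-- The ring `ℝ[V]^G` of `G`-invariant polynomials. -/
def invariantRing {n : ℕ} (G : Subgroup (OrthGroup n)) :
    Subalgebra ℝ (MvPolynomial (Fin n) ℝ) where
  carrier := {f | ∀ g ∈ G, ∀ p : Space n, evalAt (g p) f = evalAt p f}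
  mul_mem' := by
    intro a b ha hb g hg p
    have h1 := ha g hg p
    have h2 := hb g hg p
    simp only [evalAt, map_mul] at *
    rw [h1, h2]
  add_mem' := by
    intro a b ha hb g hg p
    have h1 := ha g hg p
    have h2 := hb g hg p
    simp only [evalAt, map_add] at *
    rw [h1, h2]
  algebraMap_mem' := by
    intro r g _ p
    simp [evalAt, MvPolynomial.algebraMap_eq]

/-- A set of basic invariants of `G`: algebraically independent homogeneous generators
`π₁, …, πₙ` of `ℝ[V]^G`, ordered by degree. -/
structure IsBasicInvariants {n : ℕ} (G : Subgroup (OrthGroup n))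
    (π : Fin n → MvPolynomial (Fin n) ℝ) : Prop where
  algebraicIndependent : AlgebraicIndependent ℝ π
  generates : Algebra.adjoin ℝ (Set.range π) = invariantRing G
  homogeneous : ∀ i, (π i).IsHomogeneous (π i).totalDegree
  degree_mono : Monotone fun i => (π i).totalDegree

/-- The real zero set of a finite set of polynomials. -/
def realZeros {n : ℕ} (S : Finset (MvPolynomial (Fin n) ℝ)) : Set (Space n) :=
  {p | ∀ f ∈ S, evalAt p f = 0}

/-- `X` is a real variety. -/
def IsRealVariety {n : ℕ} (X : Set (Space n)) : Prop :=
  ∃ S : Finset (MvPolynomial (Fin n) ℝ), X = realZeros S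

/-- `X` is `G`-invariant. -/
def IsInvariantSet {n : ℕ} (G : Subgroup (OrthGroup n)) (X : Set (Space n)) : Prop :=
  ∀ g ∈ G, ∀ p ∈ X, g p ∈ X

/-- `X` is `k`-sparse: for some choice of basic invariants `π₁, …, πₙ` of `G`, it is the real
zero set of finitely many polynomials in `ℝ[π₁, …, π_k]`. -/
def IsSparse {n : ℕ} (G : Subgroup (OrthGroup n)) (k : ℕ) (X : Set (Space n)) : Prop :=
  ∃ π : Fin n → MvPolynomial (Fin n) ℝ, IsBasicInvariants G π ∧
    ∃ S : Finset (MvPolynomial (Fin n) ℝ),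
      (∀ f ∈ S, f ∈ Algebra.adjoin ℝ (π '' {i : Fin n | (i : ℕ) < k})) ∧ X = realZeros S

end

/-! A set cut out by polynomials in π₁, …, π_k is a union of common fibres of π₁, …, π_k. It
therefore suffices that each such fibre meets the stratum, which is the property
`FibresMeetStratum`.

The main tool is Lagrange multipliers. On a compact fibre of some polynomials a further polynomial
attains its minimum, and at the minimum all their gradients are linearly dependent
(`card_le_of_isLocalExtrOn`). For power sums such a dependence is a Vandermonde relation: it bounds
the number of distinct coordinates, or of distinct squares of coordinates, and so puts the minimum
on many reflecting hyperplanes at once. This settles type `A` (`fibresMeetStratum_typeA`) and type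
`B` (`fibresMeetStratum_typeB`). In type `D` the product of the coordinates is a further invariant
and needs a separate analysis (`exists_mem_stratum_of_ne_zero`, `exists_mem_stratum_prodPoly`). For
`F₄` and k = dim V^G + 2 the sum of fourth powers is minimised, although it is not invariant under
the whole group (`fibresMeetStratum_typeF`).

Basic invariants are not unique, so the explicit invariants have to control every choice. The
Jacobian determinant of basic invariants of degrees dᵢ vanishes on every reflecting hyperplane,
hence the number of reflections is at most ∑ (dᵢ - 1) (`IsBasicInvariants.card_le_sum`). An explicit
family with independent gradients that attains this bound (`IsCompleteFamily`) has the degrees of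
the basic invariants. By a dimension count each πᵢ is then a weighted homogeneous polynomial in the
family (`IsBasicInvariants.exists_aeval_eq`). Consequently the low-degree members of the family
determine π₁, …, π_k (`IsBasicInvariants.evalAt_eq_of_family`). Only in type `D_r` with r = 2(k -
dim V^G) does a combination of two invariants of equal degree have to be kept.

Some values of k need no coordinates. For k = n there is nothing to prove. For k = dim V^G the first
k invariants are linear, and the orthogonal projection to V^G preserves them. For k = dim V^G + 1
and a connected Coxeter graph, the first k invariants have degree at most two and see only the norm
of the component orthogonal to V^G, so this component may be turned onto a ray of the arrangement.
For k = n - 1 with k > dim V^G and a connected graph, the last invariant is minimised: gradients of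
basic invariants are independent at points with trivial stabilizer, and points off all hyperplanes
are such, so the minimum lies on a hyperplane (`fibresMeetStratum_of_add_one_eq`). This suffices for
`I₂(m)` with m > 2, for `H₃` and for the other values of k in `F₄`. The reducible case `I₂(2)` =
`D₂` is computed by hand (`fibresMeetStratum_of_orthogonal_pair`). -/

section Auxiliary

open MvPolynomial Module

/-! ### Gradients of polynomials -/

/-- The linear form `⟪v, ·⟫` as a polynomial. -/
noncomputable def linForm {n : ℕ} (v : Space n) : MvPolynomial (Fin n) ℝ :=
  ∑ i, C (v i) * X i

/-- The gradient of a polynomial at a point. -/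
noncomputable def polyGrad {n : ℕ} (f : MvPolynomial (Fin n) ℝ) (q : Space n) : Space n :=
  WithLp.toLp 2 fun i => evalAt q (pderiv i f)

section Gradient

variable {n : ℕ}

lemma inner_eq_sum (x y : Space n) : inner ℝ x y = ∑ i, x i * y i := by
  simp [PiLp.inner_apply, mul_comm]

lemma evalAt_add (p : Space n) (f g : MvPolynomial (Fin n) ℝ) :
    evalAt p (f + g) = evalAt p f + evalAt p g := by simp [evalAt]

lemma evalAt_mul (p : Space n) (f g : MvPolynomial (Fin n) ℝ) :
    evalAt p (f * g) = evalAt p f * evalAt p g := by simp [evalAt]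

lemma evalAt_C (p : Space n) (c : ℝ) : evalAt p (C c) = c := by simp [evalAt]

lemma evalAt_pow (p : Space n) (f : MvPolynomial (Fin n) ℝ) (m : ℕ) :
    evalAt p (f ^ m) = evalAt p f ^ m := by simp [evalAt]

lemma evalAt_sum {ι : Type*} (p : Space n) (s : Finset ι) (f : ι → MvPolynomial (Fin n) ℝ) :
    evalAt p (∑ i ∈ s, f i) = ∑ i ∈ s, evalAt p (f i) := by simp [evalAt]

lemma evalAt_prod {ι : Type*} (p : Space n) (s : Finset ι) (f : ι → MvPolynomial (Fin n) ℝ) :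
    evalAt p (∏ i ∈ s, f i) = ∏ i ∈ s, evalAt p (f i) := by simp [evalAt, map_prod]

lemma evalAt_smul (p : Space n) (c : ℝ) (f : MvPolynomial (Fin n) ℝ) :
    evalAt p (c • f) = c * evalAt p f := by simp [evalAt, smul_eval]

lemma evalAt_linForm (v p : Space n) : evalAt p (linForm v) = inner ℝ v p := by
  simp [evalAt, linForm, inner_eq_sum]

lemma isHomogeneous_linForm (v : Space n) : (linForm v).IsHomogeneous 1 := by
  refine IsHomogeneous.sum _ _ _ fun i _ => ?_
  simpa using (isHomogeneous_C (Fin n) (v i)).mul (isHomogeneous_X ℝ i)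

lemma polyGrad_add (f g : MvPolynomial (Fin n) ℝ) (q : Space n) :
    polyGrad (f + g) q = polyGrad f q + polyGrad g q := by
  ext i; simp [polyGrad, evalAt]

lemma polyGrad_mul (f g : MvPolynomial (Fin n) ℝ) (q : Space n) :
    polyGrad (f * g) q = evalAt q g • polyGrad f q + evalAt q f • polyGrad g q := by
  ext i; simp [polyGrad, evalAt]; ring

lemma polyGrad_C (c : ℝ) (q : Space n) : polyGrad (C c) q = 0 := by
  ext i; simp [polyGrad, evalAt]

lemma polyGrad_smul (c : ℝ) (f : MvPolynomial (Fin n) ℝ) (q : Space n) :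
    polyGrad (c • f) q = c • polyGrad f q := by
  rw [smul_eq_C_mul, polyGrad_mul, polyGrad_C, evalAt_C]; simp

lemma polyGrad_sum {ι : Type*} (s : Finset ι) (f : ι → MvPolynomial (Fin n) ℝ) (q : Space n) :
    polyGrad (∑ i ∈ s, f i) q = ∑ i ∈ s, polyGrad (f i) q := by
  classical
  induction s using Finset.induction_on with
  | empty => simpa using polyGrad_C 0 q
  | insert a s ha ih => rw [Finset.sum_insert ha, Finset.sum_insert ha, polyGrad_add, ih]

lemma polyGrad_pow (f : MvPolynomial (Fin n) ℝ) (m : ℕ) (q : Space n) :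
    polyGrad (f ^ m) q = (m * evalAt q f ^ (m - 1)) • polyGrad f q := by
  induction m with
  | zero => simpa using polyGrad_C 1 q
  | succ m ih =>
    rw [pow_succ, polyGrad_mul, ih, evalAt_pow, smul_smul, ← add_smul]
    congr 1
    rcases m with _ | m
    · simp
    · push_cast; ring

lemma polyGrad_X (i : Fin n) (q : Space n) : polyGrad (X i) q = EuclideanSpace.single i 1 := by
  ext j
  by_cases h : j = i
  · subst h; simp [polyGrad, evalAt]
  · simp [polyGrad, evalAt, pderiv_X, Pi.single_apply, h, Ne.symm h]

lemma polyGrad_linForm (v q : Space n) : polyGrad (linForm v) q = v := by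
  ext i
  simp [polyGrad, evalAt, linForm, pderiv_X, Pi.single_apply]

lemma polyGrad_prod {ι : Type*} [DecidableEq ι] (s : Finset ι)
    (f : ι → MvPolynomial (Fin n) ℝ) (q : Space n) :
    polyGrad (∏ i ∈ s, f i) q =
      ∑ i ∈ s, (∏ j ∈ s.erase i, evalAt q (f j)) • polyGrad (f i) q := by
  induction s using Finset.induction_on with
  | empty => simpa using polyGrad_C 1 q
  | insert a s ha ih =>
    rw [Finset.prod_insert ha, Finset.sum_insert ha, polyGrad_mul, ih, evalAt_prod,
      Finset.erase_insert ha, Finset.smul_sum]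
    congr 1
    refine Finset.sum_congr rfl fun i hi => ?_
    have hia : i ≠ a := fun h => ha (h ▸ hi)
    rw [Finset.erase_insert_of_ne hia.symm, Finset.prod_insert, smul_smul]
    exact fun h => ha (Finset.mem_of_mem_erase h)

lemma hasStrictFDerivAt_evalAt (f : MvPolynomial (Fin n) ℝ) (q : Space n) :
    HasStrictFDerivAt (fun p => evalAt p f) (innerSL ℝ (polyGrad f q)) q := by
  induction f using MvPolynomial.induction_on with
  | C a =>
    simp only [evalAt_C, polyGrad_C, map_zero]
    exact hasStrictFDerivAt_const a q
  | add f g hf hg =>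
    simp only [evalAt_add, polyGrad_add, map_add]
    exact hf.add hg
  | mul_X f i hf =>
    simp only [evalAt_mul, polyGrad_mul, map_add, map_smul]
    have hX : HasStrictFDerivAt (fun p : Space n => evalAt p (X i))
        (innerSL ℝ (polyGrad (X i) q)) q := by
      have h : (fun p : Space n => evalAt p (X i)) = fun p =>
          innerSL ℝ (polyGrad (X i) q) p := by
        funext p
        simp [evalAt, polyGrad_X, EuclideanSpace.inner_single_left]
      rw [h]
      exact (innerSL ℝ (polyGrad (X i) q)).hasStrictFDerivAt
    rw [add_comm]
    exact hf.mul hX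

lemma continuous_evalAt (f : MvPolynomial (Fin n) ℝ) : Continuous fun p : Space n => evalAt p f :=
  continuous_iff_continuousAt.2 fun q => (hasStrictFDerivAt_evalAt f q).continuousAt

/-- The Leibniz rule. It turns membership in a generated algebra into linear algebra at a single
point, where ranks can be counted. -/
lemma polyGrad_mem_span_of_mem_adjoin {ι : Type*} (P : ι → MvPolynomial (Fin n) ℝ) (S : Set ι)
    {f : MvPolynomial (Fin n) ℝ} (hf : f ∈ Algebra.adjoin ℝ (P '' S)) (q : Space n) :
    polyGrad f q ∈ Submodule.span ℝ ((fun i => polyGrad (P i) q) '' S) := by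
  induction hf using Algebra.adjoin_induction with
  | mem x hx =>
    obtain ⟨i, hi, rfl⟩ := hx
    exact Submodule.subset_span ⟨i, hi, rfl⟩
  | algebraMap r => rw [MvPolynomial.algebraMap_eq, polyGrad_C]; exact Submodule.zero_mem _
  | add x y _ _ hx hy => rw [polyGrad_add]; exact Submodule.add_mem _ hx hy
  | mul x y _ _ hx hy =>
    rw [polyGrad_mul]
    exact Submodule.add_mem _ (Submodule.smul_mem _ _ hx) (Submodule.smul_mem _ _ hy)

lemma evalAt_eq_of_mem_adjoin {ι : Type*} (P : ι → MvPolynomial (Fin n) ℝ) (S : Set ι)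
    {f : MvPolynomial (Fin n) ℝ} (hf : f ∈ Algebra.adjoin ℝ (P '' S)) {p q : Space n}
    (h : ∀ i ∈ S, evalAt q (P i) = evalAt p (P i)) : evalAt q f = evalAt p f := by
  induction hf using Algebra.adjoin_induction with
  | mem x hx => obtain ⟨i, hi, rfl⟩ := hx; exact h i hi
  | algebraMap r => rw [MvPolynomial.algebraMap_eq, evalAt_C, evalAt_C]
  | add x y _ _ hx hy => rw [evalAt_add, evalAt_add, hx, hy]
  | mul x y _ _ hx hy => rw [evalAt_mul, evalAt_mul, hx, hy]

end Gradient

/-! ### Critical points on fibres -/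

section Critical

variable {n : ℕ}

/-- At a local extremum of `h` on a common fibre of the `f i`, the gradients are dependent. -/
lemma card_le_of_isLocalExtrOn {ι κ : Type*} [Fintype ι] [Fintype κ]
    (f : ι → MvPolynomial (Fin n) ℝ) (h : MvPolynomial (Fin n) ℝ) {q : Space n}
    (hq : IsLocalExtrOn (fun x => evalAt x h) {x | ∀ i, evalAt x (f i) = evalAt q (f i)} q)
    (w : κ → Space n) (hw : LinearIndependent ℝ w)
    (hmem : ∀ j, w j ∈ Submodule.span ℝ
      (insert (polyGrad h q) (Set.range fun i => polyGrad (f i) q))) :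
    Fintype.card κ ≤ Fintype.card ι := by
  classical
  -- The multipliers give a nontrivial relation between the gradients of `h` and of the `f i`, so
  -- these `card ι + 1` vectors span a space of dimension at most `card ι`.
  obtain ⟨Λ, Λ₀, hne, hsum⟩ := hq.exists_multipliers_of_hasStrictFDerivAt
    (fun i => hasStrictFDerivAt_evalAt (f i) q) (hasStrictFDerivAt_evalAt h q)
  have hsum' : ∑ i, Λ i • polyGrad (f i) q + Λ₀ • polyGrad h q = 0 := by
    refine ext_inner_right ℝ fun v => ?_
    have := DFunLike.congr_fun hsum v
    simpa [inner_add_left, sum_inner, inner_smul_left] using this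
  let u : Option ι → Space n := fun o => o.elim (polyGrad h q) fun i => polyGrad (f i) q
  have hu : ¬ LinearIndependent ℝ u := by
    intro hli
    have := Fintype.linearIndependent_iff.1 hli (fun o => o.elim Λ₀ Λ) (by
      rw [Fintype.sum_option, add_comm]; simpa [u] using hsum')
    apply hne
    ext i
    · simpa using this (some i)
    · simpa using this none
  have hrange : Set.range u = insert (polyGrad h q) (Set.range fun i => polyGrad (f i) q) := by
    ext x; simp [u, Option.exists, eq_comm]
  rw [← hrange] at hmem
  have h1 : Fintype.card κ ≤ finrank ℝ (Submodule.span ℝ (Set.range u)) := by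
    rw [← finrank_span_eq_card hw]
    exact Submodule.finrank_mono (Submodule.span_le.2 (by rintro _ ⟨j, rfl⟩; exact hmem j))
  have h2 : finrank ℝ (Submodule.span ℝ (Set.range u)) ≤ Fintype.card (Option ι) :=
    finrank_range_le_card u
  have h3 : finrank ℝ (Submodule.span ℝ (Set.range u)) ≠ Fintype.card (Option ι) := fun h =>
    hu (linearIndependent_iff_card_eq_finrank_span.2 h.symm)
  rw [Fintype.card_option] at h2 h3
  omega

lemma isClosed_fibre {ι : Type*} (f : ι → MvPolynomial (Fin n) ℝ) (p : Space n) :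
    IsClosed {x | ∀ i, evalAt x (f i) = evalAt p (f i)} := by
  simp only [Set.ofPred_forall]
  exact isClosed_iInter fun i => isClosed_eq (continuous_evalAt _) continuous_const

/-- A closed set on which a separating family of linear forms is bounded is compact. -/
lemma isCompact_of_inner_bounded {ι : Type*} [Fintype ι] (w : ι → Space n)
    (hw : ∀ x, (∀ i, inner ℝ (w i) x = 0) → x = 0) {F : Set (Space n)} (hF : IsClosed F) (M : ℝ)
    (hM : ∀ x ∈ F, ∀ i, |inner ℝ (w i) x| ≤ M) : IsCompact F := by
  let φ : Space n →ₗ[ℝ] (ι → ℝ) := LinearMap.pi fun i => (innerSL ℝ (w i)).toLinearMap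
  have hφ : φ.ker = ⊥ := by
    rw [LinearMap.ker_eq_bot']
    intro x hx
    exact hw x fun i => by simpa [φ] using congrFun hx i
  have hc := (LinearMap.isClosedEmbedding_of_injective hφ).isCompact_preimage
    (isCompact_univ_pi fun _ : ι => isCompact_Icc (a := -M) (b := M))
  refine hc.of_isClosed_subset hF fun x hx => ?_
  simp only [Set.mem_preimage, Set.mem_pi, Set.mem_univ, true_implies]
  intro i
  exact abs_le.1 (hM x hx i)

/-- Compactness provides the minimum. The fibre through `p` is also the fibre through `q`, the form
in which Lagrange multipliers are applied. -/
lemma exists_min_on_fibre {ι : Type*} (f : ι → MvPolynomial (Fin n) ℝ)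
    (p : Space n) (hF : IsCompact {x | ∀ i, evalAt x (f i) = evalAt p (f i)})
    (h : MvPolynomial (Fin n) ℝ) :
    ∃ q, (∀ i, evalAt q (f i) = evalAt p (f i)) ∧
      (∀ x, (∀ i, evalAt x (f i) = evalAt p (f i)) → evalAt q h ≤ evalAt x h) ∧
      IsLocalExtrOn (fun x => evalAt x h) {x | ∀ i, evalAt x (f i) = evalAt q (f i)} q := by
  obtain ⟨q, hq, hmin⟩ := hF.exists_isMinOn ⟨p, fun _ => rfl⟩ (continuous_evalAt h).continuousOn
  refine ⟨q, hq, fun x hx => hmin hx, Or.inl ?_⟩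
  have : {x : Space n | ∀ i, evalAt x (f i) = evalAt q (f i)} =
      {x | ∀ i, evalAt x (f i) = evalAt p (f i)} := by
    ext x; simp only [Set.mem_ofPred_eq]
    exact forall_congr' fun i => by rw [hq i]
  rw [this]
  exact hmin.localize

end Critical

/-! ### Reflections, roots and strata -/

section Roots

variable {n : ℕ}

lemma hyperplaneReflection_apply (v x : Space n) :
    hyperplaneReflection v x = x - (2 * inner ℝ v x / inner ℝ v v) • v := by
  rw [hyperplaneReflection, Submodule.reflection_orthogonal_apply,
    Submodule.reflection_singleton_apply, real_inner_self_eq_norm_sq]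
  simp only [RCLike.ofReal_real_eq_id, id_eq, neg_sub, two_smul, ← add_smul]
  congr 2
  ring

lemma hyperplaneReflection_self (v : Space n) (hv : v ≠ 0) : hyperplaneReflection v v = -v := by
  rw [hyperplaneReflection_apply, mul_div_assoc, div_self (inner_self_ne_zero.2 hv), mul_one,
    two_smul]
  abel

lemma hyperplaneReflection_invol (v x : Space n) :
    hyperplaneReflection v (hyperplaneReflection v x) = x := by
  simp [hyperplaneReflection]

lemma hyperplaneReflection_mul_self (v : Space n) :
    hyperplaneReflection v * hyperplaneReflection v = 1 := by
  ext1 x; exact hyperplaneReflection_invol v x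

lemma hyperplaneReflection_map (g : OrthGroup n) (v : Space n) :
    hyperplaneReflection (g v) = g * hyperplaneReflection v * g⁻¹ := by
  ext1 x
  have hx : x = g (g⁻¹ x) := (g.apply_symm_apply x).symm
  change _ = g (hyperplaneReflection v (g⁻¹ x))
  rw [hyperplaneReflection_apply, hyperplaneReflection_apply, map_sub, map_smul, ← hx,
    g.inner_map_map]
  conv_lhs => rw [hx, g.inner_map_map]
  rw [← hx]

lemma hyperplaneReflection_smul (c : ℝ) (hc : c ≠ 0) (v : Space n) :
    hyperplaneReflection (c • v) = hyperplaneReflection v := by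
  rw [hyperplaneReflection, hyperplaneReflection]
  congr 2
  exact Submodule.span_singleton_smul_eq (IsUnit.mk0 c hc) v

/-- The nonzero vectors whose reflections lie in `G`. -/
def rootSet (G : Subgroup (OrthGroup n)) : Set (Space n) :=
  {v | v ≠ 0 ∧ hyperplaneReflection v ∈ G}

lemma map_mem_rootSet {G : Subgroup (OrthGroup n)} {g : OrthGroup n} (hg : g ∈ G) {v : Space n}
    (hv : v ∈ rootSet G) : g v ∈ rootSet G := by
  refine ⟨by simpa using hv.1, ?_⟩
  rw [hyperplaneReflection_map]
  exact G.mul_mem (G.mul_mem hg hv.2) (G.inv_mem hg)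

lemma smul_mem_rootSet {G : Subgroup (OrthGroup n)} {c : ℝ} (hc : c ≠ 0) {v : Space n}
    (hv : v ∈ rootSet G) : c • v ∈ rootSet G :=
  ⟨smul_ne_zero hc hv.1, by rw [hyperplaneReflection_smul c hc]; exact hv.2⟩

lemma reflect_mem_rootSet {G : Subgroup (OrthGroup n)} {v w : Space n} (hv : v ∈ rootSet G)
    (hw : w ∈ rootSet G) : w - (2 * inner ℝ v w / inner ℝ v v) • v ∈ rootSet G := by
  rw [← hyperplaneReflection_apply]
  exact map_mem_rootSet hv.2 hw

lemma mem_orthogonal_span_iff (s : Set (Space n)) (x : Space n) :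
    x ∈ (Submodule.span ℝ s)ᗮ ↔ ∀ v ∈ s, inner ℝ v x = 0 := by
  rw [Submodule.mem_orthogonal]
  refine ⟨fun hx v hv => hx v (Submodule.subset_span hv), fun hx u hu => ?_⟩
  induction hu using Submodule.span_induction with
  | mem v hv => exact hx v hv
  | zero => simp
  | add a b _ _ ha hb => rw [inner_add_left, ha, hb, add_zero]
  | smul t a _ ha => rw [inner_smul_left, ha, mul_zero]

/-- Discarding members of a basis of the span taken from `N` enlarges the orthogonal complement one
dimension at a time. This is why a point on a flat of dimension at most `k` also lies on one of
dimension exactly `k`. -/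
lemma exists_finset_finrank_orthogonal_eq (N : Set (Space n)) {k : ℕ} (hkn : k ≤ n)
    (h : finrank ℝ (Submodule.span ℝ N)ᗮ ≤ k) :
    ∃ c : Finset (Space n), (c : Set (Space n)) ⊆ N ∧
      finrank ℝ (Submodule.span ℝ (c : Set (Space n)))ᗮ = k := by
  obtain ⟨b, hbN, hbspan, hbli⟩ := exists_linearIndependent ℝ N
  have hbfin : b.Finite := hbli.setFinite
  have : Fintype b := hbfin.fintype
  have hsum := Submodule.finrank_add_finrank_orthogonal (Submodule.span ℝ N)
  rw [finrank_euclideanSpace_fin] at hsum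
  have hbcard : b.toFinset.card = finrank ℝ (Submodule.span ℝ N) := by
    rw [← hbspan, finrank_span_set_eq_card hbli]
  obtain ⟨c, hcb, hccard⟩ := Finset.exists_subset_card_eq (s := b.toFinset) (n := n - k)
    (by rw [hbcard]; omega)
  have hcb' : (c : Set (Space n)) ⊆ b := fun x hx => Set.mem_toFinset.1 (hcb hx)
  have hcli : LinearIndepOn ℝ id (c : Set (Space n)) := LinearIndepOn.mono hbli hcb'
  have hcrank : finrank ℝ (Submodule.span ℝ (c : Set (Space n))) = n - k := by
    rw [finrank_span_finset_eq_card hcli, hccard]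
  have hsum' := Submodule.finrank_add_finrank_orthogonal (Submodule.span ℝ (c : Set (Space n)))
  rw [finrank_euclideanSpace_fin] at hsum'
  exact ⟨c, hcb'.trans hbN, by omega⟩

/-- A point lies in the stratum `k` as soon as the roots orthogonal to it cut out a subspace of
dimension at most `k`. -/
lemma mem_stratum_of_finrank_le {G : Subgroup (OrthGroup n)} {k : ℕ} (hkn : k ≤ n) {q : Space n}
    (h : finrank ℝ (Submodule.span ℝ {v | v ∈ rootSet G ∧ inner ℝ v q = 0})ᗮ ≤ k) :
    q ∈ stratum G k := by
  obtain ⟨c, hcN, hc⟩ := exists_finset_finrank_orthogonal_eq _ hkn h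
  refine ⟨(Submodule.span ℝ (c : Set (Space n)))ᗮ,
    ⟨(fun v => (Submodule.span ℝ {v})ᗮ) '' (c : Set (Space n)), ?_, ?_⟩, hc, ?_⟩
  · rintro _ ⟨v, hv, rfl⟩
    have := hcN hv
    exact ⟨v, this.1.1, this.1.2, rfl⟩
  · ext x
    rw [mem_orthogonal_span_iff, Submodule.mem_sInf]
    simp only [Set.mem_image, forall_exists_index, and_imp, forall_apply_eq_imp_iff₂,
      Submodule.mem_orthogonal_singleton_iff_inner_right]
  · rw [mem_orthogonal_span_iff]
    exact fun v hv => (hcN hv).2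

/-- If every vector orthogonal to the roots at `q` and to the `k` vectors `w` vanishes, then `q`
lies in the stratum `k`. -/
lemma mem_stratum_of_separating {G : Subgroup (OrthGroup n)} {k : ℕ} (hkn : k ≤ n) {q : Space n}
    {κ : Type*} [Fintype κ] (hκ : Fintype.card κ ≤ k) (w : κ → Space n)
    (h : ∀ x, (∀ v ∈ rootSet G, inner ℝ v q = 0 → inner ℝ v x = 0) →
      (∀ j, inner ℝ (w j) x = 0) → x = 0) : q ∈ stratum G k := by
  apply mem_stratum_of_finrank_le hkn
  refine le_trans ?_ hκ
  set W := (Submodule.span ℝ {v | v ∈ rootSet G ∧ inner ℝ v q = 0})ᗮ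
  let φ : W →ₗ[ℝ] (κ → ℝ) :=
    (LinearMap.pi fun i => (innerSL ℝ (w i)).toLinearMap) ∘ₗ W.subtype
  have hφ : Function.Injective φ := by
    rw [← LinearMap.ker_eq_bot, LinearMap.ker_eq_bot']
    intro x hx
    apply Subtype.ext
    refine h x (fun v hv hvq => ?_) fun j => by simpa [φ] using congrFun hx j
    exact (Submodule.mem_orthogonal _ _).1 x.2 v (Submodule.subset_span ⟨hv, hvq⟩)
  simpa using LinearMap.finrank_le_finrank_of_injective hφ

lemma mem_stratum_top (G : Subgroup (OrthGroup n)) (q : Space n) : q ∈ stratum G n :=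
  mem_stratum_of_finrank_le le_rfl (by
    simpa using Submodule.finrank_le (Submodule.span ℝ {v | v ∈ rootSet G ∧ inner ℝ v q = 0})ᗮ)

end Roots

/-! ### Degrees of basic invariants -/

section Degrees

variable {n : ℕ}

/-- A nonzero functional that vanishes on the range would be a linear relation between the
gradients. -/
lemma sum_smul_polyGrad_inner {ι : Type*} [Fintype ι] (P : ι → MvPolynomial (Fin n) ℝ)
    {a : Space n} (hP : LinearIndependent ℝ fun i => polyGrad (P i) a) :
    (ContinuousLinearMap.pi fun i => innerSL ℝ (polyGrad (P i) a)).range = ⊤ := by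
  by_contra hne
  obtain ⟨f, hf0, hf⟩ := Submodule.exists_le_ker_of_lt_top _ (lt_top_iff_ne_top.2 hne)
  classical
  have hfeq : ∀ y, f y = ∑ i, y i * f (Pi.single i 1) := by
    intro y
    conv_lhs => rw [← Finset.univ_sum_single y]
    rw [map_sum]
    refine Finset.sum_congr rfl fun i _ => ?_
    rw [← smul_eq_mul, ← map_smul, ← Pi.single_smul, smul_eq_mul, mul_one]
  have hz : ∑ i, f (Pi.single i 1) • polyGrad (P i) a = 0 := by
    refine ext_inner_right ℝ fun v => ?_
    have h1 : f (fun i => inner ℝ (polyGrad (P i) a) v) = 0 := hf ⟨v, rfl⟩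
    rw [hfeq] at h1
    rw [sum_inner, inner_zero_left, ← h1]
    exact Finset.sum_congr rfl fun i _ => by rw [real_inner_smul_left, mul_comm]
  have hall := Fintype.linearIndependent_iff.1 hP _ hz
  exact hf0 (LinearMap.ext fun y => by rw [hfeq]; simp [hall])

lemma evalAt_aeval {ι : Type*} (P : ι → MvPolynomial (Fin n) ℝ) (Q : MvPolynomial ι ℝ)
    (q : Space n) : evalAt q (aeval P Q) = eval (fun j => evalAt q (P j)) Q := by
  rw [evalAt, ← MvPolynomial.coe_aeval_eq_eval, ← MvPolynomial.coe_aeval_eq_eval]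
  exact DFunLike.congr_fun (MvPolynomial.comp_aeval P (aeval fun i => q i)) Q

/-- The Jacobian criterion: polynomials with independent gradients at some point are
algebraically independent. -/
lemma algebraicIndependent_of_polyGrad {ι : Type*} [Fintype ι] (P : ι → MvPolynomial (Fin n) ℝ)
    {a : Space n} (hP : LinearIndependent ℝ fun i => polyGrad (P i) a) :
    AlgebraicIndependent ℝ P := by
  rw [algebraicIndependent_iff]
  intro Q hQ
  have hs : HasStrictFDerivAt (fun x i => evalAt x (P i))
      (ContinuousLinearMap.pi fun i => innerSL ℝ (polyGrad (P i) a)) a :=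
    hasStrictFDerivAt_pi.2 fun i => hasStrictFDerivAt_evalAt (P i) a
  -- The map with components `P i` is a submersion at `a`, hence open there, so `Q` vanishes on a
  -- whole neighbourhood of the image point.
  have hmap := hs.map_nhds_eq_of_surj (sum_smul_polyGrad_inner P hP)
  have hQ0 : ∀ᶠ y in nhds (fun i => evalAt a (P i)), eval y Q = 0 := by
    rw [← hmap, Filter.eventually_map]
    refine Filter.Eventually.of_forall fun x => ?_
    rw [← evalAt_aeval, hQ]
    simp [evalAt]
  obtain ⟨ε, hε, hball⟩ := Metric.eventually_nhds_iff_ball.1 hQ0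
  -- In the sup metric a ball is a product of intervals, and a polynomial that vanishes on a product
  -- of infinite sets is zero.
  refine MvPolynomial.funext_set (fun i => Metric.ball (evalAt a (P i)) ε) (fun i => ?_) ?_
  · rw [Real.ball_eq_Ioo]
    exact Set.Ioo_infinite (by linarith)
  · intro y hy
    rw [map_zero]
    refine hball y ?_
    rw [ball_pi _ hε]
    exact hy

lemma isHomogeneous_aeval_monomial {ι : Type*} (P : ι → MvPolynomial (Fin n) ℝ)
    (D : ι → ℕ) (hP : ∀ i, (P i).IsHomogeneous (D i)) (s : ι →₀ ℕ) (c : ℝ) :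
    (aeval P (monomial s c)).IsHomogeneous (Finsupp.weight D s) := by
  rw [aeval_monomial, MvPolynomial.algebraMap_eq, Finsupp.weight_apply]
  have h := (isHomogeneous_C (Fin n) c).mul
    (IsHomogeneous.prod s.support (fun i => P i ^ s i) (fun i => D i * s i)
      fun i _ => (hP i).pow (s i))
  simpa [Finsupp.sum, Finsupp.prod, mul_comm] using h

/-- Substituting homogeneous polynomials carries the grading by weights to the grading by degree. -/
lemma homogeneousComponent_aeval {ι : Type*} (P : ι → MvPolynomial (Fin n) ℝ)
    (D : ι → ℕ) (hP : ∀ i, (P i).IsHomogeneous (D i)) (m : ℕ) (Q : MvPolynomial ι ℝ) :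
    homogeneousComponent m (aeval P Q) = aeval P (weightedHomogeneousComponent D m Q) := by
  induction Q using MvPolynomial.induction_on' with
  | monomial s c =>
    rw [homogeneousComponent_of_mem (isHomogeneous_aeval_monomial P D hP s c),
      weightedHomogeneousComponent_of_mem (isWeightedHomogeneous_monomial D s c rfl)]
    split_ifs <;> simp
  | add p q hp hq => rw [map_add, map_add, map_add, map_add, hp, hq]

/-- A variable of weight above `m` cannot occur in a monomial of weighted degree `m`. -/
lemma aeval_mem_adjoin_of_isWeightedHomogeneous {ι : Type*} (P : ι → MvPolynomial (Fin n) ℝ)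
    {D : ι → ℕ} {m : ℕ} {Q : MvPolynomial ι ℝ} (hQ : IsWeightedHomogeneous D Q m) :
    aeval P Q ∈ Algebra.adjoin ℝ (P '' {j | D j ≤ m}) := by
  rw [aeval_def, eval₂_eq]
  refine Subalgebra.sum_mem _ fun s hs => ?_
  refine Subalgebra.mul_mem _ (Subalgebra.algebraMap_mem _ _) ?_
  refine Subalgebra.prod_mem _ fun i hi => Subalgebra.pow_mem _ ?_ _
  refine Algebra.subset_adjoin ⟨i, ?_, rfl⟩
  have h := hQ (mem_support_iff.1 hs)
  exact (Finsupp.le_weight_of_ne_zero' D (Finsupp.mem_support_iff.1 hi)).trans h.le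

namespace IsBasicInvariants

variable {G : Subgroup (OrthGroup n)} {π : Fin n → MvPolynomial (Fin n) ℝ}

lemma mem_invariantRing (hπ : IsBasicInvariants G π) (i : Fin n) : π i ∈ invariantRing G := by
  rw [← hπ.generates]
  exact Algebra.subset_adjoin ⟨i, rfl⟩

/-- A constant member with value c would satisfy the algebraic relation `X i - C c`. -/
lemma totalDegree_pos (hπ : IsBasicInvariants G π) (i : Fin n) : 0 < (π i).totalDegree := by
  rw [Nat.pos_iff_ne_zero]
  intro h
  rw [totalDegree_eq_zero_iff_eq_C] at h
  have h0 : aeval π (X i - C (coeff 0 (π i))) = 0 := by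
    rw [map_sub, aeval_X, ← MvPolynomial.algebraMap_eq, AlgHom.commutes,
      MvPolynomial.algebraMap_eq, ← h, sub_self]
  have h1 := algebraicIndependent_iff.1 hπ.algebraicIndependent _ h0
  have h2 := congrArg (eval fun _ => coeff 0 (π i) + 1) h1
  simp at h2

lemma exists_isWeightedHomogeneous (hπ : IsBasicInvariants G π) {f : MvPolynomial (Fin n) ℝ}
    (hf : f ∈ invariantRing G) {m : ℕ} (hm : f.IsHomogeneous m) :
    ∃ Q : MvPolynomial (Fin n) ℝ,
      IsWeightedHomogeneous (fun i => (π i).totalDegree) Q m ∧ aeval π Q = f := by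
  rw [← hπ.generates, Algebra.adjoin_range_eq_range_aeval] at hf
  obtain ⟨Q, rfl⟩ := hf
  refine ⟨weightedHomogeneousComponent _ m Q,
    weightedHomogeneousComponent_isWeightedHomogeneous m Q, ?_⟩
  rw [← homogeneousComponent_aeval π _ hπ.homogeneous]
  exact (homogeneousComponent_of_mem hm).trans (if_pos rfl)

lemma mem_adjoin_of_isHomogeneous (hπ : IsBasicInvariants G π) {f : MvPolynomial (Fin n) ℝ}
    (hf : f ∈ invariantRing G) {m : ℕ} (hm : f.IsHomogeneous m) :
    f ∈ Algebra.adjoin ℝ (π '' {i | (π i).totalDegree ≤ m}) := by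
  obtain ⟨Q, hQ, rfl⟩ := hπ.exists_isWeightedHomogeneous hf hm
  exact aeval_mem_adjoin_of_isWeightedHomogeneous π hQ

/-- If there are at least `k` homogeneous invariants of degree at most `m` with independent
gradients, then the first `k` basic invariants have degree at most `m`. -/
lemma totalDegree_le_of_family (hπ : IsBasicInvariants G π) {κ : Type*} [Fintype κ]
    (P : κ → MvPolynomial (Fin n) ℝ) (D : κ → ℕ) {m k : ℕ} (hinv : ∀ j, P j ∈ invariantRing G)
    (hhom : ∀ j, (P j).IsHomogeneous (D j)) (hD : ∀ j, D j ≤ m) {a : Space n}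
    (ha : LinearIndependent ℝ fun j => polyGrad (P j) a) (hk : k ≤ Fintype.card κ)
    (i : Fin n) (hi : (i : ℕ) < k) : (π i).totalDegree ≤ m := by
  classical
  by_contra! hlt
  -- If `π i` had degree above `m`, only the `π l` with `l < i` could enter the `P j`, and the
  -- gradients of the `P j` would lie in a space of dimension at most `i < k`.
  have hmem : ∀ j, polyGrad (P j) a ∈
      Submodule.span ℝ ((fun l => polyGrad (π l) a) '' {l | l < i}) := by
    intro j
    refine polyGrad_mem_span_of_mem_adjoin π _ ?_ a
    refine Algebra.adjoin_mono (Set.image_mono ?_)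
      (hπ.mem_adjoin_of_isHomogeneous (hinv j) (hhom j))
    intro l hl
    by_contra hil
    have h1 := hπ.degree_mono (not_lt.1 hil)
    have h2 : (π l).totalDegree ≤ D j := hl
    have h3 := hD j
    simp only at h1
    omega
  have h1 : Fintype.card κ ≤
      finrank ℝ (Submodule.span ℝ ((fun l => polyGrad (π l) a) '' {l | l < i})) := by
    rw [← finrank_span_eq_card ha]
    exact Submodule.finrank_mono (Submodule.span_le.2 (by rintro _ ⟨j, rfl⟩; exact hmem j))
  have h2 : finrank ℝ (Submodule.span ℝ ((fun l => polyGrad (π l) a) '' {l | l < i})) ≤ i := by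
    have h3 := finrank_span_finset_le_card (R := ℝ) ((Finset.Iio i).image fun l => polyGrad (π l) a)
    rw [Finset.coe_image, Finset.coe_Iio] at h3
    refine h3.trans (Finset.card_image_le.trans ?_)
    simp
  omega

end IsBasicInvariants

lemma mem_invariantRing_iff {G : Subgroup (OrthGroup n)} {f : MvPolynomial (Fin n) ℝ} :
    f ∈ invariantRing G ↔ ∀ g ∈ G, ∀ p, evalAt (g p) f = evalAt p f := Iff.rfl

lemma evalAt_map_of_mem {G : Subgroup (OrthGroup n)} {f : MvPolynomial (Fin n) ℝ}
    (hf : f ∈ invariantRing G) {g : OrthGroup n} (hg : g ∈ G) (p : Space n) :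
    evalAt (g p) f = evalAt p f :=
  mem_invariantRing_iff.1 hf g hg p

/-- Differentiate `f ∘ g = f`; orthogonality of `g` replaces the transpose by the inverse. -/
lemma polyGrad_equivariant {G : Subgroup (OrthGroup n)} {f : MvPolynomial (Fin n) ℝ}
    (hf : f ∈ invariantRing G) {g : OrthGroup n} (hg : g ∈ G) (q : Space n) :
    polyGrad f (g q) = g (polyGrad f q) := by
  have h1 : HasFDerivAt (fun x => evalAt (g x) f)
      ((innerSL ℝ (polyGrad f (g q))).comp (g.toContinuousLinearEquiv : Space n →L[ℝ] Space n)) q :=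
    HasFDerivAt.comp q (hasStrictFDerivAt_evalAt f (g q)).hasFDerivAt
      g.toContinuousLinearEquiv.hasFDerivAt
  simp only [evalAt_map_of_mem hf hg] at h1
  have h3 := h1.unique (hasStrictFDerivAt_evalAt f q).hasFDerivAt
  refine ext_inner_right ℝ fun v => ?_
  obtain ⟨u, rfl⟩ := g.surjective v
  rw [g.inner_map_map]
  exact DFunLike.congr_fun h3 u

/-- The gradient of an invariant at a point of a reflecting hyperplane lies in the hyperplane. -/
lemma inner_polyGrad_eq_zero {G : Subgroup (OrthGroup n)} {f : MvPolynomial (Fin n) ℝ}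
    (hf : f ∈ invariantRing G) {v q : Space n} (hv : v ∈ rootSet G) (hq : inner ℝ v q = 0) :
    inner ℝ (polyGrad f q) v = 0 := by
  have h1 : hyperplaneReflection v q = q := by rw [hyperplaneReflection_apply, hq]; simp
  have h2 := polyGrad_equivariant hf hv.2 q
  rw [h1] at h2
  have h3 := (hyperplaneReflection v).inner_map_map (polyGrad f q) v
  rw [← h2, hyperplaneReflection_self v hv.1, inner_neg_right] at h3
  linarith

lemma isHomogeneous_det {m : ℕ} (A : Matrix (Fin m) (Fin m) (MvPolynomial (Fin n) ℝ))
    (e : Fin m → ℕ) (hA : ∀ i j, (A i j).IsHomogeneous (e i)) :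
    A.det.IsHomogeneous (∑ i, e i) := by
  rw [Matrix.det_apply']
  refine IsHomogeneous.sum _ _ _ fun σ _ => ?_
  have h : (∏ i, A (σ i) i).IsHomogeneous (∑ i, e (σ i)) :=
    IsHomogeneous.prod _ _ _ fun i _ => hA _ _
  rw [Equiv.sum_comp σ e] at h
  have h2 := (isHomogeneous_C (Fin n) (((Equiv.Perm.sign σ : ℤ)) : ℝ)).mul h
  simpa using h2

/-- A real vector space is not a finite union of hyperplanes. -/
lemma exists_inner_ne_zero {ι : Type*} [Finite ι] (w : ι → Space n) (hw : ∀ i, w i ≠ 0) :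
    ∃ b : Space n, ∀ i, inner ℝ (w i) b ≠ 0 := by
  obtain ⟨b, -, hb⟩ := Module.Dual.exists_forall_mem_ne_zero_of_forall_exists (⊤ : Submodule ℝ _)
    (fun i => (innerSL ℝ (w i)).toLinearMap)
    (fun i => ⟨w i, trivial, by simpa using hw i⟩)
  exact ⟨b, fun i => by simpa using hb i⟩

lemma evalAt_line (J : MvPolynomial (Fin n) ℝ) (a b : Space n) (t : ℝ) :
    (aeval (fun i => Polynomial.C (a i) + Polynomial.C (b i) * Polynomial.X) J).eval t =
      evalAt (a + t • b) J := by
  have h := DFunLike.congr_fun (MvPolynomial.comp_aeval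
    (fun i => Polynomial.C (a i) + Polynomial.C (b i) * Polynomial.X) (Polynomial.aeval t)) J
  rw [AlgHom.comp_apply, Polynomial.coe_aeval_eq_eval] at h
  rw [h, evalAt, ← MvPolynomial.coe_aeval_eq_eval]
  refine DFunLike.congr_fun (congrArg _ (funext fun i => ?_)) J
  rw [Polynomial.eval_add, Polynomial.eval_mul, Polynomial.eval_C, Polynomial.eval_C,
    Polynomial.eval_X]
  exact congrArg (a i + ·) (mul_comm _ _)

/-- The number of reflections is at most `∑ (dᵢ - 1)`. -/
lemma IsBasicInvariants.card_le_sum {G : Subgroup (OrthGroup n)}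
    {π : Fin n → MvPolynomial (Fin n) ℝ} (hπ : IsBasicInvariants G π) {a : Space n}
    (ha : LinearIndependent ℝ fun i => polyGrad (π i) a) {κ : Type*} [Fintype κ]
    (R : κ → Space n) (hR : ∀ i, R i ∈ rootSet G) (hprop : ∀ i j, i ≠ j → ∀ c : ℝ, R i ≠ c • R j) :
    Fintype.card κ ≤ ∑ i, ((π i).totalDegree - 1) := by
  classical
  -- The Jacobian matrix. Its determinant has degree at most ∑ (dᵢ - 1), does not vanish at `a` and
  -- vanishes on all reflecting hyperplanes. Its zeros on a line are counted below.
  set A : Matrix (Fin n) (Fin n) (MvPolynomial (Fin n) ℝ) :=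
    Matrix.of fun i j => pderiv j (π i) with hA
  have hev : ∀ x, evalAt x A.det = (Matrix.of fun i j => polyGrad (π i) x j).det := by
    intro x
    rw [evalAt, RingHom.map_det]
    rfl
  have hJhom : A.det.IsHomogeneous (∑ i, ((π i).totalDegree - 1)) :=
    isHomogeneous_det A _ fun i j => (hπ.homogeneous i).pderiv
  have hJa : evalAt a A.det ≠ 0 := by
    rw [hev]
    have hli : LinearIndependent ℝ (Matrix.of fun i j => polyGrad (π i) a j).row :=
      ha.map' (WithLp.linearEquiv 2 ℝ (Fin n → ℝ)).toLinearMap (LinearEquiv.ker _)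
    exact ((Matrix.isUnit_iff_isUnit_det _).1
      (Matrix.linearIndependent_rows_iff_isUnit.1 hli)).ne_zero
  -- On the hyperplane of `v` all rows are orthogonal to `v`, so `v` is in the kernel.
  have hJroot : ∀ v ∈ rootSet G, ∀ x, inner ℝ v x = 0 → evalAt x A.det = 0 := by
    intro v hv x hx
    rw [hev]
    refine Matrix.exists_mulVec_eq_zero_iff.1 ⟨fun i => v i, ?_, ?_⟩
    · intro h0
      exact hv.1 (by ext i; exact congrFun h0 i)
    · funext i
      have := inner_polyGrad_eq_zero (hπ.mem_invariantRing i) hv hx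
      rw [inner_eq_sum] at this
      simpa [Matrix.mulVec, dotProduct] using this
  have hRa : ∀ i, inner ℝ (R i) a ≠ 0 := fun i h => hJa (hJroot _ (hR i) a h)
  -- A generic direction: the first kind of vector makes the line `a + t • b` meet every hyperplane,
  -- and the second makes the parameters of different hyperplanes distinct.
  obtain ⟨b, hb⟩ := exists_inner_ne_zero
    (fun o : κ ⊕ {p : κ × κ // p.1 ≠ p.2} => Sum.elim R
      (fun p => inner ℝ (R p.1.1) a • R p.1.2 - inner ℝ (R p.1.2) a • R p.1.1) o) (by
      rintro (i | ⟨⟨i, j⟩, hij⟩)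
      · exact (hR i).1
      · simp only [Sum.elim_inr]
        intro h0
        refine hprop j i hij.symm ((inner ℝ (R i) a)⁻¹ * inner ℝ (R j) a) ?_
        rw [mul_smul, ← sub_eq_zero.1 h0, smul_smul, inv_mul_cancel₀ (hRa i), one_smul])
  have hb1 : ∀ i, inner ℝ (R i) b ≠ 0 := fun i => hb (Sum.inl i)
  have hb2 : ∀ i j, i ≠ j →
      inner ℝ (R i) a * inner ℝ (R j) b ≠ inner ℝ (R j) a * inner ℝ (R i) b := by
    intro i j hij h
    apply hb (Sum.inr ⟨(i, j), hij⟩)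
    simp only [Sum.elim_inr, inner_sub_left, real_inner_smul_left]
    linarith
  set p : Polynomial ℝ :=
    aeval (fun i => Polynomial.C (a i) + Polynomial.C (b i) * Polynomial.X) A.det with hp
  have hp0 : p ≠ 0 := by
    intro h0
    have h1 := evalAt_line A.det a b 0
    rw [← hp, h0] at h1
    apply hJa
    simpa using h1.symm
  have hdeg : p.natDegree ≤ ∑ i, ((π i).totalDegree - 1) := by
    have := MvPolynomial.aeval_natDegree_le A.det hJhom.totalDegree_le
      (fun i => Polynomial.C (a i) + Polynomial.C (b i) * Polynomial.X) (n := 1) fun i => by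
        compute_degree
    simpa using this
  let t : κ → ℝ := fun i => -(inner ℝ (R i) a / inner ℝ (R i) b)
  have ht : Function.Injective t := by
    intro i j hij
    by_contra hne
    apply hb2 i j hne
    have h1 : inner ℝ (R i) a / inner ℝ (R i) b = inner ℝ (R j) a / inner ℝ (R j) b :=
      neg_injective hij
    rwa [div_eq_div_iff (hb1 i) (hb1 j)] at h1
  refine le_trans ?_ hdeg
  rw [← Finset.card_univ, ← Finset.card_image_of_injective _ ht]
  refine Polynomial.card_le_degree_of_subset_roots fun s hs => ?_
  rw [Finset.mem_val, Finset.mem_image] at hs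
  obtain ⟨i, -, rfl⟩ := hs
  rw [Polynomial.mem_roots hp0, Polynomial.IsRoot.def, hp, evalAt_line]
  refine hJroot _ (hR i) _ ?_
  rw [inner_add_right, real_inner_smul_right]
  simp only [t]
  rw [neg_mul, div_mul_cancel₀ _ (hb1 i)]
  ring

end Degrees

/-! ### Complete families of invariants and fibres of basic invariants -/

section Fibres

variable {n : ℕ} {G : Subgroup (OrthGroup n)} {π : Fin n → MvPolynomial (Fin n) ℝ}

lemma linearIndependent_polyGrad_of_span_eq_top (hπ : IsBasicInvariants G π) {a : Space n}
    (h : ∀ v, v ∈ Submodule.span ℝ {w | ∃ f ∈ invariantRing G, w = polyGrad f a}) :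
    LinearIndependent ℝ fun i => polyGrad (π i) a := by
  refine linearIndependent_of_top_le_span_of_card_eq_finrank ?_ (by simp)
  intro v _
  refine Submodule.span_le.2 ?_ (h v)
  rintro _ ⟨f, hf, rfl⟩
  rw [← hπ.generates, ← Set.image_univ] at hf
  rw [← Set.image_univ]
  exact polyGrad_mem_span_of_mem_adjoin π Set.univ hf a

lemma linearIndependent_polyGrad_of_family (hπ : IsBasicInvariants G π) {ι : Type*} [Fintype ι]
    (hcard : Fintype.card ι = n) (P : ι → MvPolynomial (Fin n) ℝ)
    (hinv : ∀ j, P j ∈ invariantRing G) {a : Space n}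
    (ha : LinearIndependent ℝ fun j => polyGrad (P j) a) :
    LinearIndependent ℝ fun i => polyGrad (π i) a := by
  refine linearIndependent_polyGrad_of_span_eq_top hπ fun v => ?_
  have htop := ha.span_eq_top_of_card_eq_finrank' (by simpa using hcard)
  have hv : v ∈ Submodule.span ℝ (Set.range fun j => polyGrad (P j) a) := by rw [htop]; trivial
  refine Submodule.span_mono ?_ hv
  rintro _ ⟨j, rfl⟩
  exact ⟨P j, hinv j, rfl⟩

/-- A family of `n` homogeneous invariants whose gradients are independent at some point and whose
degrees are as small as the number of reflections permits. -/
structure IsCompleteFamily (G : Subgroup (OrthGroup n)) {ι : Type*} [Fintype ι]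
    (P : ι → MvPolynomial (Fin n) ℝ) (D : ι → ℕ) : Prop where
  card_eq : Fintype.card ι = n
  pos : ∀ j, 0 < D j
  mem_invariantRing : ∀ j, P j ∈ invariantRing G
  homogeneous : ∀ j, (P j).IsHomogeneous (D j)
  linearIndependent : ∃ a, LinearIndependent ℝ fun j => polyGrad (P j) a
  sum_le : ∃ (κ : Type) (_ : Fintype κ) (R : κ → Space n), (∀ i, R i ∈ rootSet G) ∧
    (∀ i j, i ≠ j → ∀ c : ℝ, R i ≠ c • R j) ∧ ∑ j, (D j - 1) ≤ Fintype.card κ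

/-- The degrees of the basic invariants are determined by a complete family. -/
theorem IsBasicInvariants.exists_equiv_degree (hπ : IsBasicInvariants G π) {ι : Type*} [Fintype ι]
    {P : ι → MvPolynomial (Fin n) ℝ} {D : ι → ℕ} (hP : IsCompleteFamily G P D) :
    ∃ σ : Fin n ≃ ι, ∀ i, (π i).totalDegree = D (σ i) := by
  classical
  obtain ⟨hcard, hpos, hinv, hhom, ⟨a, ha⟩, κ, _, R, hR, hprop, hsum⟩ := hP
  let e : Fin n ≃ ι := (Fintype.equivFinOfCardEq hcard).symm
  -- Once the `D j` are sorted, the first `i + 1` members of the family bound the degree of `π i`.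
  let σ : Fin n ≃ ι := (Tuple.sort (D ∘ e)).trans e
  have hmono : Monotone (D ∘ σ) := Tuple.monotone_sort (D ∘ e)
  have hle : ∀ i, (π i).totalDegree ≤ D (σ i) := by
    intro i
    refine hπ.totalDegree_le_of_family (fun j : Set.Iic i => P (σ j)) (fun j => D (σ j))
      (fun j => hinv _) (fun j => hhom _) (fun j => hmono j.2) (a := a) (k := i + 1) ?_ ?_ i
      (Nat.lt_succ_self _)
    · exact ha.comp (fun j : Set.Iic i => σ j) (σ.injective.comp Subtype.val_injective)
    · simp
  refine ⟨σ, fun i => ?_⟩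
  -- The number of reflections squeezes the two degree sums, so all termwise inequalities are
  -- equalities. Positivity of the degrees then removes the truncated subtraction.
  have h1 := hπ.card_le_sum (linearIndependent_polyGrad_of_family hπ hcard P hinv ha) R hR hprop
  have h2 : ∑ i, (D (σ i) - 1) = ∑ j, (D j - 1) := Equiv.sum_comp σ fun j => D j - 1
  have h3 : ∀ i ∈ Finset.univ, (π i).totalDegree - 1 ≤ D (σ i) - 1 := fun i _ =>
    Nat.sub_le_sub_right (hle i) 1
  have h4 := (Finset.sum_eq_sum_iff_of_le h3).1
    (le_antisymm (Finset.sum_le_sum h3) (by omega)) i (Finset.mem_univ i)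
  have h5 := hπ.totalDegree_pos i
  have h6 := hpos (σ i)
  omega

/-- The basic invariants are weighted homogeneous polynomials in any complete family. -/
theorem IsBasicInvariants.exists_aeval_eq (hπ : IsBasicInvariants G π) {ι : Type*} [Fintype ι]
    {P : ι → MvPolynomial (Fin n) ℝ} {D : ι → ℕ} (hP : IsCompleteFamily G P D) (i : Fin n) :
    ∃ Q : MvPolynomial ι ℝ, IsWeightedHomogeneous D Q (π i).totalDegree ∧ aeval P Q = π i := by
  obtain ⟨σ, hσ⟩ := hπ.exists_equiv_degree hP
  obtain ⟨-, -, hinv, hhom, ⟨a, ha⟩, -⟩ := hP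
  set d : Fin n → ℕ := fun i => (π i).totalDegree with hd
  set m := d i with hm
  have hindP : AlgebraicIndependent ℝ (P ∘ σ) :=
    algebraicIndependent_of_polyGrad (P ∘ σ) (a := a) (ha.comp σ σ.injective)
  set W := weightedHomogeneousSubmodule ℝ d m with hW
  have hWfin : Module.Finite ℝ W := Module.Finite.iff_fg.2
    (weightedHomogeneousSubmodule_fg (R := ℝ) d (fun j => (hπ.totalDegree_pos j).ne') m)
  let A := W.map (aeval (P ∘ σ) : MvPolynomial (Fin n) ℝ →ₐ[ℝ] _).toLinearMap
  let B := W.map (aeval π : MvPolynomial (Fin n) ℝ →ₐ[ℝ] _).toLinearMap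
  -- `A` and `B` are the images of the same weighted piece under substitution of `P ∘ σ` and of `π`.
  -- Both substitutions are injective, so the inclusion forces equality by dimension.
  have hAB : A ≤ B := by
    rintro _ ⟨Q, hQ, rfl⟩
    have hinvQ : aeval (P ∘ σ) Q ∈ invariantRing G := by
      have h1 : aeval (P ∘ σ) Q ∈ Algebra.adjoin ℝ (Set.range (P ∘ σ)) := by
        rw [Algebra.adjoin_range_eq_range_aeval]; exact ⟨Q, rfl⟩
      refine Algebra.adjoin_le ?_ h1
      rintro _ ⟨j, rfl⟩
      exact hinv _
    have hhomQ : (aeval (P ∘ σ) Q).IsHomogeneous m := by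
      have h1 := homogeneousComponent_aeval (P ∘ σ) d
        (fun j => by rw [hd]; simp only [hσ]; exact hhom _) m Q
      rw [weightedHomogeneousComponent_eq_self hQ] at h1
      rw [← h1]
      exact homogeneousComponent_isHomogeneous m _
    obtain ⟨Q', hQ', h'⟩ := hπ.exists_isWeightedHomogeneous hinvQ hhomQ
    exact ⟨Q', hQ', h'⟩
  have hrankA : finrank ℝ A = finrank ℝ W :=
    (Submodule.equivMapOfInjective (aeval (P ∘ σ)).toLinearMap (by exact hindP) W).finrank_eq.symm
  have hrankB : finrank ℝ B = finrank ℝ W :=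
    (Submodule.equivMapOfInjective (aeval π).toLinearMap
      (by exact hπ.algebraicIndependent) W).finrank_eq.symm
  have hBfin : Module.Finite ℝ B := Module.Finite.map W _
  have hEq : A = B := Submodule.eq_of_le_of_finrank_eq hAB (hrankA.trans hrankB.symm)
  have hi : π i ∈ B := ⟨X i, isWeightedHomogeneous_X ℝ d i, by simp⟩
  rw [← hEq] at hi
  obtain ⟨Q, -, hQ⟩ := hi
  refine ⟨weightedHomogeneousComponent D m (rename σ Q),
    weightedHomogeneousComponent_isWeightedHomogeneous m _, ?_⟩
  rw [← homogeneousComponent_aeval P D hhom, aeval_rename]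
  have hQ' : aeval (P ∘ σ) Q = π i := hQ
  rw [hQ']
  exact (homogeneousComponent_of_mem (hπ.homogeneous i)).trans (if_pos rfl)

lemma mem_of_evalAt_eq {k : ℕ} {X : Set (Space n)} {S : Finset (MvPolynomial (Fin n) ℝ)}
    (hS : ∀ f ∈ S, f ∈ Algebra.adjoin ℝ (π '' {i : Fin n | (i : ℕ) < k})) (hX : X = realZeros S)
    {p q : Space n} (hp : p ∈ X) (h : ∀ i : Fin n, (i : ℕ) < k → evalAt q (π i) = evalAt p (π i)) :
    q ∈ X := by
  rw [hX] at hp ⊢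
  intro f hf
  rw [evalAt_eq_of_mem_adjoin π _ (hS f hf) h]
  exact hp f hf

/-- Every common fibre of the first `k` basic invariants meets
the stratum `k`. -/
def FibresMeetStratum (G : Subgroup (OrthGroup n)) (k : ℕ) : Prop :=
  ∀ π : Fin n → MvPolynomial (Fin n) ℝ, IsBasicInvariants G π → ∀ p : Space n,
    ∃ q ∈ stratum G k, ∀ i : Fin n, (i : ℕ) < k → evalAt q (π i) = evalAt p (π i)

lemma FibresMeetStratum.nonempty {k : ℕ} (h : FibresMeetStratum G k) {X : Set (Space n)}
    (hne : X.Nonempty) (hX : IsSparse G k X) : (X ∩ stratum G k).Nonempty := by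
  obtain ⟨π, hπ, S, hS, hXS⟩ := hX
  obtain ⟨p, hp⟩ := hne
  obtain ⟨q, hq, heq⟩ := h π hπ p
  exact ⟨q, mem_of_evalAt_eq hS hXS hp heq, hq⟩

lemma fibresMeetStratum_top (G : Subgroup (OrthGroup n)) : FibresMeetStratum G n :=
  fun _ _ p => ⟨p, mem_stratum_top G p, fun _ _ => rfl⟩

/-- Given a complete family, the first `k` basic invariants are
constant on the common fibres of the members of degree at most `m` of the family, if there are at
least `k` of them. -/
theorem IsBasicInvariants.evalAt_eq_of_family (hπ : IsBasicInvariants G π) {ι : Type*} [Fintype ι]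
    {P : ι → MvPolynomial (Fin n) ℝ} {D : ι → ℕ} (hP : IsCompleteFamily G P D)
    {k m : ℕ} {κ' : Type*} [Fintype κ'] (s : κ' → ι)
    (hs : Function.Injective s) (hsm : ∀ j, D (s j) ≤ m) (hk : k ≤ Fintype.card κ')
    {p q : Space n} (hpq : ∀ j, D j ≤ m → evalAt q (P j) = evalAt p (P j))
    (i : Fin n) (hi : (i : ℕ) < k) : evalAt q (π i) = evalAt p (π i) := by
  obtain ⟨a, ha⟩ := hP.linearIndependent
  have hdeg : (π i).totalDegree ≤ m :=
    hπ.totalDegree_le_of_family (fun j => P (s j)) (fun j => D (s j))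
      (fun j => hP.mem_invariantRing _) (fun j => hP.homogeneous _) hsm (ha.comp s hs) hk i hi
  obtain ⟨Q, hQ, hQi⟩ := hπ.exists_aeval_eq hP i
  rw [← hQi]
  refine evalAt_eq_of_mem_adjoin P _ (aeval_mem_adjoin_of_isWeightedHomogeneous P hQ) ?_
  intro j hj
  exact hpq j (le_trans hj hdeg)

end Fibres

/-! ### Invariants of degree at most two -/

section LowDegree

variable {n : ℕ} {G : Subgroup (OrthGroup n)}

/-- Euler's identity. -/
lemma inner_polyGrad_self {f : MvPolynomial (Fin n) ℝ} {m : ℕ} (hf : f.IsHomogeneous m)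
    (x : Space n) : inner ℝ x (polyGrad f x) = m * evalAt x f := by
  have h := congrArg (evalAt x) hf.sum_X_mul_pderiv
  rw [evalAt_sum, nsmul_eq_mul, evalAt_mul] at h
  simp only [evalAt_mul] at h
  rw [inner_eq_sum]
  have h1 : evalAt x (m : MvPolynomial (Fin n) ℝ) = m := by simp [evalAt]
  rw [← h1, ← h]
  refine Finset.sum_congr rfl fun i _ => ?_
  simp [evalAt, polyGrad]

lemma evalAt_const_of_isHomogeneous_zero {f : MvPolynomial (Fin n) ℝ} (hf : f.IsHomogeneous 0)
    (x y : Space n) : evalAt x f = evalAt y f := by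
  rw [totalDegree_eq_zero_iff_eq_C.1 (Nat.le_zero.1 hf.totalDegree_le), evalAt_C, evalAt_C]

lemma polyGrad_const_of_isHomogeneous_one {f : MvPolynomial (Fin n) ℝ} (hf : f.IsHomogeneous 1)
    (x y : Space n) : polyGrad f x = polyGrad f y := by
  ext i
  exact evalAt_const_of_isHomogeneous_zero (hf.pderiv (i := i)) x y

lemma evalAt_eq_inner_of_isHomogeneous_one {f : MvPolynomial (Fin n) ℝ} (hf : f.IsHomogeneous 1)
    (x : Space n) : evalAt x f = inner ℝ (polyGrad f 0) x := by
  have h := inner_polyGrad_self hf x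
  rw [polyGrad_const_of_isHomogeneous_one hf x 0, real_inner_comm] at h
  simpa using h.symm

lemma polyGrad_add_point {f : MvPolynomial (Fin n) ℝ} (hf : f.IsHomogeneous 2) (x y : Space n) :
    polyGrad f (x + y) = polyGrad f x + polyGrad f y := by
  ext i
  change evalAt (x + y) (pderiv i f) = evalAt x (pderiv i f) + evalAt y (pderiv i f)
  simp only [evalAt_eq_inner_of_isHomogeneous_one (hf.pderiv (i := i)), inner_add_right]

lemma polyGrad_smul_point {f : MvPolynomial (Fin n) ℝ} (hf : f.IsHomogeneous 2) (c : ℝ)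
    (x : Space n) : polyGrad f (c • x) = c • polyGrad f x := by
  ext i
  change evalAt (c • x) (pderiv i f) = c * evalAt x (pderiv i f)
  simp only [evalAt_eq_inner_of_isHomogeneous_one (hf.pderiv (i := i)), real_inner_smul_right]

lemma mem_fixedSubspace_iff {x : Space n} : x ∈ fixedSubspace G ↔ ∀ g ∈ G, g x = x := Iff.rfl

lemma inner_eq_zero_of_mem_fixedSubspace {x v : Space n} (hx : x ∈ fixedSubspace G)
    (hv : v ∈ rootSet G) : inner ℝ v x = 0 := by
  have h := mem_fixedSubspace_iff.1 hx _ hv.2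
  have h2 := (hyperplaneReflection v).inner_map_map v x
  rw [h, hyperplaneReflection_self v hv.1, inner_neg_left] at h2
  linarith

lemma linForm_mem_invariantRing {v : Space n} (hv : v ∈ fixedSubspace G) :
    linForm v ∈ invariantRing G := by
  rw [mem_invariantRing_iff]
  intro g hg p
  rw [evalAt_linForm, evalAt_linForm]
  conv_lhs => rw [← mem_fixedSubspace_iff.1 hv g hg]
  rw [g.inner_map_map]

/-- A linear invariant does not change along vectors orthogonal to the fixed subspace. -/
lemma evalAt_eq_of_sub_mem {f : MvPolynomial (Fin n) ℝ} (hf : f ∈ invariantRing G) {m : ℕ}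
    (hm : f.IsHomogeneous m) (hm1 : m ≤ 1) {x y : Space n} (h : x - y ∈ (fixedSubspace G)ᗮ) :
    evalAt x f = evalAt y f := by
  interval_cases m
  · exact evalAt_const_of_isHomogeneous_zero hm x y
  · have hc : polyGrad f 0 ∈ fixedSubspace G := by
      rw [mem_fixedSubspace_iff]
      intro g hg
      rw [← polyGrad_equivariant hf hg, map_zero]
    rw [evalAt_eq_inner_of_isHomogeneous_one hm, evalAt_eq_inner_of_isHomogeneous_one hm,
      ← sub_eq_zero, ← inner_sub_right]
    exact (Submodule.mem_orthogonal _ _).1 h _ hc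

/-- An orthonormal basis of the fixed subspace, in the ambient space. -/
noncomputable def fixedBasis (G : Subgroup (OrthGroup n)) :
    Fin (finrank ℝ (fixedSubspace G)) → Space n :=
  fun l => (stdOrthonormalBasis ℝ (fixedSubspace G) l : Space n)

lemma fixedBasis_mem (l : Fin (finrank ℝ (fixedSubspace G))) : fixedBasis G l ∈ fixedSubspace G :=
  (stdOrthonormalBasis ℝ (fixedSubspace G) l).2

lemma orthonormal_fixedBasis : Orthonormal ℝ (fixedBasis G) :=
  (stdOrthonormalBasis ℝ (fixedSubspace G)).orthonormal.comp_linearIsometry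
    (fixedSubspace G).subtypeₗᵢ

lemma mem_orthogonal_of_inner_fixedBasis {x : Space n} (h : ∀ l, inner ℝ (fixedBasis G l) x = 0) :
    x ∈ (fixedSubspace G)ᗮ := by
  rw [Submodule.mem_orthogonal]
  intro u hu
  have h1 := (stdOrthonormalBasis ℝ (fixedSubspace G)).sum_repr ⟨u, hu⟩
  have h2 : u = ∑ l, (stdOrthonormalBasis ℝ (fixedSubspace G)).repr ⟨u, hu⟩ l • fixedBasis G l := by
    have := congrArg (fixedSubspace G).subtype h1
    rw [map_sum] at this
    exact this.symm
  rw [h2, sum_inner]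
  refine Finset.sum_eq_zero fun l _ => ?_
  rw [real_inner_smul_left, h l, mul_zero]

/-- The polynomial `‖x‖²`. -/
noncomputable def normSqPoly (n : ℕ) : MvPolynomial (Fin n) ℝ := ∑ i, X i ^ 2

lemma evalAt_normSqPoly (x : Space n) : evalAt x (normSqPoly n) = inner ℝ x x := by
  rw [inner_eq_sum, normSqPoly, evalAt_sum]
  exact Finset.sum_congr rfl fun i _ => by simp [evalAt, sq]

lemma isHomogeneous_normSqPoly : (normSqPoly n).IsHomogeneous 2 :=
  IsHomogeneous.sum _ _ _ fun i _ => by simpa using (isHomogeneous_X ℝ i).pow 2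

lemma normSqPoly_mem_invariantRing : normSqPoly n ∈ invariantRing G := by
  rw [mem_invariantRing_iff]
  intro g _ p
  rw [evalAt_normSqPoly, evalAt_normSqPoly, g.inner_map_map]

lemma polyGrad_normSqPoly (x : Space n) : polyGrad (normSqPoly n) x = (2 : ℝ) • x := by
  rw [normSqPoly, polyGrad_sum]
  ext j
  simp only [polyGrad_pow, polyGrad_X]
  simp [evalAt, Pi.single_apply]

lemma IsBasicInvariants.totalDegree_le_one {π : Fin n → MvPolynomial (Fin n) ℝ}
    (hπ : IsBasicInvariants G π) (i : Fin n) (hi : (i : ℕ) < finrank ℝ (fixedSubspace G)) :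
    (π i).totalDegree ≤ 1 := by
  refine hπ.totalDegree_le_of_family (fun l => linForm (fixedBasis G l)) (fun _ => 1)
    (fun l => linForm_mem_invariantRing (fixedBasis_mem l)) (fun l => isHomogeneous_linForm _)
    (fun _ => le_rfl) (a := 0) ?_ (by simp) i hi
  simp only [polyGrad_linForm]
  exact orthonormal_fixedBasis.linearIndependent

/-- The squared norm joins the linear invariants: at a nonzero point `a` orthogonal to V^G its
gradient `2 • a` is independent of their gradients, which lie in V^G. -/
lemma IsBasicInvariants.totalDegree_le_two {π : Fin n → MvPolynomial (Fin n) ℝ}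
    (hπ : IsBasicInvariants G π) (i : Fin n) (hi : (i : ℕ) ≤ finrank ℝ (fixedSubspace G)) :
    (π i).totalDegree ≤ 2 := by
  rcases hi.lt_or_eq with hlt | heq
  · exact (hπ.totalDegree_le_one i hlt).trans (by norm_num)
  obtain ⟨a, ha, ha0⟩ : ∃ a ∈ (fixedSubspace G)ᗮ, a ≠ 0 := by
    refine Submodule.exists_mem_ne_zero_of_ne_bot fun hbot => ?_
    have h1 := Submodule.finrank_add_finrank_orthogonal (fixedSubspace G)
    rw [hbot, finrank_bot, finrank_euclideanSpace_fin] at h1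
    have := i.2
    omega
  refine hπ.totalDegree_le_of_family
    (fun o : Option (Fin (finrank ℝ (fixedSubspace G))) =>
      o.elim (normSqPoly n) fun l => linForm (fixedBasis G l)) (fun o => o.elim 2 fun _ => 1)
    ?_ ?_ ?_ (a := a) (k := finrank ℝ (fixedSubspace G) + 1) ?_ (by simp) i (by omega)
  · rintro (_ | l)
    · exact normSqPoly_mem_invariantRing
    · exact linForm_mem_invariantRing (fixedBasis_mem l)
  · rintro (_ | l)
    · exact isHomogeneous_normSqPoly
    · exact isHomogeneous_linForm _
  · rintro (_ | l) <;> simp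
  · rw [linearIndependent_option]
    constructor
    · have : ((fun o : Option (Fin (finrank ℝ (fixedSubspace G))) => polyGrad
          (o.elim (normSqPoly n) fun l => linForm (fixedBasis G l)) a) ∘ some) = fixedBasis G := by
        funext l; simp [polyGrad_linForm]
      rw [this]
      exact orthonormal_fixedBasis.linearIndependent
    · intro hmem
      have hsub : polyGrad (normSqPoly n) a ∈ fixedSubspace G := by
        refine Submodule.span_le.2 ?_ hmem
        rintro _ ⟨l, rfl⟩
        simp only [Function.comp_apply, Option.elim_some, polyGrad_linForm]
        exact fixedBasis_mem l
      rw [polyGrad_normSqPoly] at hsub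
      have h0 := (Submodule.mem_orthogonal _ _).1 ha _ hsub
      rw [real_inner_smul_left] at h0
      exact ha0 (inner_self_eq_zero.1 (by linarith : inner ℝ a a = 0))

variable {B : Type} {α : B → Space n}

lemma mem_rootSet_of_closure
    (hG : G = Subgroup.closure (Set.range fun i => hyperplaneReflection (α i)))
    (hα : ∀ i, α i ≠ 0) (i : B) : α i ∈ rootSet G :=
  ⟨hα i, by rw [hG]; exact Subgroup.subset_closure ⟨i, rfl⟩⟩

lemma fixedSubspace_eq (hG : G = Subgroup.closure (Set.range fun i => hyperplaneReflection (α i)))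
    (hα : ∀ i, α i ≠ 0) : fixedSubspace G = (Submodule.span ℝ (Set.range α))ᗮ := by
  ext x
  rw [mem_orthogonal_span_iff]
  constructor
  · rintro hx _ ⟨i, rfl⟩
    exact inner_eq_zero_of_mem_fixedSubspace hx (mem_rootSet_of_closure hG hα i)
  · intro hx
    rw [mem_fixedSubspace_iff]
    intro g hg
    rw [hG] at hg
    induction hg using Subgroup.closure_induction with
    | mem g hg =>
      obtain ⟨i, rfl⟩ := hg
      rw [hyperplaneReflection_apply, hx _ ⟨i, rfl⟩]
      simp
    | one => rfl
    | mul g h _ _ hg hh => exact (congrArg g hh).trans hg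
    | inv g _ hg =>
      conv_lhs => rw [← hg]
      exact g.symm_apply_apply x

lemma orthogonal_fixedSubspace_eq
    (hG : G = Subgroup.closure (Set.range fun i => hyperplaneReflection (α i)))
    (hα : ∀ i, α i ≠ 0) : (fixedSubspace G)ᗮ = Submodule.span ℝ (Set.range α) := by
  rw [fixedSubspace_eq hG hα, Submodule.orthogonal_orthogonal]

lemma exists_decomposition (G : Subgroup (OrthGroup n)) (p : Space n) :
    ∃ z ∈ fixedSubspace G, ∃ y ∈ (fixedSubspace G)ᗮ, p = z + y :=
  let ⟨z, hz, y, hy, h⟩ := (fixedSubspace G).exists_add_mem_mem_orthogonal p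
  ⟨z, hz, y, hy, h⟩

/-- Invariants of degree at most one do not see the component orthogonal to V^G. Removing it leads
to a point of V^G, and V^G is the common intersection of the simple hyperplanes. -/
theorem fibresMeetStratum_finrank_fixedSubspace
    (hG : G = Subgroup.closure (Set.range fun i => hyperplaneReflection (α i)))
    (hα : ∀ i, α i ≠ 0) : FibresMeetStratum G (finrank ℝ (fixedSubspace G)) := by
  intro π hπ p
  obtain ⟨z, hz, y, hy, rfl⟩ := exists_decomposition G p
  refine ⟨z, ?_, fun i hi => ?_⟩
  · refine mem_stratum_of_finrank_le (by simpa using Submodule.finrank_le (fixedSubspace G)) ?_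
    rw [fixedSubspace_eq hG hα]
    refine Submodule.finrank_mono (Submodule.orthogonal_le (Submodule.span_mono ?_))
    rintro _ ⟨i, rfl⟩
    have hi := mem_rootSet_of_closure hG hα i
    exact ⟨hi, inner_eq_zero_of_mem_fixedSubspace hz hi⟩
  · refine evalAt_eq_of_sub_mem (hπ.mem_invariantRing i) (hπ.homogeneous i)
      (hπ.totalDegree_le_one i hi) ?_
    rw [sub_add_cancel_left]
    exact Submodule.neg_mem _ hy

/-- Roots are eigenvectors of the linear map defined by a quadratic invariant. -/
lemma exists_polyGrad_eq_smul {f : MvPolynomial (Fin n) ℝ} (hf : f ∈ invariantRing G)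
    (h2 : f.IsHomogeneous 2) {v : Space n} (hv : v ∈ rootSet G) :
    ∃ c : ℝ, polyGrad f v = c • v := by
  have h := polyGrad_equivariant hf hv.2 v
  rw [hyperplaneReflection_self v hv.1, ← neg_one_smul ℝ v, polyGrad_smul_point h2,
    hyperplaneReflection_apply, neg_one_smul] at h
  set w := polyGrad f v
  set c := 2 * inner ℝ v w / inner ℝ v v
  refine ⟨c / 2, ?_⟩
  have h3 : (2 : ℝ) • w = c • v := by
    rw [two_smul]
    have : c • v = w + w := by
      rw [neg_eq_iff_eq_neg] at h
      nth_rewrite 1 [h]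
      abel
    rw [this]
  rw [div_eq_inv_mul, mul_smul, ← h3, smul_smul]
  norm_num

/-- The gradient of a quadratic invariant is linear and preserves V^G. If it also keeps `y` in the
complement, the mixed terms in Euler's identity vanish. -/
lemma two_mul_evalAt {f : MvPolynomial (Fin n) ℝ} (hf : f ∈ invariantRing G)
    (h2 : f.IsHomogeneous 2) {z y : Space n} (hz : z ∈ fixedSubspace G)
    (hy : y ∈ (fixedSubspace G)ᗮ) (hLy : polyGrad f y ∈ (fixedSubspace G)ᗮ) :
    2 * evalAt (z + y) f = inner ℝ z (polyGrad f z) + inner ℝ y (polyGrad f y) := by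
  have h := inner_polyGrad_self h2 (z + y)
  have hLz : polyGrad f z ∈ fixedSubspace G := by
    rw [mem_fixedSubspace_iff]
    intro g hg
    rw [← polyGrad_equivariant hf hg, mem_fixedSubspace_iff.1 hz g hg]
  rw [polyGrad_add_point h2, inner_add_left, inner_add_right, inner_add_right,
    (Submodule.mem_orthogonal _ _).1 hLy z hz, real_inner_comm,
    real_inner_comm (polyGrad f z) y, (Submodule.mem_orthogonal _ _).1 hy _ hLz] at h
  rw [real_inner_comm] at h
  push_cast at h
  linarith

/-- The Coxeter graph of the family `α` is connected. -/
def IsConnectedFamily (α : B → Space n) : Prop :=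
  ∀ c : B → ℝ, (∀ i j, inner ℝ (α i) (α j) ≠ 0 → c i = c j) → ∀ i j, c i = c j

/-- An instance of Schur's lemma. The simple roots are eigenvectors of the gradient map;
equivariance under the reflection in `α i`, applied to `α j`, equates the two eigenvalues along each
edge of the Coxeter graph. -/
lemma exists_polyGrad_eq_smul_of_connected
    (hG : G = Subgroup.closure (Set.range fun i => hyperplaneReflection (α i)))
    (hα : ∀ i, α i ≠ 0) (hconn : IsConnectedFamily α) {f : MvPolynomial (Fin n) ℝ}
    (hf : f ∈ invariantRing G) (h2 : f.IsHomogeneous 2) :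
    ∃ c : ℝ, ∀ y ∈ (fixedSubspace G)ᗮ, polyGrad f y = c • y := by
  choose c hc using fun i => exists_polyGrad_eq_smul hf h2 (mem_rootSet_of_closure hG hα i)
  have hcc : ∀ i j, c i = c j := by
    refine hconn c fun i j hij => ?_
    have h := polyGrad_equivariant hf (mem_rootSet_of_closure hG hα i).2 (α j)
    have hne : 2 * inner ℝ (α i) (α j) / inner ℝ (α i) (α i) ≠ 0 :=
      div_ne_zero (mul_ne_zero two_ne_zero hij) (inner_self_ne_zero.2 (hα i))
    rw [hc j, map_smul, hyperplaneReflection_apply] at h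
    set t := 2 * inner ℝ (α i) (α j) / inner ℝ (α i) (α i)
    rw [sub_eq_add_neg, ← neg_smul, polyGrad_add_point h2, polyGrad_smul_point h2, hc, hc,
      smul_add, add_right_inj, smul_smul, smul_smul] at h
    have h' : -t * c i = c j * -t := smul_left_injective ℝ (hα i) h
    have : t * (c i - c j) = 0 := by linarith
    rcases mul_eq_zero.1 this with h0 | h0
    · exact absurd h0 hne
    · linarith
  rw [orthogonal_fixedSubspace_eq hG hα]
  rcases isEmpty_or_nonempty B with hB | ⟨⟨b⟩⟩
  · refine ⟨0, fun y hy => ?_⟩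
    rw [Set.range_eq_empty, Submodule.span_empty, Submodule.mem_bot] at hy
    rw [hy, smul_zero, ← zero_smul ℝ (0 : Space n), polyGrad_smul_point h2, zero_smul, zero_smul]
  · refine ⟨c b, fun y hy => ?_⟩
    induction hy using Submodule.span_induction with
    | mem v hv => obtain ⟨i, rfl⟩ := hv; rw [hc, hcc i b]
    | zero => rw [smul_zero, ← zero_smul ℝ (0 : Space n), polyGrad_smul_point h2, zero_smul,
        zero_smul]
    | add x y _ _ hx hy => rw [polyGrad_add_point h2, hx, hy, smul_add]
    | smul t x _ hx => rw [polyGrad_smul_point h2, hx, smul_comm]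

lemma evalAt_eq_of_norm_eq
    (hG : G = Subgroup.closure (Set.range fun i => hyperplaneReflection (α i)))
    (hα : ∀ i, α i ≠ 0) (hconn : IsConnectedFamily α) {f : MvPolynomial (Fin n) ℝ}
    (hf : f ∈ invariantRing G) {m : ℕ} (hm : f.IsHomogeneous m) (hm2 : m ≤ 2) {z y y' : Space n}
    (hz : z ∈ fixedSubspace G) (hy : y ∈ (fixedSubspace G)ᗮ) (hy' : y' ∈ (fixedSubspace G)ᗮ)
    (hn : inner ℝ y' y' = inner ℝ y y) : evalAt (z + y') f = evalAt (z + y) f := by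
  rcases hm2.lt_or_eq with h1 | rfl
  · refine evalAt_eq_of_sub_mem hf hm (by omega) ?_
    rw [add_sub_add_left_eq_sub]
    exact Submodule.sub_mem _ hy' hy
  · obtain ⟨c, hc⟩ := exists_polyGrad_eq_smul_of_connected hG hα hconn hf hm
    have e1 := two_mul_evalAt hf hm hz hy (by rw [hc y hy]; exact Submodule.smul_mem _ _ hy)
    have e2 := two_mul_evalAt hf hm hz hy' (by rw [hc y' hy']; exact Submodule.smul_mem _ _ hy')
    rw [hc y hy, real_inner_smul_right] at e1
    rw [hc y' hy', real_inner_smul_right, hn] at e2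
    linarith

/-- All relevant invariants have degree at most two and depend only on the component in V^G and on
the norm of the other component. The latter can thus be replaced by a vector of the same norm on a
suitable flat. -/
theorem fibresMeetStratum_finrank_add_one
    (hG : G = Subgroup.closure (Set.range fun i => hyperplaneReflection (α i)))
    (hα : ∀ i, α i ≠ 0) (hconn : IsConnectedFamily α)
    (hn : finrank ℝ (fixedSubspace G) + 1 ≤ n) :
    FibresMeetStratum G (finrank ℝ (fixedSubspace G) + 1) := by
  intro π hπ p
  obtain ⟨z, hz, y, hy, rfl⟩ := exists_decomposition G p
  -- A flat one dimension larger than V^G, cut out by simple roots. It contains a vector outside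
  -- V^G, whose component `w` orthogonal to V^G spans the required ray.
  obtain ⟨c, hcα, hc⟩ := exists_finset_finrank_orthogonal_eq (Set.range α) hn (by
    rw [fixedSubspace_eq hG hα]; omega)
  obtain ⟨x, hxc, hxf⟩ : ∃ x ∈ (Submodule.span ℝ (c : Set (Space n)))ᗮ, x ∉ fixedSubspace G := by
    by_contra! hcon
    have := Submodule.finrank_mono (show (Submodule.span ℝ (c : Set (Space n)))ᗮ ≤ _ from hcon)
    omega
  obtain ⟨z', hz', w, hw, rfl⟩ := exists_decomposition G x
  have hw0 : w ≠ 0 := by rintro rfl; exact hxf (by simpa using hz')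
  have hcroot : ∀ v ∈ c, v ∈ rootSet G := by
    intro v hv
    obtain ⟨i, rfl⟩ := hcα hv
    exact mem_rootSet_of_closure hG hα i
  rw [mem_orthogonal_span_iff] at hxc
  have hcw : ∀ v ∈ c, inner ℝ v w = 0 := by
    intro v hv
    have := hxc v hv
    rwa [inner_add_right, inner_eq_zero_of_mem_fixedSubspace hz' (hcroot v hv), zero_add] at this
  refine ⟨z + (‖y‖ / ‖w‖) • w, ?_, fun i hi => ?_⟩
  · refine mem_stratum_of_finrank_le hn (le_trans ?_ hc.le)
    refine Submodule.finrank_mono (Submodule.orthogonal_le (Submodule.span_mono ?_))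
    intro v hv
    refine ⟨hcroot v hv, ?_⟩
    rw [inner_add_right, real_inner_smul_right, hcw v hv,
      inner_eq_zero_of_mem_fixedSubspace hz (hcroot v hv)]
    simp
  · refine evalAt_eq_of_norm_eq hG hα hconn (hπ.mem_invariantRing i) (hπ.homogeneous i)
      (hπ.totalDegree_le_two i (by omega)) hz hy (Submodule.smul_mem _ _ hw) ?_
    rw [real_inner_self_eq_norm_sq, real_inner_self_eq_norm_sq, norm_smul, norm_div, norm_norm,
      norm_norm, div_mul_cancel₀ _ (norm_ne_zero_iff.2 hw0)]

lemma mem_stratum_of_root {k : ℕ} (hk : k + 1 = n) {v q : Space n} (hv : v ∈ rootSet G)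
    (hq : inner ℝ v q = 0) : q ∈ stratum G k := by
  refine mem_stratum_of_finrank_le (by omega) ?_
  have h1 := Submodule.finrank_add_finrank_orthogonal
    (Submodule.span ℝ {v | v ∈ rootSet G ∧ inner ℝ v q = 0})
  rw [finrank_euclideanSpace_fin] at h1
  have h2 : 0 < finrank ℝ (Submodule.span ℝ {v | v ∈ rootSet G ∧ inner ℝ v q = 0}) := by
    rw [Nat.pos_iff_ne_zero]
    intro h0
    rw [Submodule.finrank_eq_zero, Submodule.span_eq_bot] at h0
    exact hv.1 (h0 v ⟨hv, hq⟩)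
  omega

/-- The reducible group of rank two. -/
theorem fibresMeetStratum_of_orthogonal_pair {α β : Space n} (hα : inner ℝ α α = (1 : ℝ))
    (hβ : inner ℝ β β = (1 : ℝ)) (hαβ : inner ℝ α β = (0 : ℝ))
    (hG : G = Subgroup.closure (Set.range fun i => hyperplaneReflection (![α, β] i)))
    {k : ℕ} (hk : k + 1 = n) (hkf : k = finrank ℝ (fixedSubspace G) + 1) :
    FibresMeetStratum G k := by
  intro π hπ p
  have hα0 : α ≠ 0 := by rintro rfl; simp at hα
  have hβ0 : β ≠ 0 := by rintro rfl; simp at hβ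
  have hne : ∀ i, (![α, β] : Fin 2 → Space n) i ≠ 0 := by
    intro i; fin_cases i
    · exact hα0
    · exact hβ0
  have hαr : α ∈ rootSet G := mem_rootSet_of_closure hG hne 0
  have hβr : β ∈ rootSet G := mem_rootSet_of_closure hG hne 1
  obtain ⟨z, hz, y, hy, rfl⟩ := exists_decomposition G p
  have hspan := orthogonal_fixedSubspace_eq hG hne
  rw [Matrix.range_cons, Matrix.range_cons, Matrix.range_empty, Set.union_empty,
    Set.singleton_union] at hspan
  rw [hspan, Submodule.mem_span_pair] at hy
  obtain ⟨a, b, rfl⟩ := hy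
  have hmem : ∀ s t : ℝ, s • α + t • β ∈ (fixedSubspace G)ᗮ := by
    intro s t
    rw [hspan, Submodule.mem_span_pair]
    exact ⟨s, t, rfl⟩
  have hzα := inner_eq_zero_of_mem_fixedSubspace hz hαr
  have hzβ := inner_eq_zero_of_mem_fixedSubspace hz hβr
  have hlow : ∀ i : Fin n, (π i).totalDegree ≤ 1 → ∀ s t : ℝ,
      evalAt (z + (s • α + t • β)) (π i) = evalAt (z + (a • α + b • β)) (π i) := by
    intro i hi s t
    refine evalAt_eq_of_sub_mem (hπ.mem_invariantRing i) (hπ.homogeneous i) hi ?_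
    rw [add_sub_add_left_eq_sub]
    exact Submodule.sub_mem _ (hmem _ _) (hmem _ _)
  suffices h : ∃ s t : ℝ, (s = 0 ∨ t = 0) ∧ ∀ i : Fin n, (i : ℕ) < k →
      evalAt (z + (s • α + t • β)) (π i) = evalAt (z + (a • α + b • β)) (π i) by
    obtain ⟨s, t, hst, h⟩ := h
    refine ⟨_, ?_, h⟩
    rcases hst with rfl | rfl
    · refine mem_stratum_of_root hk hαr ?_
      simp [inner_add_right, real_inner_smul_right, hzα, hαβ]
    · refine mem_stratum_of_root hk hβr ?_
      simp [inner_add_right, real_inner_smul_right, hzβ, real_inner_comm, hαβ]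
  set i₀ : Fin n := ⟨finrank ℝ (fixedSubspace G), by omega⟩ with hi₀
  have hother : ∀ i : Fin n, (i : ℕ) < k → i ≠ i₀ → (π i).totalDegree ≤ 1 := by
    intro i hi hne
    refine hπ.totalDegree_le_one i ?_
    have : (i : ℕ) ≠ finrank ℝ (fixedSubspace G) := fun h => hne (Fin.ext h)
    omega
  have hdeg := hπ.totalDegree_le_two i₀ le_rfl
  -- In degree below two none of the first `k` invariants sees the plane of the roots, and `z`
  -- itself serves.
  rcases hdeg.lt_or_eq with h1 | h2
  · refine ⟨0, 0, Or.inl rfl, fun i hi => hlow i ?_ 0 0⟩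
    by_cases h : i = i₀
    · rw [h]; omega
    · exact hother i hi h
  · have hf := hπ.mem_invariantRing i₀
    have hhom := hπ.homogeneous i₀
    rw [h2] at hhom
    obtain ⟨l, hl⟩ := exists_polyGrad_eq_smul hf hhom hαr
    obtain ⟨m, hm⟩ := exists_polyGrad_eq_smul hf hhom hβr
    have hval : ∀ s t : ℝ, 2 * evalAt (z + (s • α + t • β)) (π i₀) =
        inner ℝ z (polyGrad (π i₀) z) + (l * s ^ 2 + m * t ^ 2) := by
      intro s t
      have hg : polyGrad (π i₀) (s • α + t • β) = (s * l) • α + (t * m) • β := by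
        rw [polyGrad_add_point hhom, polyGrad_smul_point hhom, polyGrad_smul_point hhom, hl, hm,
          smul_smul, smul_smul]
      rw [two_mul_evalAt hf hhom hz (hmem s t) (by rw [hg]; exact hmem _ _), hg]
      have hβα : inner ℝ β α = (0 : ℝ) := by rw [real_inner_comm]; exact hαβ
      simp only [inner_add_left, inner_add_right, real_inner_smul_left, real_inner_smul_right, hα,
        hβ, hαβ, hβα]
      ring
    -- It remains to see that every value `c` of the diagonal form with coefficients `l` and `m` is
    -- taken on one of the axes.
    suffices h : ∃ s t : ℝ, (s = 0 ∨ t = 0) ∧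
        l * s ^ 2 + m * t ^ 2 = l * a ^ 2 + m * b ^ 2 by
      obtain ⟨s, t, hst, h⟩ := h
      refine ⟨s, t, hst, fun i hi => ?_⟩
      by_cases hii : i = i₀
      · rw [hii]
        have e1 := hval s t
        have e2 := hval a b
        linarith
      · exact hlow i (hother i hi hii) s t
    set c := l * a ^ 2 + m * b ^ 2 with hc
    by_cases hl' : l ≠ 0 ∧ 0 ≤ c / l
    · refine ⟨√(c / l), 0, Or.inr rfl, ?_⟩
      rw [Real.sq_sqrt hl'.2, mul_div_cancel₀ _ hl'.1]; simp
    by_cases hm' : m ≠ 0 ∧ 0 ≤ c / m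
    · refine ⟨0, √(c / m), Or.inl rfl, ?_⟩
      rw [Real.sq_sqrt hm'.2, mul_div_cancel₀ _ hm'.1]; simp
    refine ⟨0, 0, Or.inl rfl, ?_⟩
    -- If neither axis represents `c`, then `l * c` and `m * c` are nonpositive. Multiplying the
    -- definition of `c` by `c` gives `c ^ 2 ≤ 0`, so the origin serves.
    have hsign : ∀ r : ℝ, ¬ (r ≠ 0 ∧ 0 ≤ c / r) → r * c ≤ 0 := by
      intro r hr
      by_cases hr0 : r = 0
      · simp [hr0]
      · have : c / r < 0 := by
          by_contra h
          exact hr ⟨hr0, not_lt.1 h⟩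
        have hr2 : 0 < r ^ 2 := by positivity
        have : r * c = r ^ 2 * (c / r) := by field_simp
        nlinarith
    have h1 := hsign l hl'
    have h2 := hsign m hm'
    have h3 : c ^ 2 ≤ 0 := by
      have : c ^ 2 = a ^ 2 * (l * c) + b ^ 2 * (m * c) := by rw [hc]; ring
      nlinarith [sq_nonneg a, sq_nonneg b]
    have h4 : c = 0 := by nlinarith [sq_nonneg c]
    rw [h4]; ring

end LowDegree

/-! ### Regular points -/

section Regular

variable {n : ℕ} {G : Subgroup (OrthGroup n)}

/-- The roots of norm one. -/
def unitRoots (G : Subgroup (OrthGroup n)) : Set (Space n) := {v | v ∈ rootSet G ∧ ‖v‖ = 1}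

/-- The unit roots on the positive side of `q`. -/
def positiveRoots (G : Subgroup (OrthGroup n)) (q : Space n) : Set (Space n) :=
  {v | v ∈ unitRoots G ∧ 0 < inner ℝ v q}

/-- The positive roots whose reflection permutes the other positive roots. -/
def simpleRoots (G : Subgroup (OrthGroup n)) (q : Space n) : Set (Space n) :=
  {v | v ∈ positiveRoots G q ∧
    ∀ w ∈ positiveRoots G q, w ≠ v → 0 < inner ℝ (hyperplaneReflection v w) q}

/-- A point on none of the reflecting hyperplanes. -/
def IsRegularPoint (G : Subgroup (OrthGroup n)) (q : Space n) : Prop :=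
  ∀ v ∈ rootSet G, inner ℝ v q ≠ 0

lemma hyperplaneReflection_neg (v : Space n) :
    hyperplaneReflection (-v) = hyperplaneReflection v := by
  rw [← neg_one_smul ℝ v, hyperplaneReflection_smul _ (by norm_num)]

lemma hyperplaneReflection_apply_unit {v : Space n} (hv : ‖v‖ = 1) (x : Space n) :
    hyperplaneReflection v x = x - (2 * inner ℝ v x) • v := by
  rw [hyperplaneReflection_apply, real_inner_self_eq_norm_sq, hv]
  simp

/-- A unit vector is determined up to sign by its reflection, because the reflection sends no other
unit vectors to their negatives. -/
lemma finite_unitRoots [Finite G] : (unitRoots G).Finite := by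
  have hfin : ({g | g ∈ G} : Set (OrthGroup n)).Finite := Set.toFinite (G : Set (OrthGroup n))
  have hsub : unitRoots G ⊆ {v | hyperplaneReflection v ∈ {g | g ∈ G} ∧ ‖v‖ = 1} :=
    fun v hv => ⟨hv.1.2, hv.2⟩
  have hsub2 : unitRoots G ⊆
      ⋃ g ∈ ({g | g ∈ G} : Set (OrthGroup n)), {v | hyperplaneReflection v = g ∧ ‖v‖ = 1} := by
    intro v hv
    simp only [Set.mem_iUnion]
    exact ⟨_, hv.1.2, rfl, hv.2⟩
  refine (hfin.biUnion fun g _ => ?_).subset hsub2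
  rcases Set.eq_empty_or_nonempty {v : Space n | hyperplaneReflection v = g ∧ ‖v‖ = 1} with h | h
  · rw [h]; exact Set.finite_empty
  obtain ⟨w, hw, hw1⟩ := h
  refine (Set.toFinite {w, -w}).subset ?_
  rintro v ⟨hv, hv1⟩
  have h1 : hyperplaneReflection w v = -v := by
    rw [hw, ← hv]
    exact hyperplaneReflection_self v (by rintro rfl; simp at hv1)
  rw [hyperplaneReflection_apply_unit hw1] at h1
  have h2 : v = (inner ℝ w v : ℝ) • w := by
    have h3 : (2 : ℝ) • v = (2 : ℝ) • ((inner ℝ w v : ℝ) • w) := by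
      rw [smul_smul, two_smul]
      nth_rewrite 1 [← sub_add_cancel v ((2 * inner ℝ w v : ℝ) • w)]
      rw [h1]
      abel
    exact smul_right_injective _ two_ne_zero h3
  have h3 : |(inner ℝ w v : ℝ)| = 1 := by
    have := congrArg norm h2
    rw [norm_smul, hv1, hw1, mul_one] at this
    exact this.symm
  rcases (abs_eq zero_le_one).1 h3 with h | h
  · left; rw [h2, h, one_smul]
  · right; rw [Set.mem_singleton_iff, h2, h, neg_one_smul]

lemma map_mem_unitRoots {g : OrthGroup n} (hg : g ∈ G) {v : Space n} (hv : v ∈ unitRoots G) :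
    g v ∈ unitRoots G :=
  ⟨map_mem_rootSet hg hv.1, by rw [g.norm_map, hv.2]⟩

lemma neg_mem_unitRoots {v : Space n} (hv : v ∈ unitRoots G) : -v ∈ unitRoots G :=
  ⟨⟨neg_ne_zero.2 hv.1.1, by rw [hyperplaneReflection_neg]; exact hv.1.2⟩, by
    rw [norm_neg, hv.2]⟩

/-- Call `⟪·, q⟫` the height. Reflecting `β` in the lower root `ε` changes its height to one
strictly between minus and plus the old height. Up to sign the image is a lower positive root, and
conjugating its reflection by that of `ε` gives the reflection in `β`. -/
lemma reflection_mem_closure_of_lower {q β ε : Space n} (hq : IsRegularPoint G q)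
    (H : Subgroup (OrthGroup n)) (hβ : β ∈ positiveRoots G q) (hε : ε ∈ positiveRoots G q)
    (hlow : inner ℝ ε q < (inner ℝ β q : ℝ))
    (h0 : (0 : ℝ) < inner ℝ ε β) (h1 : (inner ℝ ε β : ℝ) < 1)
    (hmin : ∀ γ ∈ positiveRoots G q, (inner ℝ γ q : ℝ) < inner ℝ β q →
      hyperplaneReflection γ ∈ H) : hyperplaneReflection β ∈ H := by
  have hεH := hmin ε hε hlow
  set β' := hyperplaneReflection ε β with hβ'
  have hβ'u : β' ∈ unitRoots G := map_mem_unitRoots hε.1.1.2 hβ.1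
  have hheight : (inner ℝ β' q : ℝ) = inner ℝ β q - 2 * inner ℝ ε β * inner ℝ ε q := by
    rw [hβ', hyperplaneReflection_apply_unit hε.1.2, inner_sub_left, real_inner_smul_left]
  have hεq := hε.2
  have hβq := hβ.2
  have hβ'H : hyperplaneReflection β' ∈ H := by
    rcases lt_or_gt_of_ne (hq β' hβ'u.1) with hlt | hgt
    · rw [← hyperplaneReflection_neg]
      refine hmin _ ⟨neg_mem_unitRoots hβ'u, ?_⟩ ?_
      · rw [inner_neg_left]; linarith
      · rw [inner_neg_left, hheight]; nlinarith
    · exact hmin _ ⟨hβ'u, hgt⟩ (by rw [hheight]; nlinarith)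
  have h : β = hyperplaneReflection ε β' := by rw [hβ', hyperplaneReflection_invol]
  rw [h, hyperplaneReflection_map]
  exact H.mul_mem (H.mul_mem hεH hβ'H) (H.inv_mem hεH)

lemma reflection_mem_closure_simpleRoots [Finite G] {q : Space n} (hq : IsRegularPoint G q)
    {β : Space n} (hβ : β ∈ positiveRoots G q) :
    hyperplaneReflection β ∈ Subgroup.closure (hyperplaneReflection '' simpleRoots G q) := by
  set H := Subgroup.closure (hyperplaneReflection '' simpleRoots G q) with hH
  by_contra hcon
  obtain ⟨β, ⟨hβ, hβH⟩, hmin⟩ := Set.exists_min_image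
    {β | β ∈ positiveRoots G q ∧ hyperplaneReflection β ∉ H} (fun β => (inner ℝ β q : ℝ))
    (finite_unitRoots.subset fun v hv => hv.1.1) ⟨β, hβ, hcon⟩
  have hmin' : ∀ γ ∈ positiveRoots G q, (inner ℝ γ q : ℝ) < inner ℝ β q →
      hyperplaneReflection γ ∈ H := by
    intro γ hγ hlt
    by_contra hγH
    exact absurd (hmin γ ⟨hγ, hγH⟩) (not_le.2 hlt)
  have hns : β ∉ simpleRoots G q := fun hs => hβH (Subgroup.subset_closure ⟨β, hs, rfl⟩)
  have : ∃ γ ∈ positiveRoots G q, γ ≠ β ∧ (inner ℝ (hyperplaneReflection β γ) q : ℝ) < 0 := by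
    by_contra! hall
    refine hns ⟨hβ, fun w hw hne => lt_of_le_of_ne (hall w hw hne) (Ne.symm ?_)⟩
    exact hq _ (map_mem_rootSet hβ.1.1.2 hw.1.1)
  obtain ⟨γ, hγ, hγβ, hneg⟩ := this
  have hγu := map_mem_unitRoots hβ.1.1.2 hγ.1
  -- The sum of `γ` and `δ` is `(2 * inner ℝ β γ) • β` with `inner ℝ β γ < 1`, so one of them is
  -- lower than `β`. Both have the same positive inner product with `β`.
  set δ := -hyperplaneReflection β γ with hδ
  have hδpos : δ ∈ positiveRoots G q := ⟨neg_mem_unitRoots hγu, by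
    rw [hδ, inner_neg_left]; linarith⟩
  have hβ1 := hβ.1.2
  have hlt1 : (inner ℝ γ β : ℝ) < 1 := inner_lt_one_iff_real_of_norm_eq_one hγ.1.2 hβ1 |>.2 hγβ
  have hδeq : δ = (2 * inner ℝ β γ : ℝ) • β - γ := by
    rw [hδ, hyperplaneReflection_apply_unit hβ1]; abel
  have hδβ : (inner ℝ δ β : ℝ) = inner ℝ γ β := by
    rw [hδeq, inner_sub_left, real_inner_smul_left, real_inner_self_eq_norm_sq, hβ1,
      real_inner_comm γ β]
    ring
  have hδq : (inner ℝ δ q : ℝ) = 2 * inner ℝ γ β * inner ℝ β q - inner ℝ γ q := by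
    rw [hδeq, inner_sub_left, real_inner_smul_left, real_inner_comm γ β]
  have h1 := hγ.2
  have h2 := hδpos.2
  have h3 := hβ.2
  have h0 : (0 : ℝ) < inner ℝ γ β := by
    by_contra hle
    nlinarith
  by_cases hc : (inner ℝ γ q : ℝ) < inner ℝ β q
  · exact hβH (reflection_mem_closure_of_lower hq H hβ hγ hc h0 hlt1 hmin')
  · refine hβH (reflection_mem_closure_of_lower hq H hβ hδpos ?_ (by rwa [hδβ]) (by rwa [hδβ])
      hmin')
    rw [hδq]
    nlinarith

/-- The product of the reflections in the vectors of a list. -/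
noncomputable def reflectionProd (l : List (Space n)) : OrthGroup n :=
  (l.map hyperplaneReflection).prod

lemma reflectionProd_cons (v : Space n) (l : List (Space n)) :
    reflectionProd (v :: l) = hyperplaneReflection v * reflectionProd l := by
  simp [reflectionProd]

lemma reflectionProd_append (l l' : List (Space n)) :
    reflectionProd (l ++ l') = reflectionProd l * reflectionProd l' := by
  simp [reflectionProd]

lemma reflectionProd_mem {q : Space n} {l : List (Space n)} (hl : ∀ v ∈ l, v ∈ simpleRoots G q) :
    reflectionProd l ∈ G := by
  refine Subgroup.list_prod_mem _ fun g hg => ?_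
  obtain ⟨v, hv, rfl⟩ := List.mem_map.1 hg
  exact (hl v hv).1.1.1.2

lemma exists_list_of_mem [Finite G] {q : Space n} (hq : IsRegularPoint G q)
    (hG : IsReflectionGroup G) {g : OrthGroup n} (hg : g ∈ G) :
    ∃ l : List (Space n), (∀ v ∈ l, v ∈ simpleRoots G q) ∧ g = reflectionProd l := by
  have hle : G ≤ Subgroup.closure (hyperplaneReflection '' simpleRoots G q) := by
    rw [hG.2, Subgroup.closure_le, ← hG.2]
    rintro _ ⟨hgG, v, hv, rfl⟩
    have hv0 : ‖v‖⁻¹ ≠ 0 := inv_ne_zero (norm_ne_zero_iff.2 hv)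
    have hu : ‖v‖⁻¹ • v ∈ unitRoots G := ⟨smul_mem_rootSet hv0 ⟨hv, hgG⟩, by
      rw [norm_smul, norm_inv, norm_norm, inv_mul_cancel₀ (norm_ne_zero_iff.2 hv)]⟩
    rw [SetLike.mem_coe, ← hyperplaneReflection_smul _ hv0 v]
    rcases lt_or_gt_of_ne (hq _ hu.1) with hlt | hgt
    · rw [← hyperplaneReflection_neg]
      exact reflection_mem_closure_simpleRoots hq ⟨neg_mem_unitRoots hu, by
        rw [inner_neg_left]; linarith⟩
    · exact reflection_mem_closure_simpleRoots hq ⟨hu, hgt⟩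
  have hg' := hle hg
  induction hg' using Subgroup.closure_induction with
  | mem x hx =>
    obtain ⟨v, hv, rfl⟩ := hx
    exact ⟨[v], by simpa using hv, by simp [reflectionProd]⟩
  | one => exact ⟨[], by simp, by simp [reflectionProd]⟩
  | mul x y hx hy ihx ihy =>
    have hsub : Subgroup.closure (hyperplaneReflection '' simpleRoots G q) ≤ G := by
      rw [Subgroup.closure_le]
      rintro _ ⟨v, hv, rfl⟩
      exact hv.1.1.1.2
    obtain ⟨l, hl, rfl⟩ := ihx (hsub hx)
    obtain ⟨l', hl', rfl⟩ := ihy (hsub hy)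
    refine ⟨l ++ l', ?_, (reflectionProd_append _ _).symm⟩
    intro v hv
    rcases List.mem_append.1 hv with h | h
    · exact hl v h
    · exact hl' v h
  | inv x hx ih =>
    obtain ⟨l, hl, rfl⟩ := ih (by simpa using G.inv_mem hg)
    refine ⟨l.reverse, by simpa using hl, ?_⟩
    rw [reflectionProd, reflectionProd, List.prod_inv_reverse, List.map_map, List.map_reverse]
    congr 2

/-- Apply the reflections one at a time, from the right. At the first change of sign a simple
reflection makes a positive root negative, and the only positive root it can do this to is its own.
-/
lemma exists_split {q : Space n} (hq : IsRegularPoint G q) (l : List (Space n))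
    (hl : ∀ v ∈ l, v ∈ simpleRoots G q) {α : Space n} (hα : α ∈ positiveRoots G q)
    (hneg : (inner ℝ (reflectionProd l α) q : ℝ) < 0) :
    ∃ l₁ v l₂, l = l₁ ++ v :: l₂ ∧ reflectionProd l₂ α = v := by
  induction l with
  | nil =>
    have h : reflectionProd ([] : List (Space n)) α = α := by simp [reflectionProd]
    rw [h] at hneg
    exact absurd hα.2 (by linarith)
  | cons v l ih =>
    have hl' : ∀ v ∈ l, v ∈ simpleRoots G q := fun w hw => hl w (List.mem_cons_of_mem _ hw)
    have hu := map_mem_unitRoots (reflectionProd_mem hl') hα.1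
    rcases lt_or_gt_of_ne (hq _ hu.1) with hlt | hgt
    · obtain ⟨l₁, w, l₂, rfl, h⟩ := ih hl' hlt
      exact ⟨v :: l₁, w, l₂, rfl, h⟩
    · refine ⟨[], v, l, rfl, ?_⟩
      by_contra hne
      have hs := (hl v (List.mem_cons_self)).2 _ ⟨hu, hgt⟩ hne
      rw [reflectionProd_cons] at hneg
      exact absurd hneg (not_lt.2 hs.le)

/-- The deletion argument. The product without the last factor makes the last root `α` negative, so
the split supplies an earlier factor equal to the reflection in `α`, conjugated by the factors in
between. The two cancel, and the word becomes shorter by two. -/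
lemma reflectionProd_eq_one {q : Space n} (hq : IsRegularPoint G q) (m : ℕ) :
    ∀ l : List (Space n), l.length = m → (∀ v ∈ l, v ∈ simpleRoots G q) →
      (∀ α ∈ positiveRoots G q, (0 : ℝ) < inner ℝ (reflectionProd l α) q) →
      reflectionProd l = 1 := by
  induction m using Nat.strong_induction_on with
  | _ m ih =>
    intro l hlen hl hpos
    rcases List.eq_nil_or_concat l with rfl | ⟨l', α, rfl⟩
    · simp [reflectionProd]
    rw [List.concat_eq_append] at *
    have hα : α ∈ simpleRoots G q := hl α (by simp)
    have hl' : ∀ v ∈ l', v ∈ simpleRoots G q := fun v hv => hl v (by simp [hv])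
    have happ : reflectionProd (l' ++ [α]) = reflectionProd l' * hyperplaneReflection α := by
      rw [reflectionProd_append]; simp [reflectionProd]
    have h1 := hpos α hα.1
    rw [happ] at h1
    change (0 : ℝ) < inner ℝ (reflectionProd l' (hyperplaneReflection α α)) q at h1
    rw [hyperplaneReflection_self α hα.1.1.1.1, map_neg, inner_neg_left] at h1
    obtain ⟨l₁, v, l₂, rfl, hv⟩ := exists_split hq l' hl' hα.1 (by linarith)
    have hshort : reflectionProd (l₁ ++ v :: l₂ ++ [α]) = reflectionProd (l₁ ++ l₂) := by
      rw [happ, reflectionProd_append, reflectionProd_append, reflectionProd_cons, ← hv,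
        hyperplaneReflection_map]
      simp [mul_assoc, hyperplaneReflection_mul_self]
    rw [hshort]
    refine ih (l₁ ++ l₂).length ?_ _ rfl ?_ ?_
    · rw [← hlen]; simp
    · intro w hw
      refine hl' w ?_
      rcases List.mem_append.1 hw with h | h <;> simp [h]
    · rw [← hshort]; exact hpos

/-- Regular points have trivial stabilizer. -/
theorem eq_one_of_isRegularPoint (hG : IsReflectionGroup G) {q : Space n}
    (hq : IsRegularPoint G q) {g : OrthGroup n} (hg : g ∈ G) (hgq : g q = q) : g = 1 := by
  have := hG.1
  obtain ⟨l, hl, rfl⟩ := exists_list_of_mem hq hG hg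
  refine reflectionProd_eq_one hq _ l rfl hl fun α hα => ?_
  -- An isometry that fixes `q` preserves heights, hence keeps positive roots positive.
  conv_rhs => rw [← hgq]
  rw [LinearIsometryEquiv.inner_map_map]
  exact hα.2

/-- The polynomial `f ∘ g`. -/
noncomputable def polyComp (g : OrthGroup n) (f : MvPolynomial (Fin n) ℝ) :
    MvPolynomial (Fin n) ℝ :=
  aeval (fun i => linForm (g.symm (EuclideanSpace.single i 1))) f

lemma evalAt_polyComp (g : OrthGroup n) (f : MvPolynomial (Fin n) ℝ) (x : Space n) :
    evalAt x (polyComp g f) = evalAt (g x) f := by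
  rw [polyComp, evalAt_aeval, evalAt]
  congr 2
  funext i
  rw [evalAt_linForm]
  have h := g.inner_map_map (g.symm (EuclideanSpace.single i 1)) x
  rw [g.apply_symm_apply] at h
  rw [← h]
  simp [EuclideanSpace.inner_single_left]

lemma inner_polyGrad_polyComp (g : OrthGroup n) (f : MvPolynomial (Fin n) ℝ) (q v : Space n) :
    inner ℝ (polyGrad (polyComp g f) q) v = (inner ℝ (polyGrad f (g q)) (g v) : ℝ) := by
  have h1 : HasFDerivAt (fun x => evalAt (g x) f)
      ((innerSL ℝ (polyGrad f (g q))).comp (g.toContinuousLinearEquiv : Space n →L[ℝ] Space n)) q :=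
    HasFDerivAt.comp q (hasStrictFDerivAt_evalAt f (g q)).hasFDerivAt
      g.toContinuousLinearEquiv.hasFDerivAt
  simp only [← evalAt_polyComp] at h1
  have h3 := (hasStrictFDerivAt_evalAt (polyComp g f) q).hasFDerivAt.unique h1
  exact DFunLike.congr_fun h3 v

/-- The polynomial `‖x - c‖²`. -/
noncomputable def distSqPoly (c : Space n) : MvPolynomial (Fin n) ℝ :=
  normSqPoly n + (-2 : ℝ) • linForm c + C (inner ℝ c c)

lemma evalAt_distSqPoly (c x : Space n) :
    evalAt x (distSqPoly c) = inner ℝ (x - c) (x - c) := by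
  rw [distSqPoly, evalAt_add, evalAt_add, evalAt_smul, evalAt_linForm, evalAt_normSqPoly, evalAt_C,
    inner_sub_left, inner_sub_right, inner_sub_right, real_inner_comm c x]
  ring

lemma polyGrad_distSqPoly_self (c : Space n) : polyGrad (distSqPoly c) c = 0 := by
  rw [distSqPoly, polyGrad_add, polyGrad_add, polyGrad_smul, polyGrad_linForm, polyGrad_normSqPoly,
    polyGrad_C, ← add_smul]
  simp

/-- At a point with trivial stabilizer the gradients of the invariants span the whole space. -/
lemma exists_invariant_polyGrad [Finite G] {q : Space n} (hq : ∀ g ∈ G, g q = q → g = 1)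
    (u : Space n) : ∃ f ∈ invariantRing G, ∃ c : ℝ, c ≠ 0 ∧ polyGrad f q = c • u := by
  classical
  have : Fintype G := Fintype.ofFinite G
  -- `D` vanishes to second order at the other points of the orbit of `q`, so in the average over
  -- `G` of a linear factor times `D` only the identity contributes to the gradient at `q`.
  set D : MvPolynomial (Fin n) ℝ :=
    ∏ g ∈ (Finset.univ : Finset G).erase 1, distSqPoly ((g : OrthGroup n) q) with hD
  set f₀ := (linForm u + C (-inner ℝ u q)) * D with hf₀
  have hgrad1 : polyGrad f₀ q = evalAt q D • u := by
    rw [hf₀, polyGrad_mul, polyGrad_add, polyGrad_linForm, polyGrad_C, evalAt_add, evalAt_linForm,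
      evalAt_C]
    simp
  have hgrad2 : ∀ g : G, g ≠ 1 → polyGrad f₀ ((g : OrthGroup n) q) = 0 := by
    intro g hg
    have hsplit : D = distSqPoly ((g : OrthGroup n) q) *
        ∏ h ∈ ((Finset.univ : Finset G).erase 1).erase g, distSqPoly ((h : OrthGroup n) q) :=
      (Finset.mul_prod_erase _ _ (by simp [hg])).symm
    have h0 : evalAt ((g : OrthGroup n) q) D = 0 := by
      rw [hsplit, evalAt_mul, evalAt_distSqPoly]; simp
    have h1 : polyGrad D ((g : OrthGroup n) q) = 0 := by
      rw [hsplit, polyGrad_mul, evalAt_distSqPoly, polyGrad_distSqPoly_self]; simp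
    rw [hf₀, polyGrad_mul, h0, h1]; simp
  refine ⟨∑ g : G, polyComp (g : OrthGroup n) f₀, ?_, evalAt q D, ?_, ?_⟩
  · rw [mem_invariantRing_iff]
    intro h hh p
    rw [evalAt_sum, evalAt_sum]
    simp only [evalAt_polyComp]
    exact Fintype.sum_equiv (Equiv.mulRight (⟨h, hh⟩ : G)) _ _ fun g => rfl
  · rw [hD, evalAt_prod, Finset.prod_ne_zero_iff]
    intro g hg
    rw [evalAt_distSqPoly, inner_self_ne_zero, sub_ne_zero]
    intro h
    exact (Finset.ne_of_mem_erase hg) (Subtype.ext (hq g g.2 h.symm))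
  · refine ext_inner_right ℝ fun v => ?_
    rw [polyGrad_sum, sum_inner, Finset.sum_eq_single (1 : G)]
    · rw [inner_polyGrad_polyComp]
      change (inner ℝ (polyGrad f₀ q) v : ℝ) = _
      rw [hgrad1]
    · intro g _ hg
      rw [inner_polyGrad_polyComp, hgrad2 g hg, inner_zero_left]
    · simp

lemma linearIndependent_polyGrad_of_isRegularPoint (hG : IsReflectionGroup G)
    {π : Fin n → MvPolynomial (Fin n) ℝ} (hπ : IsBasicInvariants G π) {q : Space n}
    (hq : IsRegularPoint G q) : LinearIndependent ℝ fun i => polyGrad (π i) q := by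
  have := hG.1
  refine linearIndependent_polyGrad_of_span_eq_top hπ fun v => ?_
  obtain ⟨f, hf, c, hc, h⟩ :=
    exists_invariant_polyGrad (fun g hg hgq => eq_one_of_isRegularPoint hG hq hg hgq) v
  have hv : v = c⁻¹ • polyGrad f q := by rw [h, smul_smul, inv_mul_cancel₀ hc, one_smul]
  rw [hv]
  exact Submodule.smul_mem _ _ (Submodule.subset_span ⟨f, hf, rfl⟩)

lemma exists_isRegularPoint [Finite G] : ∃ q : Space n, IsRegularPoint G q := by
  have : Finite (unitRoots G) := finite_unitRoots.to_subtype
  obtain ⟨b, hb⟩ := exists_inner_ne_zero (fun v : unitRoots G => (v : Space n))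
    fun v => v.2.1.1
  refine ⟨b, fun v hv h0 => ?_⟩
  have hv0 : ‖v‖⁻¹ ≠ 0 := inv_ne_zero (norm_ne_zero_iff.2 hv.1)
  refine hb ⟨‖v‖⁻¹ • v, smul_mem_rootSet hv0 hv, ?_⟩ ?_
  · rw [norm_smul, norm_inv, norm_norm, inv_mul_cancel₀ (norm_ne_zero_iff.2 hv.1)]
  · rw [real_inner_smul_left, h0, mul_zero]

/-- The last basic invariant is minimised on the fibre of the others. At a regular point all
gradients would be independent, contradicting criticality, so the minimum lies on a hyperplane. -/
theorem fibresMeetStratum_of_add_one_eq {B : Type} {α : B → Space n} (hR : IsReflectionGroup G)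
    (hG : G = Subgroup.closure (Set.range fun i => hyperplaneReflection (α i)))
    (hα : ∀ i, α i ≠ 0) (hconn : IsConnectedFamily α) {k : ℕ} (hk : k + 1 = n)
    (hkf : finrank ℝ (fixedSubspace G) + 1 ≤ k) : FibresMeetStratum G k := by
  have hfin := hR.1
  intro π hπ p
  set last : Fin n := ⟨k, by omega⟩ with hlast
  -- If all degrees were at most two, all gradients at `z + y` would lie in V^G plus the line
  -- through `y`, of dimension at most dim V^G + 1 < n. At a regular point this is impossible.
  have hdeg : 2 < (π last).totalDegree := by
    by_contra! hle
    obtain ⟨a, ha⟩ := exists_isRegularPoint (G := G)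
    have hli := linearIndependent_polyGrad_of_isRegularPoint hR hπ ha
    obtain ⟨z, hz, y, hy, rfl⟩ := exists_decomposition G a
    have hmem : ∀ i, polyGrad (π i) (z + y) ∈ fixedSubspace G ⊔ Submodule.span ℝ {y} := by
      intro i
      have hi2 : (π i).totalDegree ≤ 2 := by
        refine le_trans (hπ.degree_mono (?_ : i ≤ last)) hle
        rw [Fin.le_def, hlast]
        have := i.2
        simp only
        omega
      have hhom := hπ.homogeneous i
      have hfix : ∀ {f : MvPolynomial (Fin n) ℝ}, f ∈ invariantRing G → ∀ w ∈ fixedSubspace G,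
          polyGrad f w ∈ fixedSubspace G := by
        intro f hf w hw
        rw [mem_fixedSubspace_iff]
        intro g hg
        rw [← polyGrad_equivariant hf hg, mem_fixedSubspace_iff.1 hw g hg]
      rcases hi2.lt_or_eq with h1 | h2
      · have h1' : (π i).totalDegree = 1 := by
          have := hπ.totalDegree_pos i
          omega
        rw [h1'] at hhom
        rw [polyGrad_const_of_isHomogeneous_one hhom _ z]
        exact Submodule.mem_sup_left (hfix (hπ.mem_invariantRing i) z hz)
      · rw [h2] at hhom
        obtain ⟨c, hc⟩ := exists_polyGrad_eq_smul_of_connected hG hα hconn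
          (hπ.mem_invariantRing i) hhom
        rw [polyGrad_add_point hhom, hc y hy]
        exact Submodule.add_mem_sup (hfix (hπ.mem_invariantRing i) z hz)
          (Submodule.smul_mem _ _ (Submodule.mem_span_singleton_self y))
    have h1 : n ≤ finrank ℝ (fixedSubspace G ⊔ Submodule.span ℝ {y} : Submodule ℝ (Space n)) := by
      have h2 := finrank_span_eq_card hli
      rw [Fintype.card_fin] at h2
      conv_lhs => rw [← h2]
      exact Submodule.finrank_mono (Submodule.span_le.2 (by rintro _ ⟨i, rfl⟩; exact hmem i))
    have h2 := Submodule.finrank_add_le_finrank_add_finrank (fixedSubspace G)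
      (Submodule.span ℝ {y})
    have h3 := finrank_span_finset_le_card (R := ℝ) ({y} : Finset (Space n))
    rw [Set.finrank, Finset.coe_singleton, Finset.card_singleton] at h3
    omega
  -- As the last degree exceeds two, the squared norm is a polynomial in the other invariants, which
  -- makes the fibre bounded.
  have hnorm : normSqPoly n ∈ Algebra.adjoin ℝ (π '' {i : Fin n | (i : ℕ) < k}) := by
    refine Algebra.adjoin_mono (Set.image_mono ?_)
      (hπ.mem_adjoin_of_isHomogeneous normSqPoly_mem_invariantRing isHomogeneous_normSqPoly)
    intro i hi
    have hi2 : (π i).totalDegree ≤ 2 := hi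
    by_contra hik
    have h1 : last ≤ i := by
      rw [Fin.le_def, hlast]
      simpa using hik
    have h2 : (π last).totalDegree ≤ (π i).totalDegree := hπ.degree_mono h1
    omega
  let f : {i : Fin n // (i : ℕ) < k} → MvPolynomial (Fin n) ℝ := fun i => π i
  have hcompact : IsCompact {x : Space n | ∀ i, evalAt x (f i) = evalAt p (f i)} := by
    refine (isCompact_closedBall (0 : Space n) ‖p‖).of_isClosed_subset (isClosed_fibre f p) ?_
    intro x hx
    have h1 := evalAt_eq_of_mem_adjoin π _ hnorm (p := p) (q := x) fun i hi => hx ⟨i, hi⟩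
    rw [evalAt_normSqPoly, evalAt_normSqPoly, real_inner_self_eq_norm_sq,
      real_inner_self_eq_norm_sq] at h1
    rw [mem_closedBall_zero_iff]
    exact (pow_le_pow_iff_left₀ (norm_nonneg _) (norm_nonneg _) two_ne_zero).1 h1.le
  obtain ⟨q, hq, -, hext⟩ := exists_min_on_fibre f p hcompact (π last)
  refine ⟨q, ?_, fun i hi => hq ⟨i, hi⟩⟩
  have hnreg : ¬ IsRegularPoint G q := by
    intro hreg
    have hcard := card_le_of_isLocalExtrOn f (π last) hext _
      (linearIndependent_polyGrad_of_isRegularPoint hR hπ hreg) (fun j => by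
        by_cases hj : (j : ℕ) < k
        · exact Submodule.subset_span (Or.inr ⟨⟨j, hj⟩, rfl⟩)
        · have : j = last := Fin.ext (by
            have := j.2
            simp only [hlast]
            omega)
          rw [this]
          exact Submodule.subset_span (Or.inl rfl))
    have hc : Fintype.card {i : Fin n // (i : ℕ) < k} ≤ k := by
      refine (Fintype.card_le_of_injective (fun i => (⟨i.1, i.2⟩ : Fin k)) ?_).trans
        (Fintype.card_fin k).le
      intro i j hij
      exact Subtype.ext (Fin.ext (by simpa using hij))
    rw [Fintype.card_fin] at hcard
    omega
  rw [IsRegularPoint] at hnreg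
  push Not at hnreg
  obtain ⟨v, hv, hvq⟩ := hnreg
  exact mem_stratum_of_root hk hv hvq

end Regular

/-! ### Realizing a Gram matrix -/

section Gram

variable {n : ℕ}

/-- Two families with the same Gram matrix are related by a partial isometry. -/
lemma exists_partialIsometry {B E : Type*} [NormedAddCommGroup E] [InnerProductSpace ℝ E]
    [FiniteDimensional ℝ E] (α' : B → E) (α : B → Space n)
    (h : ∀ i j, inner ℝ (α i) (α j) = (inner ℝ (α' i) (α' j) : ℝ)) :
    ∃ T : E →ₗ[ℝ] Space n, (∀ i, T (α' i) = α i) ∧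
      (∀ x, ∀ y ∈ Submodule.span ℝ (Set.range α'), inner ℝ (T x) (T y) = (inner ℝ x y : ℝ)) ∧
      ∀ x, T x ∈ Submodule.span ℝ (Set.range α) := by
  classical
  let F := Finsupp.linearCombination ℝ α'
  let F' := Finsupp.linearCombination ℝ α
  have hF : ∀ c c', inner ℝ (F' c) (F' c') = (inner ℝ (F c) (F c') : ℝ) := by
    intro c c'
    simp only [F, F', Finsupp.linearCombination_apply, Finsupp.sum, sum_inner, inner_sum,
      real_inner_smul_left, real_inner_smul_right, h]
  -- `T` projects to the span of the `α'`, chooses coefficients with the section `S` and uses them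
  -- for the `α`. The choice does not matter, since equal Gram matrices mean equal relations.
  obtain ⟨S, hS⟩ := F.rangeRestrict.exists_rightInverse_of_surjective
    (LinearMap.range_rangeRestrict F)
  have hFS : ∀ x : LinearMap.range F, F (S x) = x := fun x =>
    congrArg Subtype.val (DFunLike.congr_fun hS x)
  have hrange : LinearMap.range F = Submodule.span ℝ (Set.range α') :=
    Finsupp.range_linearCombination ℝ
  let U := LinearMap.range F
  let T : E →ₗ[ℝ] Space n := F' ∘ₗ S ∘ₗ U.orthogonalProjectionOnto.toLinearMap
  have hT : ∀ y (hy : y ∈ U), T y = F' (S ⟨y, hy⟩) := by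
    intro y hy
    simp only [T, LinearMap.comp_apply]
    congr 2
    exact U.orthogonalProjectionOnto_mem_subspace_eq_self ⟨y, hy⟩
  refine ⟨T, fun i => ?_, fun x y hy => ?_, fun x => ?_⟩
  · have hi : α' i ∈ U := ⟨Finsupp.single i 1, by simp [F]⟩
    rw [hT _ hi, ← sub_eq_zero]
    have h1 : α i = F' (Finsupp.single i 1) := by simp [F']
    have h2 : α' i = F (Finsupp.single i 1) := by simp [F]
    rw [h1, ← map_sub, ← inner_self_eq_zero (𝕜 := ℝ), hF, map_sub, hFS, ← h2]
    simp
  · rw [← hrange] at hy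
    rw [hT y hy]
    simp only [T, LinearMap.comp_apply]
    rw [hF, hFS, hFS]
    exact U.inner_starProjection_left_eq_right x y |>.trans (by
      rw [Submodule.starProjection_eq_self_iff.2 hy])
  · rw [← Finsupp.range_linearCombination ℝ]
    exact ⟨_, rfl⟩

end Gram

/-! ### Power sums -/

section PowerSums

variable {n : ℕ}

/-- The power sum `∑ ⟪ε i, ·⟫ ^ m`. -/
noncomputable def powerSum {r : ℕ} (ε : Fin r → Space n) (m : ℕ) : MvPolynomial (Fin n) ℝ :=
  ∑ i, linForm (ε i) ^ m

lemma evalAt_powerSum {r : ℕ} (ε : Fin r → Space n) (m : ℕ) (q : Space n) :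
    evalAt q (powerSum ε m) = ∑ i, (inner ℝ (ε i) q : ℝ) ^ m := by
  simp only [powerSum, evalAt_sum, evalAt_pow, evalAt_linForm]

lemma polyGrad_powerSum {r : ℕ} (ε : Fin r → Space n) (m : ℕ) (q : Space n) :
    polyGrad (powerSum ε m) q = ∑ i, (m * (inner ℝ (ε i) q : ℝ) ^ (m - 1)) • ε i := by
  simp only [powerSum, polyGrad_sum, polyGrad_pow, evalAt_linForm, polyGrad_linForm]

lemma isHomogeneous_powerSum {r : ℕ} (ε : Fin r → Space n) (m : ℕ) :
    (powerSum ε m).IsHomogeneous m :=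
  IsHomogeneous.sum _ _ _ fun i _ => by simpa using (isHomogeneous_linForm (ε i)).pow m

lemma mem_invariantRing_of_generators {G : Subgroup (OrthGroup n)} {B : Type*} {α : B → Space n}
    (hG : G = Subgroup.closure (Set.range fun i => hyperplaneReflection (α i)))
    {f : MvPolynomial (Fin n) ℝ}
    (h : ∀ i x, evalAt (hyperplaneReflection (α i) x) f = evalAt x f) : f ∈ invariantRing G := by
  rw [mem_invariantRing_iff]
  intro g hg
  rw [hG] at hg
  induction hg using Subgroup.closure_induction with
  | mem g hg => obtain ⟨i, rfl⟩ := hg; exact h i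
  | one => intro p; rfl
  | mul g k _ _ hg hk => intro p; exact (hg (k p)).trans (hk p)
  | inv g _ hg =>
    intro p
    rw [← hg (g⁻¹ p)]
    exact congrArg (fun y => evalAt y f) (g.apply_symm_apply p)

/-- The Vandermonde argument: a polynomial of degree below `m` with `m` distinct roots is zero. -/
lemma eq_zero_of_sum_pow_eq_zero {m : ℕ} (c : Fin m → ℝ) (S : Finset ℝ) (hS : m ≤ S.card)
    (h : ∀ s ∈ S, ∑ j, c j * s ^ (j : ℕ) = 0) : ∀ j, c j = 0 := by
  set p : Polynomial ℝ := ∑ j : Fin m, Polynomial.C (c j) * Polynomial.X ^ (j : ℕ) with hp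
  have hdeg : p.degree < m := by
    refine Polynomial.degree_sum_fin_lt c
  have hp0 : p = 0 := by
    by_contra hne
    have h1 : S.card ≤ p.natDegree := by
      refine Polynomial.card_le_degree_of_subset_roots fun s hs => ?_
      rw [Polynomial.mem_roots hne, Polynomial.IsRoot.def, hp, Polynomial.eval_finsetSum]
      simpa using h s hs
    have h2 := (Polynomial.natDegree_lt_iff_degree_lt hne).2 hdeg
    omega
  intro j
  have h1 := congrArg (fun f => Polynomial.coeff f j) hp0
  simp only [hp, Polynomial.finsetSum_coeff, Polynomial.coeff_C_mul, Polynomial.coeff_X_pow,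
    Polynomial.coeff_zero] at h1
  rw [Finset.sum_eq_single j] at h1
  · simpa using h1
  · intro i _ hij
    rw [if_neg (fun h => hij (Fin.ext h.symm)), mul_zero]
  · simp

/-- The linear invariants fix the coordinates in V^G, and the sum of squares bounds the others. -/
lemma isCompact_of_coordinates {G : Subgroup (OrthGroup n)} {r : ℕ} (w : Fin r → Space n)
    (hsep : ∀ x, (∀ l, inner ℝ (fixedBasis G l) x = 0) → (∀ i, inner ℝ (w i) x = 0) → x = 0)
    {F : Set (Space n)} (hF : IsClosed F) (p : Space n)
    (hz : ∀ x ∈ F, ∀ l, inner ℝ (fixedBasis G l) x = (inner ℝ (fixedBasis G l) p : ℝ))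
    (h2 : ∀ x ∈ F, evalAt x (powerSum w 2) = evalAt p (powerSum w 2)) : IsCompact F := by
  refine isCompact_of_inner_bounded (Sum.elim (fixedBasis G) w)
    (fun x hx => hsep x (fun l => hx (Sum.inl l)) fun i => hx (Sum.inr i)) hF
    (∑ l, |(inner ℝ (fixedBasis G l) p : ℝ)| + (evalAt p (powerSum w 2) + 1)) ?_
  have hnn : 0 ≤ evalAt p (powerSum w 2) := by
    rw [evalAt_powerSum]; exact Finset.sum_nonneg fun i _ => sq_nonneg _
  have hnn2 : 0 ≤ ∑ l, |(inner ℝ (fixedBasis G l) p : ℝ)| :=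
    Finset.sum_nonneg fun i _ => abs_nonneg _
  rintro x hx (l | i)
  · rw [Sum.elim_inl, hz x hx l]
    have := Finset.single_le_sum (f := fun l => |(inner ℝ (fixedBasis G l) p : ℝ)|)
      (fun i _ => abs_nonneg _) (Finset.mem_univ l)
    linarith
  · rw [Sum.elim_inr]
    have h3 := h2 x hx
    rw [evalAt_powerSum] at h3
    have h4 := Finset.single_le_sum (f := fun i => (inner ℝ (w i) x : ℝ) ^ 2)
      (fun i _ => sq_nonneg _) (Finset.mem_univ i)
    have h5 : |(inner ℝ (w i) x : ℝ)| ≤ (inner ℝ (w i) x : ℝ) ^ 2 + 1 := by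
      rw [← sq_abs]
      nlinarith [sq_nonneg (|(inner ℝ (w i) x : ℝ)| - 1), abs_nonneg (inner ℝ (w i) x : ℝ)]
    linarith

end PowerSums

/-! ### Orthonormal coordinates on the complement of the fixed subspace -/

section Coordinates

variable {n r : ℕ} {G : Subgroup (OrthGroup n)} {ε : Fin r → Space n}

lemma inner_fixedBasis_eq_zero (hfix : fixedSubspace G = (Submodule.span ℝ (Set.range ε))ᗮ)
    (l : Fin (finrank ℝ (fixedSubspace G))) (i : Fin r) :
    inner ℝ (ε i) (fixedBasis G l) = (0 : ℝ) := by
  have h := fixedBasis_mem (G := G) l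
  rw [hfix, mem_orthogonal_span_iff] at h
  exact h _ ⟨i, rfl⟩

lemma eq_zero_of_coordinates (hfix : fixedSubspace G = (Submodule.span ℝ (Set.range ε))ᗮ)
    (x : Space n) (h1 : ∀ l, inner ℝ (fixedBasis G l) x = 0)
    (h2 : ∀ i, inner ℝ (ε i) x = (0 : ℝ)) : x = 0 := by
  have h3 := mem_orthogonal_of_inner_fixedBasis h1
  have h4 : x ∈ fixedSubspace G := by
    rw [hfix, mem_orthogonal_span_iff]
    rintro _ ⟨i, rfl⟩
    exact h2 i
  exact inner_self_eq_zero.1 ((Submodule.mem_orthogonal _ _).1 h3 x h4)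

lemma finrank_fixedSubspace_add (hε : Orthonormal ℝ ε)
    (hfix : fixedSubspace G = (Submodule.span ℝ (Set.range ε))ᗮ) :
    finrank ℝ (fixedSubspace G) + r = n := by
  have h := Submodule.finrank_add_finrank_orthogonal (Submodule.span ℝ (Set.range ε))
  rw [finrank_span_eq_card hε.linearIndependent, Fintype.card_fin, finrank_euclideanSpace_fin,
    ← hfix] at h
  omega

/-- The coefficients of a linear relation between the `ζ l` and vectors in the span of the `ε i`
satisfy the relations read off in the coordinates. -/
lemma coordinates_of_relation (hε : Orthonormal ℝ ε)
    (hfix : fixedSubspace G = (Submodule.span ℝ (Set.range ε))ᗮ) {κ : Type*} [Fintype κ]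
    (w : κ → Fin r → ℝ) (g : Fin (finrank ℝ (fixedSubspace G)) ⊕ κ → ℝ)
    (h : ∑ o, g o • Sum.elim (fixedBasis G) (fun j => ∑ i, w j i • ε i) o = 0) :
    (∀ l, g (Sum.inl l) = 0) ∧ ∀ i, ∑ j, g (Sum.inr j) * w j i = 0 := by
  classical
  rw [Fintype.sum_sum_type] at h
  simp only [Sum.elim_inl, Sum.elim_inr] at h
  constructor
  · intro l
    have h1 := congrArg (fun x => (inner ℝ (fixedBasis G l) x : ℝ)) h
    simp only [inner_add_right, inner_sum, real_inner_smul_right, inner_zero_right,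
      orthonormal_iff_ite.1 orthonormal_fixedBasis, real_inner_comm (ε _) (fixedBasis G l),
      inner_fixedBasis_eq_zero hfix] at h1
    simpa [real_inner_comm, inner_fixedBasis_eq_zero hfix] using h1
  · intro i
    have h1 := congrArg (fun x => (inner ℝ (ε i) x : ℝ)) h
    simp only [inner_add_right, inner_sum, real_inner_smul_right, inner_zero_right,
      orthonormal_iff_ite.1 hε, inner_fixedBasis_eq_zero hfix] at h1
    simpa using h1

/-- The finite set of the squares of the coordinates of `q`. -/
noncomputable def squareSet (ε : Fin r → Space n) (q : Space n) : Finset ℝ :=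
  Finset.univ.image fun i => (inner ℝ (ε i) q : ℝ) ^ 2

lemma mem_squareSet (q : Space n) (i : Fin r) : (inner ℝ (ε i) q : ℝ) ^ 2 ∈ squareSet ε q :=
  Finset.mem_image_of_mem _ (Finset.mem_univ i)

/-- Coordinates of `q` with equal squares agree up to sign, so a root `ε i ± ε j` ties them together
on the flat of `q`. One representative for each element of `S`, together with V^G, therefore
separates the points of that flat. -/
lemma mem_stratum_of_squares
    (hfix : fixedSubspace G = (Submodule.span ℝ (Set.range ε))ᗮ)
    (hsub : ∀ i j, i ≠ j → ε i - ε j ∈ rootSet G) (hadd : ∀ i j, i ≠ j → ε i + ε j ∈ rootSet G)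
    {k : ℕ} (hk : finrank ℝ (fixedSubspace G) + k ≤ n) {q : Space n} (S : Finset ℝ)
    (hS : S.card ≤ k)
    (h : ∀ i, (inner ℝ (ε i) q : ℝ) ^ 2 ∈ S ∨
      ∀ x, (∀ v ∈ rootSet G, inner ℝ v q = 0 → inner ℝ v x = 0) → inner ℝ (ε i) x = (0 : ℝ)) :
    q ∈ stratum G (finrank ℝ (fixedSubspace G) + k) := by
  classical
  let rep : S → Space n := fun s =>
    if h : ∃ i, (inner ℝ (ε i) q : ℝ) ^ 2 = s then ε h.choose else 0
  refine mem_stratum_of_separating hk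
    (κ := Fin (finrank ℝ (fixedSubspace G)) ⊕ S) (by simpa using hS)
    (Sum.elim (fixedBasis G) rep) fun x hx hw => ?_
  refine eq_zero_of_coordinates hfix x (fun l => hw (Sum.inl l)) fun i => ?_
  rcases h i with hi | hi
  · have hr := hw (Sum.inr ⟨_, hi⟩)
    have hex : ∃ j, (inner ℝ (ε j) q : ℝ) ^ 2 = (inner ℝ (ε i) q : ℝ) ^ 2 := ⟨i, rfl⟩
    simp only [Sum.elim_inr, rep, dif_pos hex] at hr
    have hj := hex.choose_spec
    set j := hex.choose
    by_cases hij : i = j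
    · rw [hij]; exact hr
    rcases sq_eq_sq_iff_eq_or_eq_neg.1 hj with h1 | h1
    · have h2 := hx _ (hsub i j hij) (by rw [inner_sub_left, h1, sub_self])
      rw [inner_sub_left, hr, sub_zero] at h2
      exact h2
    · have h2 := hx _ (hadd i j hij) (by rw [inner_add_left, h1]; ring)
      rw [inner_add_left, hr, add_zero] at h2
      exact h2
  · exact hi x hx

/-- Independence of the gradients of the even power sums. -/
lemma linearIndependent_evenPowerSums (hε : Orthonormal ℝ ε)
    (hfix : fixedSubspace G = (Submodule.span ℝ (Set.range ε))ᗮ) {m : ℕ} {q : Space n}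
    (hm : m ≤ ((squareSet ε q).erase 0).card) :
    LinearIndependent ℝ (Sum.elim (fixedBasis G)
      fun j : Fin m => polyGrad (powerSum ε (2 * j + 2)) q) := by
  rw [Fintype.linearIndependent_iff]
  intro g hg
  simp only [polyGrad_powerSum] at hg
  obtain ⟨h1, h2⟩ := coordinates_of_relation hε hfix _ g hg
  -- At a nonzero coordinate the relation, divided by that coordinate, is a polynomial of degree
  -- below `m` in its square.
  have h3 := eq_zero_of_sum_pow_eq_zero
    (fun j : Fin m => g (Sum.inr j) * ((2 * j + 2 : ℕ) : ℝ)) _ hm (by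
    intro s hs
    obtain ⟨hs0, hs⟩ := Finset.mem_erase.1 hs
    obtain ⟨i, -, rfl⟩ := Finset.mem_image.1 hs
    have ht : (inner ℝ (ε i) q : ℝ) ≠ 0 := fun h => hs0 (by rw [h]; simp)
    apply mul_left_cancel₀ ht
    rw [mul_zero, Finset.mul_sum, ← h2 i]
    refine Finset.sum_congr rfl fun j _ => ?_
    rw [show 2 * (j : ℕ) + 2 - 1 = 2 * j + 1 by omega, ← pow_mul, pow_succ]
    ring)
  rintro (l | j)
  · exact h1 l
  · have := h3 j
    rcases mul_eq_zero.1 this with h | h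
    · exact h
    · exact absurd h (by positivity)

lemma exists_point_with_coordinates (hε : Orthonormal ℝ ε) (c : Fin r → ℝ) :
    ∃ q : Space n, ∀ i, inner ℝ (ε i) q = c i := by
  classical
  refine ⟨∑ i, c i • ε i, fun i => ?_⟩
  simp [inner_sum, real_inner_smul_right, orthonormal_iff_ite.1 hε]

/-- A point whose coordinates have distinct nonzero squares. -/
lemma exists_generic_point (hε : Orthonormal ℝ ε) :
    ∃ q : Space n, (∀ i, inner ℝ (ε i) q ≠ (0 : ℝ)) ∧ (squareSet ε q).card = r ∧
      ((squareSet ε q).erase 0).card = r := by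
  obtain ⟨q, hq⟩ := exists_point_with_coordinates hε fun i => (i : ℝ) + 1
  have hpos : ∀ i : Fin r, (0 : ℝ) < (i : ℝ) + 1 := fun i => by positivity
  have hcard : (squareSet ε q).card = r := by
    rw [squareSet, Finset.card_image_of_injective, Finset.card_univ, Fintype.card_fin]
    intro i j hij
    simp only [hq] at hij
    have := (pow_left_inj₀ (hpos i).le (hpos j).le two_ne_zero).1 hij
    exact Fin.ext (by exact_mod_cast add_right_cancel this)
  refine ⟨q, fun i => by rw [hq]; exact (hpos i).ne', hcard, ?_⟩
  rw [Finset.erase_eq_of_notMem, hcard]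
  intro h0
  obtain ⟨i, -, hi⟩ := Finset.mem_image.1 h0
  rw [hq] at hi
  have := hpos i
  nlinarith

end Coordinates

/-! ### Roots in orthonormal coordinates -/

section SignedRoots

variable {n r : ℕ} {G : Subgroup (OrthGroup n)} {ε : Fin r → Space n}

lemma neg_mem_rootSet {v : Space n} (hv : v ∈ rootSet G) : -v ∈ rootSet G := by
  rw [← neg_one_smul ℝ v]
  exact smul_mem_rootSet (by norm_num) hv

lemma mem_rootSet_of_reflect {v w u : Space n} (hv : v ∈ rootSet G) (hw : w ∈ rootSet G) (c : ℝ)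
    (hc : 2 * inner ℝ v w = c * (inner ℝ v v : ℝ)) (hu : u = w - c • v) : u ∈ rootSet G := by
  have h := reflect_mem_rootSet hv hw
  rw [hc, mul_div_cancel_right₀ _ (inner_self_ne_zero.2 hv.1)] at h
  rwa [hu]

/-- The inner products with differences of members are as for an orthonormal family. -/
def HasUnitDifferences (ε : Fin r → Space n) : Prop :=
  ∀ m i j, inner ℝ (ε m) (ε i - ε j) = (if m = i then (1 : ℝ) else 0) - if m = j then 1 else 0

lemma Orthonormal.hasUnitDifferences (hε : Orthonormal ℝ ε) : HasUnitDifferences ε := by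
  intro m i j
  rw [inner_sub_right, orthonormal_iff_ite.1 hε, orthonormal_iff_ite.1 hε]

lemma sub_trans_mem_rootSet (hε : HasUnitDifferences ε) {i j l : Fin r} (hij : i ≠ j) (hjl : j ≠ l)
    (hil : i ≠ l) (h1 : ε i - ε j ∈ rootSet G) (h2 : ε j - ε l ∈ rootSet G) :
    ε i - ε l ∈ rootSet G := by
  refine mem_rootSet_of_reflect h2 h1 (-1) ?_ (by simp)
  simp only [inner_sub_left, hε _ _ _, if_pos, if_neg hij.symm, if_neg hjl, if_neg hil.symm,
    if_neg hjl.symm]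
  norm_num

lemma sub_mem_rootSet_of_adjacent (hε : HasUnitDifferences ε)
    (h : ∀ i j : Fin r, (i : ℕ) + 1 = j → ε i - ε j ∈ rootSet G) :
    ∀ i j, i ≠ j → ε i - ε j ∈ rootSet G := by
  have hlt : ∀ m : ℕ, ∀ i j : Fin r, (i : ℕ) + (m + 1) = j → ε i - ε j ∈ rootSet G := by
    intro m
    induction m with
    | zero => exact fun i j hij => h i j hij
    | succ m ih =>
      intro i j hij
      have hj := j.2
      let l : Fin r := ⟨i + (m + 1), by omega⟩
      refine sub_trans_mem_rootSet hε (j := l) ?_ ?_ ?_ (ih i l rfl)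
        (h l j (by simp only [l]; omega))
      all_goals
        rw [Ne, Fin.ext_iff]
        grind
  intro i j hij
  rcases lt_or_gt_of_ne (fun h => hij (Fin.ext h) : (i : ℕ) ≠ j) with hl | hl
  · exact hlt (j - i - 1) i j (by omega)
  · rw [← neg_sub]
    exact neg_mem_rootSet (hlt (i - j - 1) j i (by omega))

/-- Reflection in `ε i - ε l` replaces the index `i` of a sum by `l`, so every pair of indices is
reached from one. -/
lemma add_mem_rootSet_of_one (hε : Orthonormal ℝ ε)
    (hsub : ∀ i j, i ≠ j → ε i - ε j ∈ rootSet G) {a b : Fin r} (hab : a ≠ b)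
    (h : ε a + ε b ∈ rootSet G) : ∀ i j, i ≠ j → ε i + ε j ∈ rootSet G := by
  have step : ∀ i j l : Fin r, i ≠ j → l ≠ i → l ≠ j → ε i + ε j ∈ rootSet G →
      ε j + ε l ∈ rootSet G := by
    intro i j l hij hli hlj hr
    refine mem_rootSet_of_reflect (hsub i l hli.symm) hr 1 ?_ (by rw [one_smul]; abel)
    simp only [inner_sub_left, inner_sub_right, inner_add_right, orthonormal_iff_ite.1 hε, if_pos,
      if_neg hij, if_neg hli, if_neg hlj, if_neg hli.symm]
    norm_num
  have h' : ε b + ε a ∈ rootSet G := by rwa [add_comm]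
  have ha : ∀ l, l ≠ a → ε a + ε l ∈ rootSet G := by
    intro l hla
    by_cases hlb : l = b
    · rwa [hlb]
    · exact step b a l hab.symm hlb hla h'
  intro i j hij
  by_cases hia : i = a
  · rw [hia]; exact ha j (fun h => hij (hia.trans h.symm))
  by_cases hja : j = a
  · rw [hja, add_comm]; exact ha i hia
  · exact step a i j (Ne.symm hia) hja hij.symm (ha i hia)

lemma single_mem_rootSet_of_one (hε : Orthonormal ℝ ε)
    (hsub : ∀ i j, i ≠ j → ε i - ε j ∈ rootSet G) {a : Fin r} (h : ε a ∈ rootSet G) (i : Fin r) :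
    ε i ∈ rootSet G := by
  by_cases hia : i = a
  · rwa [hia]
  refine mem_rootSet_of_reflect (hsub a i (Ne.symm hia)) h 1 ?_ (by rw [one_smul]; abel)
  simp only [inner_sub_left, inner_sub_right, orthonormal_iff_ite.1 hε, if_pos, if_neg hia,
    if_neg (Ne.symm hia)]
  norm_num

lemma add_mem_rootSet_of_single (hε : Orthonormal ℝ ε)
    (hsub : ∀ i j, i ≠ j → ε i - ε j ∈ rootSet G) (hone : ∀ i, ε i ∈ rootSet G) (i j : Fin r)
    (hij : i ≠ j) : ε i + ε j ∈ rootSet G := by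
  refine mem_rootSet_of_reflect (hone j) (hsub i j hij) (-2) ?_ (by rw [neg_smul, two_smul]; abel)
  simp only [inner_sub_right, orthonormal_iff_ite.1 hε, if_pos, if_neg hij.symm]
  norm_num

/-- The positive roots of type `B` up to scaling, indexed by ordered pairs. -/
noncomputable def signedRoot (ε : Fin r → Space n) (p : Fin r × Fin r) : Space n :=
  if p.1 = p.2 then ε p.1 else if p.1 < p.2 then ε p.1 - ε p.2 else ε p.1 + ε p.2

lemma inner_signedRoot (hε : Orthonormal ℝ ε) (p : Fin r × Fin r) (m : Fin r) :
    inner ℝ (ε m) (signedRoot ε p) =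
      if m = p.1 then (1 : ℝ) else if m = p.2 then (if p.1 < p.2 then -1 else 1) else 0 := by
  rw [signedRoot]
  split_ifs with h1 h2 h3 h4 h5 <;>
    simp only [inner_sub_right, inner_add_right, orthonormal_iff_ite.1 hε] <;> grind

lemma signedRoot_ne_smul (hε : Orthonormal ℝ ε) (p p' : Fin r × Fin r) (hp : p ≠ p') (c : ℝ) :
    signedRoot ε p ≠ c • signedRoot ε p' := by
  intro h
  have hm : ∀ m, (inner ℝ (ε m) (signedRoot ε p) : ℝ) = c * inner ℝ (ε m) (signedRoot ε p') := by
    intro m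
    rw [h, real_inner_smul_right]
  simp only [inner_signedRoot hε] at hm
  obtain ⟨i, j⟩ := p
  obtain ⟨i', j'⟩ := p'
  apply hp
  have h1 := hm i
  have h2 := hm j
  have h3 := hm i'
  have h4 := hm j'
  clear hm h hp
  simp only at h1 h2 h3 h4
  rw [Prod.mk.injEq]
  grind

/-- The reflection swaps two coordinates. Only inner products with differences enter, so this
applies also to the dependent coordinate vectors of type `A`. -/
lemma inner_reflection_sub (hε : HasUnitDifferences ε) {i j : Fin r} (hij : i ≠ j) (m : Fin r)
    (x : Space n) : inner ℝ (ε m) (hyperplaneReflection (ε i - ε j) x) =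
      (inner ℝ (ε (Equiv.swap i j m)) x : ℝ) := by
  rw [hyperplaneReflection_apply, inner_sub_right, real_inner_smul_right]
  have hn : (inner ℝ (ε i - ε j) (ε i - ε j) : ℝ) = 2 := by
    simp only [inner_sub_left, hε _ _ _, if_pos, if_neg hij, if_neg hij.symm]
    norm_num
  rw [hn, mul_div_cancel_left₀ _ (two_ne_zero), inner_sub_left, hε]
  by_cases hmi : m = i
  · subst hmi; simp [hij]
  by_cases hmj : m = j
  · subst hmj; simp [hmi]
  · simp [hmi, hmj, Equiv.swap_apply_of_ne_of_ne hmi hmj]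

lemma inner_reflection_add (hε : Orthonormal ℝ ε) {i j : Fin r} (hij : i ≠ j) (m : Fin r)
    (x : Space n) : inner ℝ (ε m) (hyperplaneReflection (ε i + ε j) x) =
      (if m = i ∨ m = j then -1 else 1) * (inner ℝ (ε (Equiv.swap i j m)) x : ℝ) := by
  rw [hyperplaneReflection_apply, inner_sub_right, real_inner_smul_right]
  have hn : (inner ℝ (ε i + ε j) (ε i + ε j) : ℝ) = 2 := by
    simp only [inner_add_left, inner_add_right, orthonormal_iff_ite.1 hε, if_pos, if_neg hij,
      if_neg hij.symm]
    norm_num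
  rw [hn, mul_div_cancel_left₀ _ (two_ne_zero), inner_add_left, inner_add_right,
    orthonormal_iff_ite.1 hε, orthonormal_iff_ite.1 hε]
  by_cases hmi : m = i
  · subst hmi; simp [hij]
  by_cases hmj : m = j
  · subst hmj; simp [hmi]
  · simp [hmi, hmj, Equiv.swap_apply_of_ne_of_ne hmi hmj]

lemma inner_reflection_single (hε : Orthonormal ℝ ε) (i m : Fin r) (x : Space n) :
    inner ℝ (ε m) (hyperplaneReflection (ε i) x) =
      (if m = i then -1 else 1) * (inner ℝ (ε m) x : ℝ) := by
  rw [hyperplaneReflection_apply_unit (hε.1 i), inner_sub_right, real_inner_smul_right,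
    orthonormal_iff_ite.1 hε]
  split_ifs with h
  · rw [h]; ring
  · ring

lemma evalAt_powerSum_reflection_sub (hε : HasUnitDifferences ε) {i j : Fin r} (hij : i ≠ j) (m : ℕ)
    (x : Space n) : evalAt (hyperplaneReflection (ε i - ε j) x) (powerSum ε m) =
      evalAt x (powerSum ε m) := by
  simp only [evalAt_powerSum, inner_reflection_sub hε hij]
  exact Equiv.sum_comp (Equiv.swap i j) fun l => (inner ℝ (ε l) x : ℝ) ^ m

lemma evalAt_powerSum_reflection_add (hε : Orthonormal ℝ ε) {i j : Fin r} (hij : i ≠ j) {m : ℕ}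
    (hm : Even m) (x : Space n) : evalAt (hyperplaneReflection (ε i + ε j) x) (powerSum ε m) =
      evalAt x (powerSum ε m) := by
  simp only [evalAt_powerSum, inner_reflection_add hε hij]
  rw [← Equiv.sum_comp (Equiv.swap i j) fun l => (inner ℝ (ε l) x : ℝ) ^ m]
  refine Finset.sum_congr rfl fun l _ => ?_
  split_ifs
  · rw [neg_one_mul, hm.neg_pow]
  · rw [one_mul]

lemma evalAt_powerSum_reflection_single (hε : Orthonormal ℝ ε) (i : Fin r) {m : ℕ}
    (hm : Even m) (x : Space n) : evalAt (hyperplaneReflection (ε i) x) (powerSum ε m) =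
      evalAt x (powerSum ε m) := by
  simp only [evalAt_powerSum, inner_reflection_single hε]
  refine Finset.sum_congr rfl fun l _ => ?_
  split_ifs
  · rw [neg_one_mul, hm.neg_pow]
  · rw [one_mul]

end SignedRoots

/-! ### Type `B` -/

section TypeB

variable {n r : ℕ} {G : Subgroup (OrthGroup n)} {ε : Fin r → Space n}

lemma sum_fin_odd (r : ℕ) : ∑ j : Fin r, (2 * (j : ℕ) + 2 - 1) = r * r := by
  induction r with
  | zero => rfl
  | succ r ih =>
    rw [Fin.sum_univ_castSucc]
    simp only [Fin.val_castSucc, Fin.val_last, ih]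
    have : 2 * r + 2 - 1 = 2 * r + 1 := by omega
    rw [this]
    ring

/-- The sum of the odd numbers `2 * j + 1` is `r * r`, which is the number of roots up to scaling.
-/
lemma isCompleteFamily_typeB (hε : Orthonormal ℝ ε)
    (hfix : fixedSubspace G = (Submodule.span ℝ (Set.range ε))ᗮ)
    (hsub : ∀ i j, i ≠ j → ε i - ε j ∈ rootSet G) (hone : ∀ i, ε i ∈ rootSet G)
    (hinv : ∀ m, Even m → powerSum ε m ∈ invariantRing G) :
    IsCompleteFamily G
      (Sum.elim (fun l => linForm (fixedBasis G l)) fun j : Fin r => powerSum ε (2 * j + 2))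
      (Sum.elim (fun _ => 1) fun j => 2 * j + 2) where
  card_eq := by simpa using finrank_fixedSubspace_add hε hfix
  pos := by rintro (l | j) <;> simp
  mem_invariantRing := by
    rintro (l | j)
    · exact linForm_mem_invariantRing (fixedBasis_mem l)
    · exact hinv _ ⟨j + 1, by ring⟩
  homogeneous := by
    rintro (l | j)
    · exact isHomogeneous_linForm _
    · exact isHomogeneous_powerSum _ _
  linearIndependent := by
    obtain ⟨a, -, -, ha⟩ := exists_generic_point hε
    refine ⟨a, ?_⟩
    convert linearIndependent_evenPowerSums hε hfix ha.ge using 1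
    funext o
    rcases o with l | j <;> simp [polyGrad_linForm]
  sum_le := by
    refine ⟨Fin r × Fin r, inferInstance, signedRoot ε, fun p => ?_,
      signedRoot_ne_smul hε, ?_⟩
    · rw [signedRoot]
      split_ifs with h1 h2
      · exact hone _
      · exact hsub _ _ h1
      · exact add_mem_rootSet_of_single hε hsub hone _ _ h1
    · rw [Fintype.sum_sum_type]
      simp only [Sum.elim_inl, Sum.elim_inr, sum_fin_odd]
      simp

/-- At a minimum of the next even power sum, `k + 1` nonlinear gradients depend on each other and on
V^G, so at most `k` nonzero squares occur among the coordinates. Vanishing coordinates are handled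
by the roots `ε i`. -/
theorem fibresMeetStratum_typeB (hε : Orthonormal ℝ ε)
    (hfix : fixedSubspace G = (Submodule.span ℝ (Set.range ε))ᗮ)
    (hsub : ∀ i j, i ≠ j → ε i - ε j ∈ rootSet G) (hone : ∀ i, ε i ∈ rootSet G)
    (hinv : ∀ m, Even m → powerSum ε m ∈ invariantRing G) {k : ℕ} (hk1 : 1 ≤ k)
    (hk : finrank ℝ (fixedSubspace G) + k ≤ n) :
    FibresMeetStratum G (finrank ℝ (fixedSubspace G) + k) := by
  intro π hπ p
  have hkr : k ≤ r := by
    have := finrank_fixedSubspace_add hε hfix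
    omega
  let f : Fin (finrank ℝ (fixedSubspace G)) ⊕ Fin k → MvPolynomial (Fin n) ℝ :=
    Sum.elim (fun l => linForm (fixedBasis G l)) fun j => powerSum ε (2 * j + 2)
  have hcompact : IsCompact {x : Space n | ∀ i, evalAt x (f i) = evalAt p (f i)} := by
    refine isCompact_of_coordinates ε (eq_zero_of_coordinates hfix) (isClosed_fibre f p) p
      (fun x hx l => ?_) fun x hx => hx (Sum.inr ⟨0, hk1⟩)
    have := hx (Sum.inl l)
    simpa only [f, Sum.elim_inl, evalAt_linForm] using this
  obtain ⟨q, hq, -, hext⟩ := exists_min_on_fibre f p hcompact (powerSum ε (2 * k + 2))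
  refine ⟨q, ?_, fun i hi => ?_⟩
  · have hcard : ((squareSet ε q).erase 0).card ≤ k := by
      by_contra! hlt
      have h := card_le_of_isLocalExtrOn f _ hext _
        (linearIndependent_evenPowerSums hε hfix (Nat.succ_le_of_lt hlt)) (by
          rintro (l | j)
          · refine Submodule.subset_span (Or.inr ⟨Sum.inl l, ?_⟩)
            simp [f, polyGrad_linForm]
          · rcases Nat.lt_succ_iff_lt_or_eq.1 j.2 with hj | hj
            · exact Submodule.subset_span (Or.inr ⟨Sum.inr ⟨j, hj⟩, rfl⟩)
            · refine Submodule.subset_span (Or.inl ?_)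
              simp [hj])
      simp at h
    refine mem_stratum_of_squares hfix hsub (add_mem_rootSet_of_single hε hsub hone) hk _ hcard
      fun i => ?_
    by_cases h0 : (inner ℝ (ε i) q : ℝ) = 0
    · exact Or.inr fun x hx => hx _ (hone i) h0
    · exact Or.inl (Finset.mem_erase.2 ⟨pow_ne_zero 2 h0, mem_squareSet q i⟩)
  -- The bound `2 * k + 1` admits exactly the linear invariants and the first `k` even power sums.
  · refine hπ.evalAt_eq_of_family (isCompleteFamily_typeB hε hfix hsub hone hinv)
      (m := 2 * k + 1) (κ' := Fin (finrank ℝ (fixedSubspace G)) ⊕ Fin k)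
      (Sum.map id (Fin.castLE hkr)) ?_ ?_ (by simp) ?_ i hi
    · exact Function.Injective.sumMap Function.injective_id (Fin.castLE_injective hkr)
    · rintro (l | j)
      · simp
      · have := j.2
        simp only [Sum.map_inr, Sum.elim_inr, Fin.val_castLE]
        omega
    · rintro (l | j) hj
      · exact hq (Sum.inl l)
      · simp only [Sum.elim_inr] at hj
        exact hq (Sum.inr ⟨j, by omega⟩)

end TypeB

/-! ### Models of the Coxeter types -/

section Models

variable {n r : ℕ} {G : Subgroup (OrthGroup n)}

/-- The Gram matrix determines the simple roots up to isometry, so the standard basis of a model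
that the model roots span is carried to orthonormal coordinates on the complement of V^G. -/
lemma exists_orthonormal_of_model {B : Type} {α : B → Space n}
    (hG : G = Subgroup.closure (Set.range fun i => hyperplaneReflection (α i)))
    (hα : ∀ i, α i ≠ 0) (α' : B → EuclideanSpace ℝ (Fin r))
    (hspan : Submodule.span ℝ (Set.range α') = ⊤)
    (hgram : ∀ i j, inner ℝ (α i) (α j) = (inner ℝ (α' i) (α' j) : ℝ)) :
    ∃ T : EuclideanSpace ℝ (Fin r) →ₗ[ℝ] Space n, (∀ i, T (α' i) = α i) ∧
      Orthonormal ℝ (fun i => T (EuclideanSpace.single i 1)) ∧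
      fixedSubspace G =
        (Submodule.span ℝ (Set.range fun i => T (EuclideanSpace.single i 1)))ᗮ := by
  classical
  obtain ⟨T, hT, hTin, hTspan⟩ := exists_partialIsometry α' α hgram
  refine ⟨T, hT, ?_, ?_⟩
  · rw [orthonormal_iff_ite]
    intro i j
    rw [hTin _ _ (by rw [hspan]; trivial), EuclideanSpace.inner_single_left,
      PiLp.single_apply]
    simp
  · rw [fixedSubspace_eq hG hα]
    congr 1
    refine le_antisymm (Submodule.span_le.2 ?_) (Submodule.span_le.2 ?_)
    · rintro _ ⟨i, rfl⟩
      rw [← hT]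
      have h : α' i = ∑ m, α' i m • EuclideanSpace.single m (1 : ℝ) := by
        ext m; simp [Pi.single_apply]
      rw [h, map_sum]
      refine Submodule.sum_mem _ fun m _ => ?_
      rw [map_smul]
      exact Submodule.smul_mem _ _ (Submodule.subset_span ⟨m, rfl⟩)
    · rintro _ ⟨i, rfl⟩
      exact hTspan _

/-- The standard basis vector with index `k`, or zero if `k` is out of range. -/
noncomputable def stdVec (r k : ℕ) : EuclideanSpace ℝ (Fin r) :=
  if h : k < r then EuclideanSpace.single ⟨k, h⟩ 1 else 0

lemma inner_stdVec (r k l : ℕ) :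
    inner ℝ (stdVec r k) (stdVec r l) = if k = l ∧ k < r then (1 : ℝ) else 0 := by
  rw [stdVec, stdVec]
  split_ifs with h1 h2 h3 h3 h4 h5 <;>
    simp [EuclideanSpace.inner_single_left] <;> omega

lemma stdVec_eq {k : ℕ} (h : k < r) : stdVec r k = EuclideanSpace.single ⟨k, h⟩ 1 := dif_pos h

lemma span_eq_top_of_stdVec {s : Set (EuclideanSpace ℝ (Fin r))}
    (h : ∀ k, k < r → stdVec r k ∈ Submodule.span ℝ s) : Submodule.span ℝ s = ⊤ := by
  rw [eq_top_iff]
  intro x _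
  have hx : x = ∑ m, x m • EuclideanSpace.single m (1 : ℝ) := by
    ext m; simp [Pi.single_apply]
  rw [hx]
  refine Submodule.sum_mem _ fun m _ => Submodule.smul_mem _ _ ?_
  rw [← stdVec_eq m.2]
  exact h m m.2

lemma neg_cos_pi_div_one : -Real.cos (Real.pi / (1 : ℕ)) = 1 := by simp
lemma neg_cos_pi_div_two : -Real.cos (Real.pi / (2 : ℕ)) = 0 := by simp
lemma neg_cos_pi_div_three : -Real.cos (Real.pi / (3 : ℕ)) = -(1 / 2) := by
  push_cast; rw [Real.cos_pi_div_three]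
lemma neg_cos_pi_div_four : -Real.cos (Real.pi / (4 : ℕ)) = -(√2)⁻¹ := by
  push_cast; rw [Real.cos_pi_div_four]
  have : √2 * √2 = 2 := Real.mul_self_sqrt (by norm_num)
  field_simp
  linarith

lemma inv_sqrt_two_mul_self : (√2)⁻¹ * (√2)⁻¹ = (1 / 2 : ℝ) := by
  rw [← mul_inv, Real.mul_self_sqrt (by norm_num)]; norm_num

lemma inv_sqrt_two_ne_zero : (√2)⁻¹ ≠ (0 : ℝ) := by positivity

/-- Simple roots of type `B`. -/
noncomputable def modelB (r : ℕ) (i : Fin r) : EuclideanSpace ℝ (Fin r) :=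
  if (i : ℕ) + 1 < r then (√2)⁻¹ • (stdVec r i - stdVec r (i + 1)) else stdVec r i

lemma gram_modelB (r : ℕ) (i j : Fin r) : inner ℝ (modelB r i) (modelB r j) =
    -Real.cos (Real.pi / (CoxeterMatrix.B r i j : ℝ)) := by
  have hi := i.2
  have hj := j.2
  have hM : CoxeterMatrix.B r i j = if i = j then 1
    else if (i : ℕ) = r - 1 ∧ (j : ℕ) = r - 2 ∨ (j : ℕ) = r - 1 ∧ (i : ℕ) = r - 2 then 4
    else if (j : ℕ) + 1 = i ∨ (i : ℕ) + 1 = j then 3 else 2 := by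
      simp [CoxeterMatrix.B]
  have h2 := inv_sqrt_two_mul_self
  rw [hM, modelB, modelB]
  simp only [Fin.ext_iff]
  generalize (i : ℕ) = a at *
  generalize (j : ℕ) = b at *
  set c := (√2)⁻¹ with hc
  split_ifs <;>
    simp only [inner_sub_left, inner_sub_right, real_inner_smul_left, real_inner_smul_right,
      inner_stdVec, neg_cos_pi_div_one, neg_cos_pi_div_two, neg_cos_pi_div_three,
      neg_cos_pi_div_four, ← hc] <;> grind

lemma span_modelB (r : ℕ) : Submodule.span ℝ (Set.range (modelB r)) = ⊤ := by
  refine span_eq_top_of_stdVec fun k hk => ?_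
  obtain ⟨m, rfl⟩ : ∃ m, k = r - 1 - m := ⟨r - 1 - k, by omega⟩
  induction m with
  | zero =>
    refine Submodule.subset_span ⟨⟨r - 1, by omega⟩, ?_⟩
    rw [modelB, if_neg (by simp only; omega), Nat.sub_zero]
  | succ m ih =>
    by_cases hm : r - 1 - m = 0
    · have : r - 1 - (m + 1) = r - 1 - m := by omega
      rw [this] at hk ⊢
      exact ih hk
    have hroot : modelB r ⟨r - 1 - (m + 1), hk⟩ ∈ Submodule.span ℝ (Set.range (modelB r)) :=
      Submodule.subset_span ⟨_, rfl⟩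
    rw [modelB, if_pos (by simp only; omega)] at hroot
    simp only at hroot
    rw [Submodule.smul_mem_iff _ inv_sqrt_two_ne_zero] at hroot
    have h1 : r - 1 - (m + 1) + 1 = r - 1 - m := by omega
    rw [h1] at hroot
    have := Submodule.add_mem _ hroot (ih (by omega))
    rwa [sub_add_cancel] at this

lemma ne_zero_of_gram {B : Type} {M : CoxeterMatrix B} {α : B → Space n}
    (h : ∀ i j, inner ℝ (α i) (α j) = -Real.cos (Real.pi / (M i j : ℝ))) (i : B) : α i ≠ 0 := by
  intro h0
  have := h i i
  rw [h0, inner_zero_left, M.diagonal] at this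
  simp at this

theorem fibresMeetStratum_of_hasCoxeterType_B (h : HasCoxeterType G (CoxeterMatrix.B r)) {k : ℕ}
    (hk1 : 1 ≤ k) (hk : finrank ℝ (fixedSubspace G) + k ≤ n) :
    FibresMeetStratum G (finrank ℝ (fixedSubspace G) + k) := by
  obtain ⟨α, hgram, hG⟩ := h
  have hα := ne_zero_of_gram hgram
  obtain ⟨T, hT, hε, hfix⟩ := exists_orthonormal_of_model hG hα (modelB r) (span_modelB r)
    fun i j => by rw [hgram, gram_modelB]
  set ε := fun i : Fin r => T (EuclideanSpace.single i 1) with hεdef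
  have hroot := mem_rootSet_of_closure hG hα
  have hadj : ∀ i j : Fin r, (i : ℕ) + 1 = j → α i = (√2)⁻¹ • (ε i - ε j) := by
    intro i j hij
    rw [← hT, modelB, if_pos (by rw [hij]; exact j.2), map_smul, map_sub, stdVec_eq i.2,
      stdVec_eq (by rw [hij]; exact j.2)]
    simp only [hij]
    rfl
  have hlast : ∀ i : Fin r, ¬ (i : ℕ) + 1 < r → α i = ε i := by
    intro i hi
    rw [← hT, modelB, if_neg hi, stdVec_eq i.2]
  have hsub : ∀ i j, i ≠ j → ε i - ε j ∈ rootSet G := by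
    refine sub_mem_rootSet_of_adjacent hε.hasUnitDifferences fun i j hij => ?_
    have := smul_mem_rootSet (inv_ne_zero inv_sqrt_two_ne_zero) (hroot i)
    rwa [hadj i j hij, smul_smul, inv_mul_cancel₀ inv_sqrt_two_ne_zero, one_smul] at this
  have hone : ∀ i, ε i ∈ rootSet G := by
    intro i
    have hi := i.2
    refine single_mem_rootSet_of_one hε hsub (a := ⟨r - 1, by omega⟩) ?_ i
    rw [← hlast _ (by simp only; omega)]
    exact hroot _
  refine fibresMeetStratum_typeB hε hfix hsub hone (fun m hm => ?_) hk1 hk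
  refine mem_invariantRing_of_generators hG fun i x => ?_
  by_cases hi : (i : ℕ) + 1 < r
  · rw [hadj i ⟨i + 1, hi⟩ rfl, hyperplaneReflection_smul _ inv_sqrt_two_ne_zero]
    exact evalAt_powerSum_reflection_sub hε.hasUnitDifferences (by rw [Ne, Fin.ext_iff]; simp) m x
  · rw [hlast i hi]
    exact evalAt_powerSum_reflection_single hε i hm x

end Models

/-! ### Linear parts of weighted homogeneous polynomials -/

section LinearPart

/-- In a weighted homogeneous polynomial of degree at most `m`, variables of weight `m` occur only
linearly. -/
lemma exists_linear_part {ι : Type*} [Fintype ι] {w : ι → ℕ} (hw0 : ∀ j, 0 < w j)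
    {Q : MvPolynomial ι ℝ} {m' m : ℕ} (hQ : IsWeightedHomogeneous w Q m') (hm : m' ≤ m) :
    ∃ R ∈ supported ℝ {l | w l < m},
      Q = ∑ j with w j = m, C (coeff (Finsupp.single j 1) Q) * X j + R := by
  classical
  refine ⟨Q - ∑ j with w j = m, C (coeff (Finsupp.single j 1) Q) * X j, ?_, by ring⟩
  rw [mem_supported]
  intro i hi
  rw [Finset.mem_coe, mem_vars_iff_mem_support] at hi
  obtain ⟨s, hs, his⟩ := hi
  by_contra hlt
  rw [Set.mem_ofPred_eq, not_lt] at hlt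
  rw [MvPolynomial.mem_support_iff, coeff_sub, coeff_sum] at hs
  simp only [coeff_C_mul, coeff_X] at hs
  rw [Finsupp.mem_support_iff] at his
  -- The subtracted sum has only monomials of `Q`, so a surviving monomial occurs in `Q`.
  have hQs : coeff s Q ≠ 0 := by
    intro h0
    apply hs
    rw [h0, zero_sub, neg_eq_zero]
    refine Finset.sum_eq_zero fun j _ => ?_
    split_ifs with h
    · rw [h, h0, zero_mul]
    · rw [mul_zero]
  have hw := hQ hQs
  rw [Finsupp.weight_apply, Finsupp.sum_fintype _ _ (by simp)] at hw
  simp only [smul_eq_mul] at hw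
  rw [← Finset.add_sum_erase _ _ (Finset.mem_univ i)] at hw
  -- One factor of weight at least `m` exhausts the total weight `m' ≤ m`. The monomial is therefore
  -- the variable `X i` itself, and its coefficient has been subtracted.
  have h1 : w i ≤ s i * w i := Nat.le_mul_of_pos_left _ (Nat.pos_of_ne_zero his)
  have h0 : ∑ j ∈ Finset.univ.erase i, s j * w j = 0 := by omega
  have hwi : w i = m := by omega
  have hsi : s i = 1 := by
    have h2 : s i * w i = 1 * w i := by omega
    exact Nat.eq_of_mul_eq_mul_right (hw0 i) h2
  have hss : s = Finsupp.single i 1 := by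
    ext j
    by_cases hj : j = i
    · rw [hj, hsi, Finsupp.single_eq_same]
    · have := Finset.sum_eq_zero_iff.1 h0 j (Finset.mem_erase.2 ⟨hj, Finset.mem_univ j⟩)
      rw [Finsupp.single_eq_of_ne hj]
      exact (Nat.mul_eq_zero.1 this).resolve_right (hw0 j).ne'
  apply hs
  rw [Finset.sum_eq_single i, hss, if_pos rfl, mul_one, sub_self]
  · intro j _ hj
    rw [hss, if_neg, mul_zero]
    intro h
    exact hj (Finsupp.single_left_injective one_ne_zero h)
  · intro h
    exact absurd (Finset.mem_filter.2 ⟨Finset.mem_univ i, hwi⟩) h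

lemma eval_eq_of_mem_supported {ι : Type*} {s : Set ι} {R : MvPolynomial ι ℝ}
    (hR : R ∈ supported ℝ s) {x y : ι → ℝ} (h : ∀ i ∈ s, x i = y i) : eval x R = eval y R := by
  refine eval₂Hom_congr' rfl (fun i hi _ => ?_) rfl
  exact h i (mem_supported.1 hR (Finset.mem_coe.2 hi))

end LinearPart

/-! ### The product of the coordinates -/

section ProdPoly

variable {n r : ℕ} {G : Subgroup (OrthGroup n)} {ε : Fin r → Space n}

/-- The product of the linear forms `⟪ε i, ·⟫`. -/
noncomputable def prodPoly (ε : Fin r → Space n) : MvPolynomial (Fin n) ℝ := ∏ i, linForm (ε i)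

lemma evalAt_prodPoly (q : Space n) : evalAt q (prodPoly ε) = ∏ i, (inner ℝ (ε i) q : ℝ) := by
  simp only [prodPoly, evalAt_prod, evalAt_linForm]

lemma isHomogeneous_prodPoly : (prodPoly ε).IsHomogeneous r := by
  have := IsHomogeneous.prod Finset.univ (fun i => linForm (ε i)) (fun _ => 1)
    fun i _ => isHomogeneous_linForm (ε i)
  simpa [prodPoly] using this

lemma polyGrad_prodPoly (q : Space n) : polyGrad (prodPoly ε) q =
    ∑ i, (∏ j ∈ Finset.univ.erase i, (inner ℝ (ε j) q : ℝ)) • ε i := by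
  simp only [prodPoly, polyGrad_prod, evalAt_linForm, polyGrad_linForm]

/-- Every partial product omits only one factor, hence still contains one of the two zeros. -/
lemma polyGrad_prodPoly_eq_zero {q : Space n} {i j : Fin r} (hij : i ≠ j)
    (hi : (inner ℝ (ε i) q : ℝ) = 0) (hj : (inner ℝ (ε j) q : ℝ) = 0) :
    polyGrad (prodPoly ε) q = 0 := by
  rw [polyGrad_prodPoly]
  refine Finset.sum_eq_zero fun l _ => ?_
  by_cases hl : l = i
  · rw [Finset.prod_eq_zero (Finset.mem_erase.2 ⟨fun h => hij (hl.symm.trans h.symm),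
      Finset.mem_univ j⟩) hj, zero_smul]
  · rw [Finset.prod_eq_zero (Finset.mem_erase.2 ⟨Ne.symm hl, Finset.mem_univ i⟩) hi, zero_smul]

lemma evalAt_prodPoly_reflection_sub (hε : Orthonormal ℝ ε) {i j : Fin r} (hij : i ≠ j)
    (x : Space n) : evalAt (hyperplaneReflection (ε i - ε j) x) (prodPoly ε) =
      evalAt x (prodPoly ε) := by
  simp only [evalAt_prodPoly, inner_reflection_sub hε.hasUnitDifferences hij]
  exact Equiv.prod_comp (Equiv.swap i j) fun l => (inner ℝ (ε l) x : ℝ)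

lemma evalAt_prodPoly_reflection_add (hε : Orthonormal ℝ ε) {i j : Fin r} (hij : i ≠ j)
    (x : Space n) : evalAt (hyperplaneReflection (ε i + ε j) x) (prodPoly ε) =
      evalAt x (prodPoly ε) := by
  simp only [evalAt_prodPoly, inner_reflection_add hε hij]
  rw [Finset.prod_mul_distrib, Equiv.prod_comp (Equiv.swap i j) fun l => (inner ℝ (ε l) x : ℝ)]
  have h : ∀ m : Fin r, (if m = i ∨ m = j then (-1 : ℝ) else 1) =
      (if m = i then -1 else 1) * (if m = j then -1 else 1) := by
    intro m
    by_cases hi : m = i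
    · subst hi; simp [hij]
    · simp [hi]
  rw [Finset.prod_congr rfl fun m _ => h m, Finset.prod_mul_distrib]
  simp

/-- Independence of the gradients of the even power sums and a further vector. -/
lemma linearIndependent_evenPowerSums_option (hε : Orthonormal ℝ ε)
    (hfix : fixedSubspace G = (Submodule.span ℝ (Set.range ε))ᗮ) {m : ℕ} {q : Space n}
    (hm : m + 1 ≤ (squareSet ε q).card) (u : Fin r → ℝ) (e : ℝ)
    (hu : ∀ i, inner ℝ (ε i) q * u i = e) (hne : ∃ i, u i ≠ 0) :
    LinearIndependent ℝ (Sum.elim (fixedBasis G) fun o : Option (Fin m) =>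
      o.elim (∑ i, u i • ε i) fun j => polyGrad (powerSum ε (2 * j + 2)) q) := by
  rw [Fintype.linearIndependent_iff]
  intro g hg
  let w : Option (Fin m) → Fin r → ℝ := fun o i =>
    o.elim (u i) fun j => ((2 * j + 2 : ℕ) : ℝ) * (inner ℝ (ε i) q : ℝ) ^ (2 * (j : ℕ) + 2 - 1)
  have hw : (fun o : Option (Fin m) => o.elim (∑ i, u i • ε i)
      fun j => polyGrad (powerSum ε (2 * j + 2)) q) = fun o => ∑ i, w o i • ε i := by
    funext o
    cases o <;> simp [w, polyGrad_powerSum]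
  rw [hw] at hg
  obtain ⟨h1, h2⟩ := coordinates_of_relation hε hfix _ g hg
  simp only [Fintype.sum_option, w, Option.elim_none, Option.elim_some] at h2
  -- Multiplied by its coordinate, the relation becomes a polynomial in the square of the
  -- coordinate: the vector `u` contributes the constant term and the power sums the others. Thus
  -- zero counts as a square here.
  let c : Fin (m + 1) → ℝ := Fin.cons (g (Sum.inr none) * e)
    fun j : Fin m => g (Sum.inr (some j)) * ((2 * j + 2 : ℕ) : ℝ)
  have h3 := eq_zero_of_sum_pow_eq_zero c _ hm (by
    intro s hs
    obtain ⟨i, -, rfl⟩ := Finset.mem_image.1 hs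
    rw [Fin.sum_univ_succ]
    simp only [c, Fin.cons_zero, Fin.cons_succ, Fin.val_zero, pow_zero, mul_one, Fin.val_succ]
    rw [← hu i, ← mul_zero (inner ℝ (ε i) q : ℝ), ← h2 i, mul_add, Finset.mul_sum]
    congr 1
    · ring
    · refine Finset.sum_congr rfl fun j _ => ?_
      rw [show 2 * (j : ℕ) + 2 - 1 = 2 * j + 1 by omega, ← pow_mul]
      ring)
  have h4 : ∀ j, g (Sum.inr (some j)) = 0 := by
    intro j
    have := h3 j.succ
    simp only [c, Fin.cons_succ] at this
    rcases mul_eq_zero.1 this with h | h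
    · exact h
    · exact absurd h (by positivity)
  rintro (l | _ | j)
  · exact h1 l
  · obtain ⟨i, hi⟩ := hne
    have := h2 i
    simp only [h4, zero_mul, Finset.sum_const_zero, add_zero] at this
    exact (mul_eq_zero.1 this).resolve_right hi
  · exact h4 j

lemma inner_mul_prod_erase (q : Space n) (i : Fin r) : (inner ℝ (ε i) q : ℝ) *
    ∏ j ∈ Finset.univ.erase i, (inner ℝ (ε j) q : ℝ) = evalAt q (prodPoly ε) := by
  rw [evalAt_prodPoly]
  exact Finset.mul_prod_erase Finset.univ (fun j => (inner ℝ (ε j) q : ℝ)) (Finset.mem_univ i)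

end ProdPoly

/-! ### Type `D` -/

section TypeD

variable {n r : ℕ} {G : Subgroup (OrthGroup n)} {ε : Fin r → Space n}

/-- More than `m` distinct squares would make dim V^G + m + 1 vectors in the span of the critical
gradients independent, one more than criticality allows. -/
lemma card_squareSet_le_of_isLocalExtrOn (hε : Orthonormal ℝ ε)
    (hfix : fixedSubspace G = (Submodule.span ℝ (Set.range ε))ᗮ) {ι : Type*} [Fintype ι]
    (f : ι → MvPolynomial (Fin n) ℝ) (h : MvPolynomial (Fin n) ℝ) {q : Space n}
    (hq : IsLocalExtrOn (fun x => evalAt x h) {x | ∀ i, evalAt x (f i) = evalAt q (f i)} q)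
    {m : ℕ} (hι : Fintype.card ι ≤ finrank ℝ (fixedSubspace G) + m) (u : Fin r → ℝ) (e : ℝ)
    (hu : ∀ i, inner ℝ (ε i) q * u i = e) (hne : ∃ i, u i ≠ 0)
    (hz : ∀ l, fixedBasis G l ∈ Submodule.span ℝ
      (insert (polyGrad h q) (Set.range fun i => polyGrad (f i) q)))
    (hp : ∀ j < m, polyGrad (powerSum ε (2 * j + 2)) q ∈ Submodule.span ℝ
      (insert (polyGrad h q) (Set.range fun i => polyGrad (f i) q)))
    (hw : ∑ i, u i • ε i ∈ Submodule.span ℝ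
      (insert (polyGrad h q) (Set.range fun i => polyGrad (f i) q))) :
    (squareSet ε q).card ≤ m := by
  by_contra! hlt
  have h := card_le_of_isLocalExtrOn f h hq _
    (linearIndependent_evenPowerSums_option hε hfix (Nat.succ_le_of_lt hlt) u e hu hne) (by
      rintro (l | _ | j)
      · exact hz l
      · exact hw
      · exact hp j j.2)
  simp at h
  omega

/-- The linear invariants, the first `m` even power sums and a further polynomial. -/
noncomputable def levelFamily (G : Subgroup (OrthGroup n)) (ε : Fin r → Space n) (m : ℕ)
    (g : MvPolynomial (Fin n) ℝ) :
    Fin (finrank ℝ (fixedSubspace G)) ⊕ Option (Fin m) → MvPolynomial (Fin n) ℝ :=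
  Sum.elim (fun l => linForm (fixedBasis G l)) fun o =>
    o.elim g fun j => powerSum ε (2 * j + 2)

lemma card_squareSet_le_of_levelFamily (hε : Orthonormal ℝ ε)
    (hfix : fixedSubspace G = (Submodule.span ℝ (Set.range ε))ᗮ) {m : ℕ}
    {g h : MvPolynomial (Fin n) ℝ} {q : Space n}
    (hq : IsLocalExtrOn (fun x => evalAt x h)
      {x | ∀ i, evalAt x (levelFamily G ε m g i) = evalAt q (levelFamily G ε m g i)} q)
    (u : Fin r → ℝ) (e : ℝ) (hu : ∀ i, inner ℝ (ε i) q * u i = e) (hne : ∃ i, u i ≠ 0)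
    (hp : polyGrad (powerSum ε (2 * m + 2)) q ∈ Submodule.span ℝ {polyGrad h q, polyGrad g q})
    (hw : ∑ i, u i • ε i ∈ Submodule.span ℝ {polyGrad h q, polyGrad g q}) :
    (squareSet ε q).card ≤ m + 1 := by
  have hle : Submodule.span ℝ {polyGrad h q, polyGrad g q} ≤ Submodule.span ℝ
      (insert (polyGrad h q) (Set.range fun i => polyGrad (levelFamily G ε m g i) q)) :=
    Submodule.span_mono (Set.insert_subset_insert
      (Set.singleton_subset_iff.2 ⟨Sum.inr none, rfl⟩))
  refine card_squareSet_le_of_isLocalExtrOn hε hfix _ h hq (by simp) u e hu hne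
    (fun l => ?_) (fun j hj => ?_) (hle hw)
  · refine Submodule.subset_span (Or.inr ⟨Sum.inl l, ?_⟩)
    simp [levelFamily, polyGrad_linForm]
  · rcases Nat.lt_succ_iff_lt_or_eq.1 hj with hj | rfl
    · exact Submodule.subset_span (Or.inr ⟨Sum.inr (some ⟨j, hj⟩), rfl⟩)
    · exact hle hp

lemma isCompact_levelFamily (hfix : fixedSubspace G = (Submodule.span ℝ (Set.range ε))ᗮ) {m : ℕ}
    {g : MvPolynomial (Fin n) ℝ} (p : Space n)
    (h : 1 ≤ m ∨ ∃ a : ℝ, a ≠ 0 ∧ g = a • powerSum ε 2) :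
    IsCompact {x | ∀ i, evalAt x (levelFamily G ε m g i) = evalAt p (levelFamily G ε m g i)} := by
  refine isCompact_of_coordinates ε (eq_zero_of_coordinates hfix) (isClosed_fibre _ p) p
    (fun x hx l => ?_) fun x hx => ?_
  · have := hx (Sum.inl l)
    simpa only [levelFamily, Sum.elim_inl, evalAt_linForm] using this
  · rcases h with h | ⟨a, ha, rfl⟩
    · exact hx (Sum.inr (some ⟨0, h⟩))
    · have := hx (Sum.inr none)
      simp only [levelFamily, Sum.elim_inr, Option.elim_none, evalAt_smul] at this
      exact mul_left_cancel₀ ha this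

lemma mem_stratum_of_card_squareSet_le
    (hfix : fixedSubspace G = (Submodule.span ℝ (Set.range ε))ᗮ)
    (hsub : ∀ i j, i ≠ j → ε i - ε j ∈ rootSet G) (hadd : ∀ i j, i ≠ j → ε i + ε j ∈ rootSet G)
    {k : ℕ} (hk : finrank ℝ (fixedSubspace G) + k ≤ n) {q : Space n}
    (h : (squareSet ε q).card ≤ k) : q ∈ stratum G (finrank ℝ (fixedSubspace G) + k) :=
  mem_stratum_of_squares hfix hsub hadd hk _ h fun i => Or.inl (mem_squareSet q i)

lemma exists_two_zeros (hr : 0 < r) {q : Space n}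
    (h : ¬ ∃ i, ∀ l, l ≠ i → (inner ℝ (ε l) q : ℝ) ≠ 0) :
    ∃ i j, i ≠ j ∧ (inner ℝ (ε i) q : ℝ) = 0 ∧ (inner ℝ (ε j) q : ℝ) = 0 := by
  push Not at h
  obtain ⟨i, -, hi⟩ := h ⟨0, hr⟩
  obtain ⟨j, hj, hj0⟩ := h i
  exact ⟨i, j, hj.symm, hi, hj0⟩

lemma inner_eq_zero_of_two_zeros (hsub : ∀ i j, i ≠ j → ε i - ε j ∈ rootSet G)
    (hadd : ∀ i j, i ≠ j → ε i + ε j ∈ rootSet G)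
    {q : Space n} {i j : Fin r} (hij : i ≠ j)
    (hi : (inner ℝ (ε i) q : ℝ) = 0) (hj : (inner ℝ (ε j) q : ℝ) = 0) {x : Space n}
    (hx : ∀ v ∈ rootSet G, inner ℝ v q = 0 → inner ℝ v x = 0) : inner ℝ (ε i) x = (0 : ℝ) := by
  have h1 := hx _ (hsub i j hij) (by rw [inner_sub_left, hi, hj, sub_zero])
  have h2 := hx _ (hadd i j hij) (by rw [inner_add_left, hi, hj, add_zero])
  rw [inner_sub_left] at h1
  rw [inner_add_left] at h2
  linarith

/-- The product of the coordinates is minimised and maximised. An extremum with at most one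
vanishing coordinate has a nonzero product gradient and hence few distinct squares. If no such
extremum gives a point of the stratum, the product vanishes at both extrema and so on the whole
fibre. A further minimisation, of the power sum of degree `2 * m + 4`, then finishes the proof. -/
lemma exists_mem_stratum_of_ne_zero (hε : Orthonormal ℝ ε)
    (hfix : fixedSubspace G = (Submodule.span ℝ (Set.range ε))ᗮ)
    (hsub : ∀ i j, i ≠ j → ε i - ε j ∈ rootSet G) (hadd : ∀ i j, i ≠ j → ε i + ε j ∈ rootSet G)
    (hr : 0 < r) {m : ℕ} (hm : finrank ℝ (fixedSubspace G) + (m + 1) ≤ n) {a b : ℝ} (ha : a ≠ 0)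
    (hb : 1 ≤ m ∨ b = 0) (p : Space n) :
    ∃ q ∈ stratum G (finrank ℝ (fixedSubspace G) + (m + 1)), ∀ i,
      evalAt q (levelFamily G ε m (a • powerSum ε (2 * m + 2) + b • prodPoly ε) i) =
        evalAt p (levelFamily G ε m (a • powerSum ε (2 * m + 2) + b • prodPoly ε) i) := by
  set g := a • powerSum ε (2 * m + 2) + b • prodPoly ε with hg
  set f := levelFamily G ε m g with hf
  have hcompact : IsCompact {x | ∀ i, evalAt x (f i) = evalAt p (f i)} := by
    refine isCompact_levelFamily hfix p ?_
    rcases Nat.eq_zero_or_pos m with h0 | h0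
    · right
      refine ⟨a, ha, ?_⟩
      rw [hg, hb.resolve_left (by omega), zero_smul, add_zero, h0]
    · exact Or.inl h0
  have hgrad : ∀ q, polyGrad g q =
      a • polyGrad (powerSum ε (2 * m + 2)) q + b • polyGrad (prodPoly ε) q := by
    intro q
    rw [hg, polyGrad_add, polyGrad_smul, polyGrad_smul]
  -- critical points of `prodPoly ε` with at most one vanishing coordinate
  have hcrit : ∀ q (c : ℝ), c ≠ 0 → (∀ i, evalAt q (f i) = evalAt p (f i)) →
      IsLocalExtrOn (fun x => evalAt x (c • prodPoly ε))
        {x | ∀ i, evalAt x (f i) = evalAt q (f i)} q →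
      (∃ i, ∀ l, l ≠ i → (inner ℝ (ε l) q : ℝ) ≠ 0) →
      q ∈ stratum G (finrank ℝ (fixedSubspace G) + (m + 1)) := by
    intro q c hc hq hext ⟨i, hi⟩
    refine mem_stratum_of_card_squareSet_le hfix hsub hadd hm ?_
    have hprod : polyGrad (prodPoly ε) q ∈
        Submodule.span ℝ {polyGrad (c • prodPoly ε) q, polyGrad g q} := by
      rw [← Submodule.smul_mem_iff _ hc, ← polyGrad_smul]
      exact Submodule.subset_span (Or.inl rfl)
    refine card_squareSet_le_of_levelFamily hε hfix hext
      (fun i => ∏ j ∈ Finset.univ.erase i, (inner ℝ (ε j) q : ℝ)) _ (inner_mul_prod_erase q)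
      ⟨i, Finset.prod_ne_zero_iff.2 fun l hl => hi l (Finset.ne_of_mem_erase hl)⟩ ?_ ?_
    · rw [← Submodule.smul_mem_iff _ ha, ← add_sub_cancel_right (a • _)
        (b • polyGrad (prodPoly ε) q), ← hgrad]
      exact Submodule.sub_mem _ (Submodule.subset_span (Or.inr rfl))
        (Submodule.smul_mem _ _ hprod)
    · rw [← polyGrad_prodPoly]
      exact hprod
  by_contra! hno
  have hzeros : ∀ q (c : ℝ), c ≠ 0 → (∀ i, evalAt q (f i) = evalAt p (f i)) →
      IsLocalExtrOn (fun x => evalAt x (c • prodPoly ε))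
        {x | ∀ i, evalAt x (f i) = evalAt q (f i)} q →
      ∃ i j, i ≠ j ∧ (inner ℝ (ε i) q : ℝ) = 0 ∧ (inner ℝ (ε j) q : ℝ) = 0 := by
    intro q c hc hq hext
    refine exists_two_zeros hr fun h => ?_
    obtain ⟨i, hi⟩ := hno q (hcrit q c hc hq hext h)
    exact hi (hq i)
  have hval : ∀ q, (∃ i j, i ≠ j ∧ (inner ℝ (ε i) q : ℝ) = 0 ∧ (inner ℝ (ε j) q : ℝ) = 0) →
      evalAt q (prodPoly ε) = 0 := by
    rintro q ⟨i, -, -, hi, -⟩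
    rw [evalAt_prodPoly]
    exact Finset.prod_eq_zero (Finset.mem_univ i) hi
  -- The factors `1` and `-1` give the minimum and the maximum of the product.
  obtain ⟨q₁, hq₁, hmin₁, hext₁⟩ := exists_min_on_fibre f p hcompact ((1 : ℝ) • prodPoly ε)
  obtain ⟨q₂, hq₂, hmin₂, hext₂⟩ := exists_min_on_fibre f p hcompact ((-1 : ℝ) • prodPoly ε)
  have h₁ := hval q₁ (hzeros q₁ 1 one_ne_zero hq₁ hext₁)
  have h₂ := hval q₂ (hzeros q₂ (-1) (by norm_num) hq₂ hext₂)
  have hvanish : ∀ x, (∀ i, evalAt x (f i) = evalAt p (f i)) → evalAt x (prodPoly ε) = 0 := by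
    intro x hx
    have e1 := hmin₁ x hx
    have e2 := hmin₂ x hx
    rw [evalAt_smul, evalAt_smul, h₁] at e1
    rw [evalAt_smul, evalAt_smul, h₂] at e2
    linarith
  obtain ⟨q, hq, -, hext⟩ := exists_min_on_fibre f p hcompact (powerSum ε (2 * m + 4))
  -- The product is constant on the fibre, so every point of it is an extremum, in particular `q`.
  -- Two vanishing coordinates remove the product from the gradient of `g`, leaving the power sum of
  -- degree `2 * m + 2`.
  obtain ⟨i, j, hij, hi, hj⟩ := hzeros q 1 one_ne_zero hq (by
    left
    filter_upwards [self_mem_nhdsWithin] with x hx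
    have hx' : ∀ i, evalAt x (f i) = evalAt p (f i) := fun i => (hx i).trans (hq i)
    rw [evalAt_smul, evalAt_smul, hvanish x hx', hvanish q hq])
  have hcard : ((squareSet ε q).erase 0).card ≤ m + 1 := by
    by_contra! hlt
    have h := card_le_of_isLocalExtrOn f _ hext _
      (linearIndependent_evenPowerSums hε hfix (Nat.succ_le_of_lt hlt)) (by
        rintro (l | ⟨t, ht⟩)
        · refine Submodule.subset_span (Or.inr ⟨Sum.inl l, ?_⟩)
          simp [f, levelFamily, polyGrad_linForm]
        · rcases Nat.lt_succ_iff_lt_or_eq.1 ht with ht | rfl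
          · rcases Nat.lt_succ_iff_lt_or_eq.1 ht with ht | rfl
            · exact Submodule.subset_span (Or.inr ⟨Sum.inr (some ⟨t, ht⟩), rfl⟩)
            · simp only [Sum.elim_inr]
              rw [← Submodule.smul_mem_iff _ ha]
              refine Submodule.subset_span (Or.inr ⟨Sum.inr none, ?_⟩)
              have := hgrad q
              rw [polyGrad_prodPoly_eq_zero hij hi hj, smul_zero, add_zero] at this
              exact this
          · exact Submodule.subset_span (Or.inl rfl))
    simp at h
  obtain ⟨i', hi'⟩ := hno q (by
    refine mem_stratum_of_squares hfix hsub hadd hm _ hcard fun l => ?_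
    by_cases h0 : (inner ℝ (ε l) q : ℝ) = 0
    · right
      intro x hx
      by_cases hl : l = i
      · exact inner_eq_zero_of_two_zeros hsub hadd (fun h => hij (hl.symm.trans h)) h0 hj hx
      · exact inner_eq_zero_of_two_zeros hsub hadd hl h0 hi hx
    · exact Or.inl (Finset.mem_erase.2 ⟨pow_ne_zero 2 h0, mem_squareSet q l⟩))
  exact hi' (hq i')

/-- If the product is nonzero at `p`, it is nonzero on the fibre and so is its gradient. Otherwise
some coordinate of `p` vanishes; prescribing this coordinate instead of the product gives a smaller
fibre and a coordinate vector in the role of the product gradient. -/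
lemma exists_mem_stratum_prodPoly (hε : Orthonormal ℝ ε)
    (hfix : fixedSubspace G = (Submodule.span ℝ (Set.range ε))ᗮ)
    (hsub : ∀ i j, i ≠ j → ε i - ε j ∈ rootSet G) (hadd : ∀ i j, i ≠ j → ε i + ε j ∈ rootSet G)
    (hr : 0 < r) {m : ℕ} (hm : finrank ℝ (fixedSubspace G) + (m + 1) ≤ n) (hm1 : 1 ≤ m)
    (p : Space n) :
    ∃ q ∈ stratum G (finrank ℝ (fixedSubspace G) + (m + 1)), ∀ i,
      evalAt q (levelFamily G ε m (prodPoly ε) i) =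
        evalAt p (levelFamily G ε m (prodPoly ε) i) := by
  by_cases hp : evalAt p (prodPoly ε) = 0
  · obtain ⟨i, -, hi⟩ := Finset.prod_eq_zero_iff.1 ((evalAt_prodPoly p).symm.trans hp)
    obtain ⟨q, hq, -, hext⟩ := exists_min_on_fibre _ p
      (isCompact_levelFamily hfix (g := linForm (ε i)) p (Or.inl hm1)) (powerSum ε (2 * m + 2))
    have hqi : (inner ℝ (ε i) q : ℝ) = 0 := by
      have := hq (Sum.inr none)
      simpa only [levelFamily, Sum.elim_inr, Option.elim_none, evalAt_linForm, hi] using this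
    refine ⟨q, mem_stratum_of_card_squareSet_le hfix hsub hadd hm ?_, ?_⟩
    · refine card_squareSet_le_of_levelFamily hε hfix hext (Pi.single i 1) 0 (fun l => ?_)
        ⟨i, by simp⟩ (Submodule.subset_span (Or.inl rfl)) ?_
      · by_cases hl : l = i
        · rw [hl, hqi, zero_mul]
        · rw [Pi.single_eq_of_ne hl, mul_zero]
      · refine Submodule.subset_span (Or.inr ?_)
        rw [polyGrad_linForm]
        simp [Pi.single_apply]
    · rintro (l | _ | j)
      · exact hq (Sum.inl l)
      · simp only [levelFamily, Sum.elim_inr, Option.elim_none]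
        rw [hp, evalAt_prodPoly, Finset.prod_eq_zero (Finset.mem_univ i) hqi]
      · exact hq (Sum.inr (some j))
  · obtain ⟨q, hq, -, hext⟩ := exists_min_on_fibre _ p
      (isCompact_levelFamily hfix (g := prodPoly ε) p (Or.inl hm1)) (powerSum ε (2 * m + 2))
    refine ⟨q, mem_stratum_of_card_squareSet_le hfix hsub hadd hm ?_, hq⟩
    have hne : evalAt q (prodPoly ε) ≠ 0 := by
      have := hq (Sum.inr none)
      simp only [levelFamily, Sum.elim_inr, Option.elim_none] at this
      rwa [this]
    refine card_squareSet_le_of_levelFamily hε hfix hext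
      (fun i => ∏ j ∈ Finset.univ.erase i, (inner ℝ (ε j) q : ℝ)) _ (inner_mul_prod_erase q)
      ⟨⟨0, hr⟩, fun h0 => hne ?_⟩ (Submodule.subset_span (Or.inl rfl))
      (by rw [← polyGrad_prodPoly]; exact Submodule.subset_span (Or.inr rfl))
    rw [← inner_mul_prod_erase q ⟨0, hr⟩, h0, mul_zero]

/-- The product contributes `r - 1` and the even power sums `(r - 1) * (r - 1)`, in total the number
`r * r - r` of roots up to scaling. -/
lemma isCompleteFamily_typeD (hr : 0 < r) (hε : Orthonormal ℝ ε)
    (hfix : fixedSubspace G = (Submodule.span ℝ (Set.range ε))ᗮ)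
    (hsub : ∀ i j, i ≠ j → ε i - ε j ∈ rootSet G) (hadd : ∀ i j, i ≠ j → ε i + ε j ∈ rootSet G)
    (hinv : ∀ m, Even m → powerSum ε m ∈ invariantRing G) (hprod : prodPoly ε ∈ invariantRing G) :
    IsCompleteFamily G (levelFamily G ε (r - 1) (prodPoly ε))
      (Sum.elim (fun _ => 1) fun o => o.elim r fun j => 2 * j + 2) where
  card_eq := by
    have := finrank_fixedSubspace_add hε hfix
    simp
    omega
  pos := by
    rintro (l | _ | j)
    · simp
    · exact hr
    · simp
  mem_invariantRing := by
    rintro (l | _ | j)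
    · exact linForm_mem_invariantRing (fixedBasis_mem l)
    · exact hprod
    · exact hinv _ ⟨j + 1, by ring⟩
  homogeneous := by
    rintro (l | _ | j)
    · exact isHomogeneous_linForm _
    · exact isHomogeneous_prodPoly
    · exact isHomogeneous_powerSum _ _
  linearIndependent := by
    obtain ⟨a, ha0, ha, -⟩ := exists_generic_point hε
    refine ⟨a, ?_⟩
    convert linearIndependent_evenPowerSums_option hε hfix (m := r - 1) (q := a) (by omega)
      (fun i => ∏ j ∈ Finset.univ.erase i, (inner ℝ (ε j) a : ℝ)) _ (inner_mul_prod_erase a)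
      ⟨⟨0, hr⟩, Finset.prod_ne_zero_iff.2 fun l _ => ha0 l⟩ using 1
    funext o
    rcases o with l | _ | j <;> simp [levelFamily, polyGrad_linForm, polyGrad_prodPoly]
  sum_le := by
    refine ⟨{p : Fin r × Fin r // p.1 ≠ p.2}, inferInstance, fun p => signedRoot ε p,
      fun p => ?_, fun p p' hp => signedRoot_ne_smul hε p p' fun h => hp (Subtype.ext h), ?_⟩
    · change signedRoot ε p.1 ∈ rootSet G
      rw [signedRoot, if_neg p.2]
      split_ifs with h2
      · exact hsub _ _ p.2
      · exact hadd _ _ p.2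
    · rw [Fintype.sum_sum_type, Fintype.sum_option]
      simp only [Sum.elim_inl, Sum.elim_inr, Option.elim_none, Option.elim_some, sum_fin_odd]
      have hcard : Fintype.card {p : Fin r × Fin r // p.1 ≠ p.2} = r * r - r := by
        rw [Fintype.card_subtype]
        have := Finset.offDiag_card (Finset.univ : Finset (Fin r))
        rw [Finset.card_univ, Fintype.card_fin] at this
        rw [← this]
        congr 1
        ext p
        simp
      rw [hcard]
      obtain ⟨s, rfl⟩ : ∃ s, r = s + 1 := ⟨r - 1, by omega⟩
      simp only [Nat.sub_self, Finset.sum_const_zero, zero_add, Nat.add_sub_cancel]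
      rw [show (s + 1) * (s + 1) = s + s * s + (s + 1) by ring, Nat.add_sub_cancel]

/-- The position of the degree `r` of the product decides. If it lies above `2 * (m + 1)`, only
power sums matter; if below, the product replaces the last power sum. In case of equality, the last
of the chosen basic invariants may combine both, and this combination has to be preserved. -/
theorem fibresMeetStratum_typeD (hr : 3 ≤ r) (hε : Orthonormal ℝ ε)
    (hfix : fixedSubspace G = (Submodule.span ℝ (Set.range ε))ᗮ)
    (hsub : ∀ i j, i ≠ j → ε i - ε j ∈ rootSet G) (hadd : ∀ i j, i ≠ j → ε i + ε j ∈ rootSet G)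
    (hinv : ∀ m, Even m → powerSum ε m ∈ invariantRing G) (hprod : prodPoly ε ∈ invariantRing G)
    {m : ℕ} (hm : finrank ℝ (fixedSubspace G) + (m + 1) < n) :
    FibresMeetStratum G (finrank ℝ (fixedSubspace G) + (m + 1)) := by
  intro π hπ p
  have hcomplete := isCompleteFamily_typeD (by omega) hε hfix hsub hadd hinv hprod
  have hmr : m + 1 ≤ r - 1 := by
    have := finrank_fixedSubspace_add hε hfix
    omega
  rcases lt_trichotomy (2 * (m + 1)) r with hlt | heq | hgt
  · obtain ⟨q, hqs, hq⟩ := exists_mem_stratum_of_ne_zero hε hfix hsub hadd (by omega) hm.le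
      (a := 1) (b := 0) one_ne_zero (Or.inr rfl) p
    refine ⟨q, hqs, fun i hi => ?_⟩
    refine hπ.evalAt_eq_of_family hcomplete (m := 2 * (m + 1))
      (κ' := Fin (finrank ℝ (fixedSubspace G)) ⊕ Fin (m + 1))
      (Sum.map id (some ∘ Fin.castLE hmr)) ?_ ?_ (by simp) ?_ i hi
    · exact Function.Injective.sumMap Function.injective_id
        ((Option.some_injective _).comp (Fin.castLE_injective hmr))
    · rintro (l | j)
      · simp only [Sum.map_inl, Sum.elim_inl]
        omega
      · have := j.2
        simp only [Sum.map_inr, Function.comp_apply, Sum.elim_inr, Option.elim_some,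
          Fin.val_castLE]
        omega
    · rintro (l | _ | j) hj
      · exact hq (Sum.inl l)
      · simp only [Sum.elim_inr, Option.elim_none] at hj
        omega
      · simp only [Sum.elim_inr, Option.elim_some] at hj
        rcases Nat.lt_succ_iff_lt_or_eq.1 (by omega : (j : ℕ) < m + 1) with h | h
        · exact hq (Sum.inr (some ⟨j, h⟩))
        · have := hq (Sum.inr none)
          simpa [levelFamily, evalAt_smul, evalAt_add, h] using this
  · have hlow : ∀ q, (∀ l, evalAt q (linForm (fixedBasis G l)) =
          evalAt p (linForm (fixedBasis G l))) →
        (∀ j < m, evalAt q (powerSum ε (2 * j + 2)) = evalAt p (powerSum ε (2 * j + 2))) →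
        ∀ j, Sum.elim (fun _ => 1) (fun o => o.elim r fun j => 2 * (j : ℕ) + 2) j < 2 * (m + 1) →
          evalAt q (levelFamily G ε (r - 1) (prodPoly ε) j) =
            evalAt p (levelFamily G ε (r - 1) (prodPoly ε) j) := by
      intro q hz hp
      rintro (l | _ | j) hj
      · exact hz l
      · simp only [Sum.elim_inr, Option.elim_none] at hj
        omega
      · simp only [Sum.elim_inr, Option.elim_some] at hj
        exact hp j (by omega)
    set i₀ : Fin n := ⟨finrank ℝ (fixedSubspace G) + m, by omega⟩ with hi₀
    obtain ⟨Q, hQ, hQi⟩ := hπ.exists_aeval_eq hcomplete i₀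
    have hdeg : (π i₀).totalDegree ≤ 2 * (m + 1) := by
      obtain ⟨a, ha⟩ := hcomplete.linearIndependent
      let s : Fin (finrank ℝ (fixedSubspace G)) ⊕ Fin (m + 1) → _ ⊕ Option (Fin (r - 1)) :=
        Sum.map id (some ∘ Fin.castLE hmr)
      refine hπ.totalDegree_le_of_family _ _
        (fun j => hcomplete.mem_invariantRing (s j)) (fun j => hcomplete.homogeneous (s j)) ?_
        (ha.comp s ?_) (k := finrank ℝ (fixedSubspace G) + (m + 1)) (by simp) i₀
        (by simp [hi₀])
      · rintro (l | j)
        · simp only [s, Sum.map_inl, Sum.elim_inl]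
          omega
        · have := j.2
          simp only [s, Sum.map_inr, Function.comp_apply, Sum.elim_inr, Option.elim_some,
            Fin.val_castLE]
          omega
      · exact Function.Injective.sumMap Function.injective_id
          ((Option.some_injective _).comp (Fin.castLE_injective hmr))
    -- Weights leave two invariants of top degree, which occur linearly with coefficients `a` and
    -- `b`; the remainder `R` involves only invariants already fixed.
    obtain ⟨R, hR, hQR⟩ := exists_linear_part hcomplete.pos hQ hdeg
    set a := coeff (Finsupp.single (Sum.inr (some ⟨m, by omega⟩)) 1) Q with ha
    set b := coeff (Finsupp.single (Sum.inr none) 1) Q with hb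
    have hval : ∀ q, evalAt q (π i₀) = a * evalAt q (powerSum ε (2 * m + 2)) +
        b * evalAt q (prodPoly ε) +
          eval (fun j => evalAt q (levelFamily G ε (r - 1) (prodPoly ε) j)) R := by
      intro q
      rw [← hQi, evalAt_aeval]
      conv_lhs => rw [hQR]
      rw [map_add, map_sum]
      congr 1
      rw [Finset.sum_filter, Fintype.sum_sum_type, Fintype.sum_option,
        Finset.sum_eq_zero fun l _ => if_neg (by simp only [Sum.elim_inl]; omega),
        Finset.sum_eq_single (⟨m, by omega⟩ : Fin (r - 1)), if_pos (by simp [heq]),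
        if_pos (by simp only [Sum.elim_inr, Option.elim_some]; omega)]
      · simp only [map_mul, eval_C, eval_X, levelFamily, Sum.elim_inr, Option.elim_some,
          Option.elim_none, ← ha, ← hb]
        ring
      · intro j _ hj
        refine if_neg fun h => hj (Fin.ext ?_)
        simp only [Sum.elim_inr, Option.elim_some] at h
        simp only
        omega
      · simp
    suffices h : ∃ q ∈ stratum G (finrank ℝ (fixedSubspace G) + (m + 1)),
        (∀ l, evalAt q (linForm (fixedBasis G l)) = evalAt p (linForm (fixedBasis G l))) ∧
        (∀ j < m, evalAt q (powerSum ε (2 * j + 2)) = evalAt p (powerSum ε (2 * j + 2))) ∧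
        a * evalAt q (powerSum ε (2 * m + 2)) + b * evalAt q (prodPoly ε) =
          a * evalAt p (powerSum ε (2 * m + 2)) + b * evalAt p (prodPoly ε) by
      obtain ⟨q, hqs, hz, hp, hab⟩ := h
      refine ⟨q, hqs, fun i hi => ?_⟩
      by_cases hii : i = i₀
      · rw [hii, hval, hval, hab]
        congr 1
        exact eval_eq_of_mem_supported hR (hlow q hz hp)
      · have hne : (i : ℕ) ≠ finrank ℝ (fixedSubspace G) + m := fun h => hii (Fin.ext h)
        refine hπ.evalAt_eq_of_family hcomplete (m := 2 * m + 1)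
          (k := finrank ℝ (fixedSubspace G) + m)
          (κ' := Fin (finrank ℝ (fixedSubspace G)) ⊕ Fin m)
          (Sum.map id (some ∘ Fin.castLE (by omega))) ?_ ?_ (by simp)
          (fun j hj => hlow q hz hp j (by omega)) i (by omega)
        · exact Function.Injective.sumMap Function.injective_id
            ((Option.some_injective _).comp (Fin.castLE_injective _))
        · rintro (l | j)
          · simp only [Sum.map_inl, Sum.elim_inl]
            omega
          · have := j.2
            simp only [Sum.map_inr, Function.comp_apply, Sum.elim_inr, Option.elim_some,
              Fin.val_castLE]
            omega
    -- For `a = b = 0` the last condition is empty, and the fibre of the power sums is more than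
    -- enough. For `a = 0` alone the condition fixes the product, and for `a ≠ 0` the genuine
    -- combination.
    by_cases ha0 : a = 0
    · by_cases hb0 : b = 0
      · obtain ⟨q, hqs, hq⟩ := exists_mem_stratum_of_ne_zero hε hfix hsub hadd (by omega) hm.le
          (a := 1) (b := 0) one_ne_zero (Or.inr rfl) p
        exact ⟨q, hqs, fun l => hq (Sum.inl l), fun j hj => hq (Sum.inr (some ⟨j, hj⟩)),
          by rw [ha0, hb0]; ring⟩
      · obtain ⟨q, hqs, hq⟩ := exists_mem_stratum_prodPoly hε hfix hsub hadd (by omega) hm.le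
          (by omega) p
        refine ⟨q, hqs, fun l => hq (Sum.inl l), fun j hj => hq (Sum.inr (some ⟨j, hj⟩)), ?_⟩
        have : evalAt q (prodPoly ε) = evalAt p (prodPoly ε) := hq (Sum.inr none)
        rw [this, ha0]
        ring
    · obtain ⟨q, hqs, hq⟩ := exists_mem_stratum_of_ne_zero hε hfix hsub hadd (by omega) hm.le
        (a := a) (b := b) ha0 (Or.inl (by omega)) p
      refine ⟨q, hqs, fun l => hq (Sum.inl l), fun j hj => hq (Sum.inr (some ⟨j, hj⟩)), ?_⟩
      have := hq (Sum.inr none)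
      simpa only [levelFamily, Sum.elim_inr, Option.elim_none, evalAt_add, evalAt_smul] using this
  · obtain ⟨q, hqs, hq⟩ := exists_mem_stratum_prodPoly hε hfix hsub hadd (by omega) hm.le
      (by omega) p
    refine ⟨q, hqs, fun i hi => ?_⟩
    refine hπ.evalAt_eq_of_family hcomplete (m := 2 * m + 1)
      (κ' := Fin (finrank ℝ (fixedSubspace G)) ⊕ Option (Fin m))
      (Sum.map id (Option.map (Fin.castLE (by omega)))) ?_ ?_ (by simp) ?_ i hi
    · exact Function.Injective.sumMap Function.injective_id
        (Option.map_injective (Fin.castLE_injective _))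
    · rintro (l | _ | j)
      · simp only [Sum.map_inl, Sum.elim_inl]
        omega
      · simp only [Sum.map_inr, Option.map_none, Sum.elim_inr, Option.elim_none]
        omega
      · have := j.2
        simp only [Sum.map_inr, Option.map_some, Sum.elim_inr, Option.elim_some, Fin.val_castLE]
        omega
    · rintro (l | _ | j) hj
      · exact hq (Sum.inl l)
      · exact hq (Sum.inr none)
      · simp only [Sum.elim_inr, Option.elim_some] at hj
        exact hq (Sum.inr (some ⟨j, by omega⟩))

end TypeD

/-! ### Coordinates for groups of type `D` -/

section ModelD

variable {n r : ℕ} {G : Subgroup (OrthGroup n)}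

/-- Simple roots of type `D`. -/
noncomputable def modelD (r : ℕ) (i : Fin r) : EuclideanSpace ℝ (Fin r) :=
  if (i : ℕ) + 1 < r then (√2)⁻¹ • (stdVec r i - stdVec r (i + 1))
  else (√2)⁻¹ • (stdVec r (i - 1) + stdVec r i)

lemma gram_modelD (hr : 2 ≤ r) (i j : Fin r) : inner ℝ (modelD r i) (modelD r j) =
    -Real.cos (Real.pi / (coxeterMatrixD r i j : ℝ)) := by
  have hi := i.2
  have hj := j.2
  have hM : coxeterMatrixD r i j = if (i : ℕ) = j then 1
    else if ((i : ℕ) + 1 = j ∧ (j : ℕ) + 1 < r ∨ (i : ℕ) + 3 = r ∧ (j : ℕ) + 1 = r) ∨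
      ((j : ℕ) + 1 = i ∧ (i : ℕ) + 1 < r ∨ (j : ℕ) + 3 = r ∧ (i : ℕ) + 1 = r) then 3 else 2 := by
    simp only [← Fin.ext_iff]
    simp only [coxeterMatrixD, Matrix.of_apply, adjD]
    congr
  have h2 := inv_sqrt_two_mul_self
  rw [hM, modelD, modelD]
  generalize (i : ℕ) = a at *
  generalize (j : ℕ) = b at *
  set c := (√2)⁻¹ with hc
  split_ifs <;>
    simp only [inner_sub_left, inner_sub_right, inner_add_left, inner_add_right,
      real_inner_smul_left, real_inner_smul_right,
      inner_stdVec, neg_cos_pi_div_one, neg_cos_pi_div_two, neg_cos_pi_div_three] <;> grind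

lemma span_modelD (hr : 2 ≤ r) : Submodule.span ℝ (Set.range (modelD r)) = ⊤ := by
  have hsub : ∀ k, k + 1 < r →
      stdVec r k - stdVec r (k + 1) ∈ Submodule.span ℝ (Set.range (modelD r)) := by
    intro k hk
    have hroot : modelD r ⟨k, by omega⟩ ∈ Submodule.span ℝ (Set.range (modelD r)) :=
      Submodule.subset_span ⟨_, rfl⟩
    rwa [modelD, if_pos hk, Submodule.smul_mem_iff _ inv_sqrt_two_ne_zero] at hroot
  have hlast : stdVec r (r - 1) ∈ Submodule.span ℝ (Set.range (modelD r)) := by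
    have hroot : modelD r ⟨r - 1, by omega⟩ ∈ Submodule.span ℝ (Set.range (modelD r)) :=
      Submodule.subset_span ⟨_, rfl⟩
    rw [modelD, if_neg (by simp only; omega),
      Submodule.smul_mem_iff _ inv_sqrt_two_ne_zero] at hroot
    simp only at hroot
    have h := hsub (r - 1 - 1) (by omega)
    rw [show r - 1 - 1 + 1 = r - 1 by omega] at h
    have h2 := Submodule.sub_mem _ hroot h
    rw [show stdVec r (r - 1 - 1) + stdVec r (r - 1) - (stdVec r (r - 1 - 1) - stdVec r (r - 1)) =
      (2 : ℝ) • stdVec r (r - 1) by rw [two_smul]; abel] at h2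
    exact (Submodule.smul_mem_iff _ two_ne_zero).1 h2
  refine span_eq_top_of_stdVec fun k hk => ?_
  obtain ⟨m, rfl⟩ : ∃ m, k = r - 1 - m := ⟨r - 1 - k, by omega⟩
  induction m with
  | zero => exact hlast
  | succ m ih =>
    by_cases hm : r - 1 - m = 0
    · rw [show r - 1 - (m + 1) = r - 1 - m by omega] at hk ⊢
      exact ih hk
    have h := hsub (r - 1 - (m + 1)) (by omega)
    rw [show r - 1 - (m + 1) + 1 = r - 1 - m by omega] at h
    have := Submodule.add_mem _ h (ih (by omega))
    rwa [sub_add_cancel] at this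

theorem fibresMeetStratum_of_hasCoxeterType_D (hr : 3 ≤ r)
    (h : HasCoxeterType G (coxeterMatrixD r)) {k : ℕ}
    (hk : finrank ℝ (fixedSubspace G) + (k + 1) < n) :
    FibresMeetStratum G (finrank ℝ (fixedSubspace G) + (k + 1)) := by
  obtain ⟨α, hgram, hG⟩ := h
  have hα := ne_zero_of_gram hgram
  obtain ⟨T, hT, hε, hfix⟩ := exists_orthonormal_of_model hG hα (modelD r) (span_modelD (by omega))
    fun i j => by rw [hgram, gram_modelD (by omega)]
  set ε := fun i : Fin r => T (EuclideanSpace.single i 1) with hεdef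
  have hroot := mem_rootSet_of_closure hG hα
  have hadj : ∀ i j : Fin r, (i : ℕ) + 1 = j → α i = (√2)⁻¹ • (ε i - ε j) := by
    intro i j hij
    rw [← hT, modelD, if_pos (by rw [hij]; exact j.2), map_smul, map_sub, stdVec_eq i.2,
      stdVec_eq (by rw [hij]; exact j.2)]
    simp only [hij]
    rfl
  have hlast : ∀ i j : Fin r, ¬ (j : ℕ) + 1 < r → (i : ℕ) + 1 = j →
      α j = (√2)⁻¹ • (ε i + ε j) := by
    intro i j hj hij
    have hi' : (j : ℕ) - 1 = i := by omega
    rw [← hT, modelD, if_neg hj, map_smul, map_add, stdVec_eq j.2, hi', stdVec_eq i.2]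
  have hscale : ∀ v : Space n, (√2)⁻¹ • v ∈ rootSet G → v ∈ rootSet G := by
    intro v hv
    have := smul_mem_rootSet (inv_ne_zero inv_sqrt_two_ne_zero) hv
    rwa [smul_smul, inv_mul_cancel₀ inv_sqrt_two_ne_zero, one_smul] at this
  have hsub : ∀ i j, i ≠ j → ε i - ε j ∈ rootSet G :=
    sub_mem_rootSet_of_adjacent hε.hasUnitDifferences fun i j hij =>
      hscale _ (hadj i j hij ▸ hroot i)
  let a : Fin r := ⟨r - 2, by omega⟩
  let b : Fin r := ⟨r - 1, by omega⟩
  have hab1 : (a : ℕ) + 1 = b := by simp only [a, b]; omega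
  have hb1 : ¬ (b : ℕ) + 1 < r := by simp only [b]; omega
  have hab : a ≠ b := by rw [Ne, Fin.ext_iff]; omega
  have hadd : ∀ i j, i ≠ j → ε i + ε j ∈ rootSet G :=
    add_mem_rootSet_of_one hε hsub hab (hscale _ (hlast a b hb1 hab1 ▸ hroot b))
  have hgen : ∀ i, (∃ l m, l ≠ m ∧ α i = (√2)⁻¹ • (ε l - ε m)) ∨
      α i = (√2)⁻¹ • (ε a + ε b) := by
    intro i
    by_cases hi : (i : ℕ) + 1 < r
    · exact Or.inl ⟨i, ⟨i + 1, hi⟩, by rw [Ne, Fin.ext_iff]; simp, hadj i _ rfl⟩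
    · have hib : i = b := Fin.ext (by have := i.2; simp only [b]; omega)
      right
      rw [hib]
      exact hlast a b hb1 hab1
  refine fibresMeetStratum_typeD hr hε hfix hsub hadd (fun m hm => ?_) ?_ hk
  · refine mem_invariantRing_of_generators hG fun i x => ?_
    rcases hgen i with ⟨l, m', hlm, hi⟩ | hi <;>
      rw [hi, hyperplaneReflection_smul _ inv_sqrt_two_ne_zero]
    · exact evalAt_powerSum_reflection_sub hε.hasUnitDifferences hlm m x
    · exact evalAt_powerSum_reflection_add hε hab hm x
  · refine mem_invariantRing_of_generators hG fun i x => ?_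
    rcases hgen i with ⟨l, m', hlm, hi⟩ | hi <;>
      rw [hi, hyperplaneReflection_smul _ inv_sqrt_two_ne_zero]
    · exact evalAt_prodPoly_reflection_sub hε hlm x
    · exact evalAt_prodPoly_reflection_add hε hab x

end ModelD

/-! ### Type `A` -/

section TypeA

variable {n r : ℕ} {G : Subgroup (OrthGroup n)} {u : Fin (r + 1) → Space n}

/-- The finite set of the values `⟪u i, q⟫`. -/
noncomputable def valueSet (u : Fin (r + 1) → Space n) (q : Space n) : Finset ℝ :=
  Finset.univ.image fun i => (inner ℝ (u i) q : ℝ)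

lemma mem_valueSet (q : Space n) (i : Fin (r + 1)) : (inner ℝ (u i) q : ℝ) ∈ valueSet u q :=
  Finset.mem_image_of_mem _ (Finset.mem_univ i)

/-- Independence of the gradients of the power sums. -/
lemma linearIndependent_powerSums (hu : HasUnitDifferences u)
    (hfix : fixedSubspace G = (Submodule.span ℝ (Set.range u))ᗮ) {m : ℕ} {q : Space n}
    (hm : m + 1 ≤ (valueSet u q).card) :
    LinearIndependent ℝ (Sum.elim (fixedBasis G)
      fun j : Fin m => polyGrad (powerSum u (j + 2)) q) := by
  classical
  rw [Fintype.linearIndependent_iff]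
  intro g hg
  rw [Fintype.sum_sum_type] at hg
  simp only [Sum.elim_inl, Sum.elim_inr, polyGrad_powerSum, Finset.smul_sum, smul_smul] at hg
  rw [Finset.sum_comm] at hg
  simp only [← Finset.sum_smul] at hg
  set v : Fin (r + 1) → ℝ := fun i => ∑ j : Fin m, g (Sum.inr j) *
    (((j + 2 : ℕ) : ℝ) * (inner ℝ (u i) q : ℝ) ^ ((j : ℕ) + 2 - 1)) with hv
  have h1 : ∀ l, g (Sum.inl l) = 0 := by
    intro l
    have h := congrArg (fun x => (inner ℝ (fixedBasis G l) x : ℝ)) hg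
    simp only [inner_add_right, inner_sum, real_inner_smul_right, inner_zero_right,
      orthonormal_iff_ite.1 orthonormal_fixedBasis, real_inner_comm (u _) (fixedBasis G l),
      inner_fixedBasis_eq_zero hfix] at h
    simpa [real_inner_comm, inner_fixedBasis_eq_zero hfix] using h
  -- The only relation among the `u i` that differences can see is proportional to their sum, so all
  -- coefficients agree. Their common value becomes the constant term of the polynomial below.
  have h2 : ∀ a, v a = v 0 := by
    intro a
    have h := congrArg (fun x => (inner ℝ x (u a - u 0) : ℝ)) hg
    simp only [inner_add_left, sum_inner, real_inner_smul_left, inner_zero_left, h1, zero_mul,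
      Finset.sum_const_zero, zero_add, hu _ _ _] at h
    simp only [mul_sub, mul_ite, mul_one, mul_zero, Finset.sum_sub_distrib, Finset.sum_ite_eq',
      Finset.mem_univ, if_true] at h
    exact sub_eq_zero.1 h
  let c : Fin (m + 1) → ℝ := Fin.cons (-v 0) fun j : Fin m => g (Sum.inr j) * ((j + 2 : ℕ) : ℝ)
  have h3 := eq_zero_of_sum_pow_eq_zero c _ hm (by
    intro s hs
    obtain ⟨i, -, rfl⟩ := Finset.mem_image.1 hs
    rw [Fin.sum_univ_succ]
    simp only [c, Fin.cons_zero, Fin.cons_succ, Fin.val_zero, pow_zero, mul_one, Fin.val_succ]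
    rw [neg_add_eq_zero, ← h2 i, hv]
    refine Finset.sum_congr rfl fun j _ => ?_
    rw [show (j : ℕ) + 2 - 1 = j + 1 by omega, mul_assoc])
  rintro (l | j)
  · exact h1 l
  · have := h3 j.succ
    simp only [c, Fin.cons_succ] at this
    rcases mul_eq_zero.1 this with h | h
    · exact h
    · exact absurd h (by positivity)

lemma exists_card_valueSet_eq (hu : HasUnitDifferences u) :
    ∃ q : Space n, (valueSet u q).card = r + 1 := by
  classical
  refine ⟨∑ i : Fin (r + 1), (i : ℝ) • u i, ?_⟩
  rw [valueSet, Finset.card_image_of_injective, Finset.card_univ, Fintype.card_fin]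
  intro i j hij
  simp only at hij
  have h : (inner ℝ (∑ l : Fin (r + 1), (l : ℝ) • u l) (u i - u j) : ℝ) = i - j := by
    simp only [sum_inner, real_inner_smul_left, hu _ _ _]
    simp [mul_sub, Finset.sum_sub_distrib]
  rw [inner_sub_right, real_inner_comm, real_inner_comm (u j), hij, sub_self] at h
  exact Fin.ext (by exact_mod_cast (sub_eq_zero.1 h.symm))

/-- Equal coordinates are tied together by the roots `u i - u j`. Since the coordinates sum to zero,
only their differences from the coordinate of index `0` matter, which saves one value. -/
lemma mem_stratum_of_card_valueSet_le (hsum : ∑ i, u i = 0)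
    (hfix : fixedSubspace G = (Submodule.span ℝ (Set.range u))ᗮ)
    (hsub : ∀ i j, i ≠ j → u i - u j ∈ rootSet G)
    {k : ℕ} (hk : finrank ℝ (fixedSubspace G) + k ≤ n) {q : Space n}
    (h : (valueSet u q).card ≤ k + 1) : q ∈ stratum G (finrank ℝ (fixedSubspace G) + k) := by
  classical
  let S := (valueSet u q).erase (inner ℝ (u 0) q : ℝ)
  have hS : S.card ≤ k := by
    rw [Finset.card_erase_of_mem (mem_valueSet q 0)]
    omega
  let rep : S → Space n := fun s =>
    if h : ∃ i, (inner ℝ (u i) q : ℝ) = s then u h.choose - u 0 else 0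
  refine mem_stratum_of_separating hk
    (κ := Fin (finrank ℝ (fixedSubspace G)) ⊕ S) (by simpa using hS)
    (Sum.elim (fixedBasis G) rep) fun x hx hw => ?_
  have heq : ∀ i j, (inner ℝ (u i) q : ℝ) = inner ℝ (u j) q →
      (inner ℝ (u i) x : ℝ) = inner ℝ (u j) x := by
    intro i j hij
    by_cases hne : i = j
    · rw [hne]
    have := hx _ (hsub i j hne) (by rw [inner_sub_left, hij, sub_self])
    rw [inner_sub_left] at this
    linarith
  have hconst : ∀ i, (inner ℝ (u i) x : ℝ) = inner ℝ (u 0) x := by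
    intro i
    by_cases hi : (inner ℝ (u i) q : ℝ) = inner ℝ (u 0) q
    · exact heq i 0 hi
    have hmem : (inner ℝ (u i) q : ℝ) ∈ S := Finset.mem_erase.2 ⟨hi, mem_valueSet q i⟩
    have hr := hw (Sum.inr ⟨_, hmem⟩)
    have hex : ∃ j, (inner ℝ (u j) q : ℝ) = (inner ℝ (u i) q : ℝ) := ⟨i, rfl⟩
    simp only [Sum.elim_inr, rep, dif_pos hex, inner_sub_left] at hr
    rw [← heq _ i hex.choose_spec]
    linarith
  have h0 : (inner ℝ (u 0) x : ℝ) = 0 := by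
    have h1 : (∑ i, (inner ℝ (u i) x : ℝ)) = 0 := by rw [← sum_inner, hsum, inner_zero_left]
    simp only [hconst] at h1
    rw [Finset.sum_const, Finset.card_univ, Fintype.card_fin, nsmul_eq_mul] at h1
    exact (mul_eq_zero.1 h1).resolve_left (by positivity)
  exact eq_zero_of_coordinates hfix x (fun l => hw (Sum.inl l)) fun i => (hconst i).trans h0

/-- The power sum of degree `j + 2` is matched with the `j + 1` roots whose larger index is `j + 1`.
-/
lemma isCompleteFamily_typeA (hu : HasUnitDifferences u)
    (hfix : fixedSubspace G = (Submodule.span ℝ (Set.range u))ᗮ)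
    (hn : finrank ℝ (fixedSubspace G) + r = n)
    (hsub : ∀ i j, i ≠ j → u i - u j ∈ rootSet G)
    (hinv : ∀ m, powerSum u m ∈ invariantRing G) :
    IsCompleteFamily G
      (Sum.elim (fun l => linForm (fixedBasis G l)) fun j : Fin r => powerSum u (j + 2))
      (Sum.elim (fun _ => 1) fun j => j + 2) where
  card_eq := by simpa using hn
  pos := by rintro (l | j) <;> simp
  mem_invariantRing := by
    rintro (l | j)
    · exact linForm_mem_invariantRing (fixedBasis_mem l)
    · exact hinv _
  homogeneous := by
    rintro (l | j)
    · exact isHomogeneous_linForm _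
    · exact isHomogeneous_powerSum _ _
  linearIndependent := by
    obtain ⟨a, ha⟩ := exists_card_valueSet_eq hu
    refine ⟨a, ?_⟩
    convert linearIndependent_powerSums hu hfix ha.ge using 1
    funext o
    rcases o with l | j <;> simp [polyGrad_linForm]
  sum_le := by
    refine ⟨Σ j : Fin r, Fin (j + 1), inferInstance,
      fun p => u p.1.succ - u ⟨p.2, by have := p.1.2; have := p.2.2; omega⟩, fun p => ?_,
      fun p p' hp c h => ?_, ?_⟩
    · refine hsub _ _ ?_
      have := p.2.2
      rw [Ne, Fin.ext_iff, Fin.val_succ]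
      simp only
      omega
    · have hm : ∀ m : Fin (r + 1), _ := fun m => congrArg (fun x => (inner ℝ (u m) x : ℝ)) h
      simp only [real_inner_smul_right, hu _ _ _, Fin.ext_iff, Fin.val_succ] at hm
      obtain ⟨⟨a, ha⟩, ⟨b, hb⟩⟩ := p
      obtain ⟨⟨a', ha'⟩, ⟨b', hb'⟩⟩ := p'
      simp only at hb hb' hm
      have e1 := hm ⟨a + 1, by omega⟩
      have e2 := hm ⟨b, by omega⟩
      have e3 := hm ⟨a' + 1, by omega⟩
      have e4 := hm ⟨b', by omega⟩
      have hne : ¬ (a = a' ∧ b = b') := by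
        rintro ⟨rfl, rfl⟩
        exact hp rfl
      clear hm h hp
      simp only at e1 e2 e3 e4
      grind
    · rw [Fintype.sum_sum_type, Fintype.card_sigma]
      simp

/-- At a minimum of the next power sum the coordinates take at most `k + 1` distinct values, as more
would make the gradients of the power sums of degrees 2, …, k + 2 independent. -/
theorem fibresMeetStratum_typeA (hu : HasUnitDifferences u) (hsum : ∑ i, u i = 0)
    (hfix : fixedSubspace G = (Submodule.span ℝ (Set.range u))ᗮ)
    (hn : finrank ℝ (fixedSubspace G) + r = n)
    (hsub : ∀ i j, i ≠ j → u i - u j ∈ rootSet G)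
    (hinv : ∀ m, powerSum u m ∈ invariantRing G) {k : ℕ} (hk1 : 1 ≤ k)
    (hk : finrank ℝ (fixedSubspace G) + k ≤ n) :
    FibresMeetStratum G (finrank ℝ (fixedSubspace G) + k) := by
  intro π hπ p
  have hkr : k ≤ r := by omega
  let f : Fin (finrank ℝ (fixedSubspace G)) ⊕ Fin k → MvPolynomial (Fin n) ℝ :=
    Sum.elim (fun l => linForm (fixedBasis G l)) fun j => powerSum u (j + 2)
  have hcompact : IsCompact {x : Space n | ∀ i, evalAt x (f i) = evalAt p (f i)} := by
    refine isCompact_of_coordinates u (eq_zero_of_coordinates hfix) (isClosed_fibre f p) p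
      (fun x hx l => ?_) fun x hx => hx (Sum.inr ⟨0, hk1⟩)
    have := hx (Sum.inl l)
    simpa only [f, Sum.elim_inl, evalAt_linForm] using this
  obtain ⟨q, hq, -, hext⟩ := exists_min_on_fibre f p hcompact (powerSum u (k + 2))
  refine ⟨q, mem_stratum_of_card_valueSet_le hsum hfix hsub hk ?_, fun i hi => ?_⟩
  · by_contra! hlt
    have h := card_le_of_isLocalExtrOn f _ hext _
      (linearIndependent_powerSums hu hfix (m := k + 1) hlt) (by
        rintro (l | j)
        · refine Submodule.subset_span (Or.inr ⟨Sum.inl l, ?_⟩)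
          simp [f, polyGrad_linForm]
        · rcases Nat.lt_succ_iff_lt_or_eq.1 j.2 with hj | hj
          · exact Submodule.subset_span (Or.inr ⟨Sum.inr ⟨j, hj⟩, rfl⟩)
          · refine Submodule.subset_span (Or.inl ?_)
            simp [hj])
    simp at h
  · refine hπ.evalAt_eq_of_family (isCompleteFamily_typeA hu hfix hn hsub hinv)
      (m := k + 1) (κ' := Fin (finrank ℝ (fixedSubspace G)) ⊕ Fin k)
      (Sum.map id (Fin.castLE hkr)) ?_ ?_ (by simp) ?_ i hi
    · exact Function.Injective.sumMap Function.injective_id (Fin.castLE_injective hkr)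
    · rintro (l | j)
      · simp
      · have := j.2
        simp only [Sum.map_inr, Sum.elim_inr, Fin.val_castLE]
        omega
    · rintro (l | j) hj
      · exact hq (Sum.inl l)
      · simp only [Sum.elim_inr] at hj
        exact hq (Sum.inr ⟨j, by omega⟩)

/-- Simple roots of type `A`. -/
noncomputable def modelA (r : ℕ) (i : Fin r) : EuclideanSpace ℝ (Fin (r + 1)) :=
  (√2)⁻¹ • (stdVec (r + 1) i - stdVec (r + 1) (i + 1))

lemma gram_modelA (r : ℕ) (i j : Fin r) : inner ℝ (modelA r i) (modelA r j) =
    -Real.cos (Real.pi / (CoxeterMatrix.A r i j : ℝ)) := by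
  have hi := i.2
  have hj := j.2
  have hM : CoxeterMatrix.A r i j = if (i : ℕ) = j then 1
    else if (j : ℕ) + 1 = i ∨ (i : ℕ) + 1 = j then 3 else 2 := by
      simp [CoxeterMatrix.A, Fin.ext_iff]
  have h2 := inv_sqrt_two_mul_self
  rw [hM, modelA, modelA]
  generalize (i : ℕ) = a at *
  generalize (j : ℕ) = b at *
  set c := (√2)⁻¹ with hc
  split_ifs <;>
    simp only [inner_sub_left, inner_sub_right, real_inner_smul_left, real_inner_smul_right,
      inner_stdVec, neg_cos_pi_div_one, neg_cos_pi_div_two, neg_cos_pi_div_three] <;> grind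

theorem fibresMeetStratum_of_hasCoxeterType_A (h : HasCoxeterType G (CoxeterMatrix.A r)) {k : ℕ}
    (hk1 : 1 ≤ k) (hk : finrank ℝ (fixedSubspace G) + k ≤ n) :
    FibresMeetStratum G (finrank ℝ (fixedSubspace G) + k) := by
  classical
  obtain ⟨α, hgram, hG⟩ := h
  have hα := ne_zero_of_gram hgram
  obtain ⟨T, hT, hTin, hTspan⟩ := exists_partialIsometry (modelA r) α
    fun i j => by rw [hgram, gram_modelA]
  set u := fun i : Fin (r + 1) => T (EuclideanSpace.single i 1) with hudef
  have hadj : ∀ i j : Fin (r + 1), ∀ h : (i : ℕ) + 1 = j,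
      α ⟨i, by have := j.2; omega⟩ = (√2)⁻¹ • (u i - u j) := by
    intro i j hij
    have hj := j.2
    rw [← hT, modelA, map_smul, map_sub, stdVec_eq (by simp only; omega),
      stdVec_eq (by simp only; omega)]
    simp only [hij]
    rfl
  have hdiff : ∀ i j : Fin (r + 1), EuclideanSpace.single i (1 : ℝ) - EuclideanSpace.single j 1 ∈
      Submodule.span ℝ (Set.range (modelA r)) := by
    have key : ∀ m : ℕ, ∀ hm : m < r + 1, EuclideanSpace.single (0 : Fin (r + 1)) (1 : ℝ) -
        EuclideanSpace.single ⟨m, hm⟩ 1 ∈ Submodule.span ℝ (Set.range (modelA r)) := by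
      intro m
      induction m with
      | zero => intro hm; simp
      | succ m ih =>
        intro hm
        have hroot : modelA r ⟨m, by omega⟩ ∈ Submodule.span ℝ (Set.range (modelA r)) :=
          Submodule.subset_span ⟨_, rfl⟩
        rw [modelA, Submodule.smul_mem_iff _ inv_sqrt_two_ne_zero, stdVec_eq (by simp only; omega),
          stdVec_eq (by simp only; omega)] at hroot
        have := Submodule.add_mem _ (ih (by omega)) hroot
        rwa [sub_add_sub_cancel] at this
    intro i j
    have := Submodule.sub_mem _ (key j j.2) (key i i.2)
    rwa [sub_sub_sub_cancel_left] at this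
  -- `T` preserves an inner product once one argument lies in the span of the model roots, as
  -- differences of basis vectors do.
  have hu : HasUnitDifferences u := by
    intro m i j
    simp only [hudef]
    rw [← map_sub, hTin _ _ (hdiff i j), inner_sub_right, EuclideanSpace.inner_single_left,
      EuclideanSpace.inner_single_left]
    simp [PiLp.single_apply]
  have hspan : Submodule.span ℝ (Set.range α) = Submodule.span ℝ (Set.range u) := by
    refine le_antisymm (Submodule.span_le.2 ?_) (Submodule.span_le.2 ?_)
    · rintro _ ⟨i, rfl⟩
      have := hadj i.castSucc i.succ (by simp)
      simp only [Fin.val_castSucc, Fin.eta] at this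
      rw [this]
      exact Submodule.smul_mem _ _ (Submodule.sub_mem _ (Submodule.subset_span ⟨_, rfl⟩)
        (Submodule.subset_span ⟨_, rfl⟩))
    · rintro _ ⟨i, rfl⟩
      exact hTspan _
  have hfix := fixedSubspace_eq hG hα
  -- The sum is orthogonal to all simple roots and lies in their span.
  have hsum : ∑ i, u i = 0 := by
    rw [← inner_self_eq_zero (𝕜 := ℝ)]
    have h1 : ∑ i, u i ∈ (Submodule.span ℝ (Set.range α))ᗮ := by
      rw [mem_orthogonal_span_iff]
      rintro _ ⟨i, rfl⟩
      have := hadj i.castSucc i.succ (by simp)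
      simp only [Fin.val_castSucc, Fin.eta] at this
      rw [this, real_inner_smul_left, real_inner_comm, sum_inner]
      simp [hu _ _ _]
    refine (Submodule.mem_orthogonal _ _).1 h1 _ (Submodule.sum_mem _ fun i _ => hTspan _)
  rw [hspan] at hfix
  have hroot := mem_rootSet_of_closure hG hα
  have hsub : ∀ i j, i ≠ j → u i - u j ∈ rootSet G := by
    refine sub_mem_rootSet_of_adjacent hu fun i j hij => ?_
    have hj := j.2
    have := smul_mem_rootSet (inv_ne_zero inv_sqrt_two_ne_zero) (hroot ⟨i, by omega⟩)
    rwa [hadj i j hij, smul_smul, inv_mul_cancel₀ inv_sqrt_two_ne_zero, one_smul] at this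
  -- The independent gradients at a point with distinct coordinates bound `n` from below, and the
  -- `r` simple roots bound it from above.
  have hn : finrank ℝ (fixedSubspace G) + r = n := by
    obtain ⟨a, ha⟩ := exists_card_valueSet_eq hu
    have h1 := (linearIndependent_powerSums hu hfix ha.ge).fintype_card_le_finrank
    have h2 := Submodule.finrank_add_finrank_orthogonal (Submodule.span ℝ (Set.range α))
    have h3 := finrank_range_le_card (R := ℝ) α
    rw [← fixedSubspace_eq hG hα, finrank_euclideanSpace_fin] at h2
    rw [Set.finrank, Fintype.card_fin] at h3
    simp at h1
    omega
  refine fibresMeetStratum_typeA hu hsum hfix hn hsub (fun m => ?_) hk1 hk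
  refine mem_invariantRing_of_generators hG fun i x => ?_
  have := hadj i.castSucc i.succ (by simp)
  simp only [Fin.val_castSucc, Fin.eta] at this
  rw [this, hyperplaneReflection_smul _ inv_sqrt_two_ne_zero]
  exact evalAt_powerSum_reflection_sub hu (by rw [Ne, Fin.ext_iff]; simp) m x

end TypeA

/-! ### Type `F₄` -/

section TypeF

variable {n : ℕ} {G : Subgroup (OrthGroup n)} {ε : Fin 4 → Space n}

lemma eq_of_evalAt_eq {f g : MvPolynomial (Fin n) ℝ} (h : ∀ x : Space n, evalAt x f = evalAt x g) :
    f = g :=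
  MvPolynomial.funext fun x => h (WithLp.toLp 2 x)

/-- The coordinates of the long positive roots of type `F₄`. -/
def longCoord : Fin 12 → Fin 4 → ℝ :=
  ![![1, 1, 0, 0], ![1, -1, 0, 0], ![1, 0, 1, 0], ![1, 0, -1, 0], ![1, 0, 0, 1], ![1, 0, 0, -1],
    ![0, 1, 1, 0], ![0, 1, -1, 0], ![0, 1, 0, 1], ![0, 1, 0, -1], ![0, 0, 1, 1], ![0, 0, 1, -1]]

/-- The long positive roots of type `F₄`. -/
noncomputable def longRoot (ε : Fin 4 → Space n) (e : Fin 12) : Space n :=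
  ∑ i, longCoord e i • ε i

lemma inner_longRoot (e : Fin 12) (x : Space n) :
    inner ℝ (longRoot ε e) x = ∑ i, longCoord e i * (inner ℝ (ε i) x : ℝ) := by
  simp only [longRoot, sum_inner, real_inner_smul_left]

/-- The sum of the powers of the values of the long roots, in coordinates. -/
def longPowerSum (m : ℕ) (a b c d : ℝ) : ℝ :=
  (a + b) ^ m + (a - b) ^ m + (a + c) ^ m + (a - c) ^ m + (a + d) ^ m + (a - d) ^ m +
    (b + c) ^ m + (b - c) ^ m + (b + d) ^ m + (b - d) ^ m + (c + d) ^ m + (c - d) ^ m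

lemma evalAt_longPowerSum (m : ℕ) (x : Space n) : evalAt x (powerSum (longRoot ε) m) =
    longPowerSum m (inner ℝ (ε 0) x) (inner ℝ (ε 1) x) (inner ℝ (ε 2) x) (inner ℝ (ε 3) x) := by
  simp only [evalAt_powerSum, inner_longRoot, Fin.sum_univ_four]
  simp only [Fin.sum_univ_succ, longCoord, longPowerSum]
  simp [Fin.succ, sub_eq_add_neg]
  ring

lemma longPowerSum_two (a b c d : ℝ) :
    longPowerSum 2 a b c d = 6 * (a ^ 2 + b ^ 2 + c ^ 2 + d ^ 2) := by
  rw [longPowerSum]; ring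

lemma longPowerSum_six (a b c d : ℝ) : longPowerSum 6 a b c d =
    30 * ((a ^ 2 + b ^ 2 + c ^ 2 + d ^ 2) * (a ^ 4 + b ^ 4 + c ^ 4 + d ^ 4)) -
      24 * (a ^ 6 + b ^ 6 + c ^ 6 + d ^ 6) := by
  rw [longPowerSum]; ring

lemma longPowerSum_swap_one_two (m : ℕ) (hm : Even m) (a b c d : ℝ) :
    longPowerSum m a c b d = longPowerSum m a b c d := by
  rw [longPowerSum, longPowerSum, ← hm.neg_pow (c - b)]
  simp only [add_comm c b, neg_sub]
  ring

lemma longPowerSum_swap_two_three (m : ℕ) (hm : Even m) (a b c d : ℝ) :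
    longPowerSum m a b d c = longPowerSum m a b c d := by
  rw [longPowerSum, longPowerSum, ← hm.neg_pow (d - c)]
  simp only [add_comm d c, neg_sub]
  ring

lemma longPowerSum_neg_three (m : ℕ) (a b c d : ℝ) :
    longPowerSum m a b c (-d) = longPowerSum m a b c d := by
  rw [longPowerSum, longPowerSum]
  simp only [sub_neg_eq_add, ← sub_eq_add_neg]
  ring

/-- The half sums are the coordinates after the reflection in (1, -1, -1, -1)/2, which permutes the
twelve long forms without any signs. -/
lemma longPowerSum_half (m : ℕ) (a b c d : ℝ) :
    longPowerSum m ((a + b + c + d) / 2) ((a + b - c - d) / 2) ((a - b + c - d) / 2)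
      ((a - b - c + d) / 2) = longPowerSum m a b c d := by
  rw [longPowerSum, longPowerSum]
  rw [show (a + b + c + d) / 2 + (a + b - c - d) / 2 = a + b by ring,
    show (a + b + c + d) / 2 - (a + b - c - d) / 2 = c + d by ring,
    show (a + b + c + d) / 2 + (a - b + c - d) / 2 = a + c by ring,
    show (a + b + c + d) / 2 - (a - b + c - d) / 2 = b + d by ring,
    show (a + b + c + d) / 2 + (a - b - c + d) / 2 = a + d by ring,
    show (a + b + c + d) / 2 - (a - b - c + d) / 2 = b + c by ring,
    show (a + b - c - d) / 2 + (a - b + c - d) / 2 = a - d by ring,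
    show (a + b - c - d) / 2 - (a - b + c - d) / 2 = b - c by ring,
    show (a + b - c - d) / 2 + (a - b - c + d) / 2 = a - c by ring,
    show (a + b - c - d) / 2 - (a - b - c + d) / 2 = b - d by ring,
    show (a - b + c - d) / 2 + (a - b - c + d) / 2 = a - b by ring,
    show (a - b + c - d) / 2 - (a - b - c + d) / 2 = c - d by ring]
  ring

lemma powerSum_longRoot_two : powerSum (longRoot ε) 2 = (6 : ℝ) • powerSum ε 2 := by
  refine eq_of_evalAt_eq fun x => ?_
  rw [evalAt_longPowerSum, longPowerSum_two, evalAt_smul, evalAt_powerSum, Fin.sum_univ_four]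

lemma powerSum_longRoot_six : powerSum (longRoot ε) 6 =
    (30 : ℝ) • (powerSum ε 2 * powerSum ε 4) + (-24 : ℝ) • powerSum ε 6 := by
  refine eq_of_evalAt_eq fun x => ?_
  rw [evalAt_longPowerSum, longPowerSum_six, evalAt_add, evalAt_smul, evalAt_smul, evalAt_mul]
  simp only [evalAt_powerSum, Fin.sum_univ_four]
  ring

lemma polyGrad_powerSum_longRoot (m : ℕ) (q : Space n) : polyGrad (powerSum (longRoot ε) m) q =
    ∑ i, (∑ e, m * (inner ℝ (longRoot ε e) q : ℝ) ^ (m - 1) * longCoord e i) • ε i := by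
  rw [polyGrad_powerSum]
  simp only [Finset.sum_smul]
  rw [Finset.sum_comm]
  refine Finset.sum_congr rfl fun e _ => ?_
  rw [longRoot, Finset.smul_sum]
  simp only [smul_smul]

/-- The degrees of the nonlinear basic invariants of type `F₄`. -/
def degreeF : Fin 4 → ℕ := ![2, 6, 8, 12]

lemma exists_linearIndependent_longRoot (hε : Orthonormal ℝ ε)
    (hfix : fixedSubspace G = (Submodule.span ℝ (Set.range ε))ᗮ) :
    ∃ a : Space n, LinearIndependent ℝ (Sum.elim (fixedBasis G)
      fun j : Fin 4 => polyGrad (powerSum (longRoot ε) (degreeF j)) a) := by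
  -- This point lies on no reflecting hyperplane of `F₄`, unlike (1, 2, 3, 4), where 1 - 2 - 3 + 4 =
  -- 0.
  obtain ⟨a, ha⟩ := exists_point_with_coordinates hε ![1, 2, 3, 5]
  refine ⟨a, ?_⟩
  rw [Fintype.linearIndependent_iff]
  intro g hg
  simp only [polyGrad_powerSum_longRoot] at hg
  obtain ⟨h1, h2⟩ := coordinates_of_relation hε hfix _ g hg
  simp only [inner_longRoot, ha] at h2
  have e0 := h2 0
  have e1 := h2 1
  have e2 := h2 2
  have e3 := h2 3
  clear h2 hg
  simp only [Fin.sum_univ_four] at e0 e1 e2 e3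
  simp only [Fin.sum_univ_succ, longCoord, degreeF] at e0 e1 e2 e3
  simp [Fin.succ] at e0 e1 e2 e3
  norm_num at e0 e1 e2 e3
  rintro (l | j)
  · exact h1 l
  · fin_cases j <;> simp only [Fin.zero_eta, Fin.mk_one, Fin.reduceFinMk] <;> linarith

/-- Half of a linear combination; the short roots of type `F₄` outside type `B₄` arise from
coefficients `± 1`. -/
noncomputable def halfRoot (ε : Fin 4 → Space n) (s : Fin 4 → ℝ) : Space n :=
  (1 / 2 : ℝ) • ∑ i, s i • ε i

lemma inner_halfRoot (s : Fin 4 → ℝ) (x : Space n) :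
    inner ℝ (halfRoot ε s) x = 1 / 2 * ∑ i, s i * (inner ℝ (ε i) x : ℝ) := by
  simp only [halfRoot, real_inner_smul_left, sum_inner]

lemma inner_basis_halfRoot (hε : Orthonormal ℝ ε) (s : Fin 4 → ℝ) (i : Fin 4) :
    inner ℝ (ε i) (halfRoot ε s) = s i / 2 := by
  rw [real_inner_comm, inner_halfRoot]
  simp [orthonormal_iff_ite.1 hε]
  ring

lemma inner_halfRoot_halfRoot (hε : Orthonormal ℝ ε) (s s' : Fin 4 → ℝ) :
    inner ℝ (halfRoot ε s) (halfRoot ε s') = 1 / 4 * ∑ i, s i * s' i := by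
  rw [inner_halfRoot, Finset.mul_sum, Finset.mul_sum]
  refine Finset.sum_congr rfl fun i _ => ?_
  rw [inner_basis_halfRoot hε]
  ring

lemma halfRoot_update_mem_rootSet (hε : Orthonormal ℝ ε) {s : Fin 4 → ℝ}
    (hs : halfRoot ε s ∈ rootSet G) {i : Fin 4} (hi : ε i ∈ rootSet G) :
    halfRoot ε (Function.update s i (-s i)) ∈ rootSet G := by
  refine mem_rootSet_of_reflect hi hs (s i) ?_ ?_
  · rw [inner_basis_halfRoot hε, orthonormal_iff_ite.1 hε, if_pos rfl]
    ring
  · have h : ∀ j, Function.update s i (-s i) j • ε j =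
        s j • ε j - if j = i then (2 * s i) • ε i else 0 := by
      intro j
      by_cases hj : j = i
      · subst hj
        rw [Function.update_self, if_pos rfl, ← sub_smul]
        congr 1
        ring
      · rw [Function.update_of_ne hj, if_neg hj, sub_zero]
    rw [halfRoot, halfRoot, Finset.sum_congr rfl fun j _ => h j, Finset.sum_sub_distrib,
      Finset.sum_ite_eq' Finset.univ i, if_pos (Finset.mem_univ i), smul_sub, smul_smul]
    congr 2
    ring

/-- The signs of the short roots of type `F₄` outside type `B₄`. -/
def halfSigns (p : Bool × Bool × Bool) : Fin 4 → ℝ :=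
  ![1, if p.1 then 1 else -1, if p.2.1 then 1 else -1, if p.2.2 then 1 else -1]

lemma halfRoot_mem_rootSet (hε : Orthonormal ℝ ε) (h1 : ε 1 ∈ rootSet G) (h2 : ε 2 ∈ rootSet G)
    (h3 : ε 3 ∈ rootSet G) (h : halfRoot ε (halfSigns (false, false, false)) ∈ rootSet G)
    (p : Bool × Bool × Bool) : halfRoot ε (halfSigns p) ∈ rootSet G := by
  have step1 : ∀ a, halfRoot ε (halfSigns (a, false, false)) ∈ rootSet G := by
    rintro (_ | _)
    · exact h
    · convert halfRoot_update_mem_rootSet hε h h1 using 2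
      ext j
      fin_cases j <;> simp [halfSigns]
  have step2 : ∀ a b, halfRoot ε (halfSigns (a, b, false)) ∈ rootSet G := by
    rintro a (_ | _)
    · exact step1 a
    · convert halfRoot_update_mem_rootSet hε (step1 a) h2 using 2
      ext j
      fin_cases j <;> simp [halfSigns]
  obtain ⟨a, b, _ | _⟩ := p
  · exact step2 a b
  · convert halfRoot_update_mem_rootSet hε (step2 a b) h3 using 2
    ext j
    fin_cases j <;> simp [halfSigns]

lemma halfRoot_ne_smul (hε : Orthonormal ℝ ε) (p p' : Bool × Bool × Bool) (hp : p ≠ p') (c : ℝ) :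
    halfRoot ε (halfSigns p) ≠ c • halfRoot ε (halfSigns p') := by
  intro h
  have hm : ∀ m, halfSigns p m / 2 = c * (halfSigns p' m / 2) := by
    intro m
    rw [← inner_basis_halfRoot hε, ← inner_basis_halfRoot hε, h, real_inner_smul_right]
  have h0 := hm 0
  have h1 := hm 1
  have h2 := hm 2
  have h3 := hm 3
  obtain ⟨a, b, d⟩ := p
  obtain ⟨a', b', d'⟩ := p'
  apply hp
  simp only [halfSigns, Matrix.cons_val] at h0 h1 h2 h3
  have hc : c = 1 := by linarith
  subst hc
  clear hm h hp h0
  simp only [Prod.mk.injEq]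
  refine ⟨?_, ?_, ?_⟩
  · revert h1; cases a <;> cases a' <;> norm_num
  · revert h2; cases b <;> cases b' <;> norm_num
  · revert h3; cases d <;> cases d' <;> norm_num

lemma halfSigns_ne_zero (p : Bool × Bool × Bool) (m : Fin 4) : halfSigns p m ≠ 0 := by
  obtain ⟨a, b, d⟩ := p
  fin_cases m <;> cases a <;> cases b <;> cases d <;> simp [halfSigns]

lemma exists_inner_signedRoot_eq_zero (hε : Orthonormal ℝ ε) (p : Fin 4 × Fin 4) :
    ∃ m, inner ℝ (ε m) (signedRoot ε p) = (0 : ℝ) := by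
  obtain ⟨m, h1, h2⟩ : ∃ m, m ≠ p.1 ∧ m ≠ p.2 := by
    obtain ⟨a, b⟩ := p
    revert a b
    decide
  exact ⟨m, by rw [inner_signedRoot hε, if_neg h1, if_neg h2]⟩

/-- The degrees give 1 + 5 + 7 + 11 = 24, matched by sixteen roots of type `B₄` and eight half-sum
roots. A vanishing coordinate distinguishes the former from the latter. -/
lemma isCompleteFamily_typeF (hε : Orthonormal ℝ ε)
    (hfix : fixedSubspace G = (Submodule.span ℝ (Set.range ε))ᗮ)
    (hsub : ∀ i j, i ≠ j → ε i - ε j ∈ rootSet G) (hone : ∀ i, ε i ∈ rootSet G)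
    (hhalf : ∀ p, halfRoot ε (halfSigns p) ∈ rootSet G)
    (hinv : ∀ m, Even m → powerSum (longRoot ε) m ∈ invariantRing G) :
    IsCompleteFamily G
      (Sum.elim (fun l => linForm (fixedBasis G l)) fun j => powerSum (longRoot ε) (degreeF j))
      (Sum.elim (fun _ => 1) degreeF) where
  card_eq := by simpa using finrank_fixedSubspace_add hε hfix
  pos := by
    rintro (l | j)
    · simp
    · fin_cases j <;> simp [degreeF]
  mem_invariantRing := by
    rintro (l | j)
    · exact linForm_mem_invariantRing (fixedBasis_mem l)
    · refine hinv _ ?_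
      fin_cases j <;> simp [degreeF] <;> decide
  homogeneous := by
    rintro (l | j)
    · exact isHomogeneous_linForm _
    · exact isHomogeneous_powerSum _ _
  linearIndependent := by
    obtain ⟨a, ha⟩ := exists_linearIndependent_longRoot hε hfix
    refine ⟨a, ?_⟩
    convert ha using 1
    funext o
    rcases o with l | j <;> simp [polyGrad_linForm]
  sum_le := by
    have hmixed : ∀ p p' (c : ℝ), signedRoot ε p ≠ c • halfRoot ε (halfSigns p') ∧
        halfRoot ε (halfSigns p') ≠ c • signedRoot ε p := by
      intro p p' c
      obtain ⟨m, hm⟩ := exists_inner_signedRoot_eq_zero hε p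
      have hne : halfSigns p' m / 2 ≠ 0 := div_ne_zero (halfSigns_ne_zero p' m) two_ne_zero
      constructor
      · intro h
        rw [h, real_inner_smul_right, inner_basis_halfRoot hε] at hm
        rcases mul_eq_zero.1 hm with h0 | h0
        · have hroot : signedRoot ε p = 0 := by rw [h, h0, zero_smul]
          have := inner_signedRoot hε p p.1
          rw [hroot, inner_zero_right, if_pos rfl] at this
          exact zero_ne_one this
        · exact hne h0
      · intro h
        have := inner_basis_halfRoot hε (halfSigns p') m
        rw [h, real_inner_smul_right, hm, mul_zero] at this
        exact hne this.symm
    refine ⟨(Fin 4 × Fin 4) ⊕ (Bool × Bool × Bool), inferInstance,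
      Sum.elim (signedRoot ε) fun p => halfRoot ε (halfSigns p), ?_, ?_, ?_⟩
    · rintro (p | p)
      · rw [Sum.elim_inl, signedRoot]
        split_ifs with h1 h2
        · exact hone _
        · exact hsub _ _ h1
        · exact add_mem_rootSet_of_single hε hsub hone _ _ h1
      · exact hhalf p
    · rintro (p | p) (p' | p') hp c
      · exact signedRoot_ne_smul hε p p' (fun h => hp (by rw [h])) c
      · exact (hmixed p p' c).1
      · exact (hmixed p' p c).2
      · exact halfRoot_ne_smul hε p p' (fun h => hp (by rw [h])) c
    · rw [Fintype.sum_sum_type]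
      simp [Fin.sum_univ_four, degreeF]

/-- The arrangement contains that of `B₄`, so at most two nonzero squares of coordinates suffice.
The fibre is that of the invariants of degrees two and six. -/
theorem fibresMeetStratum_typeF (hε : Orthonormal ℝ ε)
    (hfix : fixedSubspace G = (Submodule.span ℝ (Set.range ε))ᗮ)
    (hsub : ∀ i j, i ≠ j → ε i - ε j ∈ rootSet G) (hone : ∀ i, ε i ∈ rootSet G)
    (hhalf : ∀ p, halfRoot ε (halfSigns p) ∈ rootSet G)
    (hinv : ∀ m, Even m → powerSum (longRoot ε) m ∈ invariantRing G) :
    FibresMeetStratum G (finrank ℝ (fixedSubspace G) + 2) := by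
  intro π hπ p
  have hk : finrank ℝ (fixedSubspace G) + 2 ≤ n := by
    have := finrank_fixedSubspace_add hε hfix
    omega
  let f : Fin (finrank ℝ (fixedSubspace G)) ⊕ Fin 2 → MvPolynomial (Fin n) ℝ :=
    Sum.elim (fun l => linForm (fixedBasis G l))
      ![powerSum (longRoot ε) 2, powerSum (longRoot ε) 6]
  have hcompact : IsCompact {x : Space n | ∀ i, evalAt x (f i) = evalAt p (f i)} := by
    refine isCompact_of_coordinates ε (eq_zero_of_coordinates hfix) (isClosed_fibre f p) p
      (fun x hx l => ?_) fun x hx => ?_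
    · have := hx (Sum.inl l)
      simpa only [f, Sum.elim_inl, evalAt_linForm] using this
    · have := hx (Sum.inr 0)
      simp only [f, Sum.elim_inr, Matrix.cons_val_zero, powerSum_longRoot_two, evalAt_smul] at this
      exact mul_left_cancel₀ (by norm_num) this
  -- The sextic invariant is a combination of p₂p₄ and p₆, where p_j is the sum of j-th powers of
  -- the coordinates. With the gradients of p₂ and p₄, its gradient therefore yields that of p₆, and
  -- three nonzero squares would contradict criticality.
  obtain ⟨q, hq, -, hext⟩ := exists_min_on_fibre f p hcompact (powerSum ε 4)
  refine ⟨q, ?_, fun i hi => ?_⟩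
  · have hcard : ((squareSet ε q).erase 0).card ≤ 2 := by
      by_contra! hlt
      set W := Submodule.span ℝ
        (insert (polyGrad (powerSum ε 4) q) (Set.range fun i => polyGrad (f i) q)) with hW
      have h4 : polyGrad (powerSum ε 4) q ∈ W := Submodule.subset_span (Or.inl rfl)
      have h2 : polyGrad (powerSum ε 2) q ∈ W := by
        have : polyGrad (powerSum (longRoot ε) 2) q ∈ W :=
          Submodule.subset_span (Or.inr ⟨Sum.inr 0, rfl⟩)
        rw [powerSum_longRoot_two, polyGrad_smul] at this
        exact (Submodule.smul_mem_iff _ (by norm_num)).1 this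
      have h6 : polyGrad (powerSum ε 6) q ∈ W := by
        have : polyGrad (powerSum (longRoot ε) 6) q ∈ W :=
          Submodule.subset_span (Or.inr ⟨Sum.inr 1, rfl⟩)
        rw [powerSum_longRoot_six, polyGrad_add, polyGrad_smul, polyGrad_smul, polyGrad_mul] at this
        have h := Submodule.sub_mem _ this (Submodule.smul_mem _ (30 : ℝ)
          (Submodule.add_mem _ (Submodule.smul_mem _ (evalAt q (powerSum ε 4)) h2)
            (Submodule.smul_mem _ (evalAt q (powerSum ε 2)) h4)))
        rw [add_sub_cancel_left] at h
        exact (Submodule.smul_mem_iff _ (by norm_num)).1 h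
      have h := card_le_of_isLocalExtrOn f _ hext _
        (linearIndependent_evenPowerSums hε hfix (m := 3) hlt) (by
          rintro (l | j)
          · refine Submodule.subset_span (Or.inr ⟨Sum.inl l, ?_⟩)
            simp [f, polyGrad_linForm]
          · fin_cases j
            · exact h2
            · exact h4
            · exact h6)
      simp at h
    refine mem_stratum_of_squares hfix hsub (add_mem_rootSet_of_single hε hsub hone) hk _ hcard
      fun i => ?_
    by_cases h0 : (inner ℝ (ε i) q : ℝ) = 0
    · exact Or.inr fun x hx => hx _ (hone i) h0
    · exact Or.inl (Finset.mem_erase.2 ⟨pow_ne_zero 2 h0, mem_squareSet q i⟩)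
  · refine hπ.evalAt_eq_of_family (isCompleteFamily_typeF hε hfix hsub hone hhalf hinv)
      (m := 6) (κ' := Fin (finrank ℝ (fixedSubspace G)) ⊕ Fin 2)
      (Sum.map id (Fin.castLE (by norm_num))) ?_ ?_ (by simp) ?_ i hi
    · exact Function.Injective.sumMap Function.injective_id (Fin.castLE_injective _)
    · rintro (l | j)
      · simp
      · fin_cases j <;> simp [degreeF]
    · rintro (l | j) hj
      · exact hq (Sum.inl l)
      · fin_cases j
        · exact hq (Sum.inr 0)
        · exact hq (Sum.inr 1)
        · simp [degreeF] at hj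
        · simp [degreeF] at hj

end TypeF

/-! ### Coordinates for groups of type `F₄` -/

section ModelF

variable {n : ℕ} {G : Subgroup (OrthGroup n)}

/-- Simple roots of type `F₄`. -/
noncomputable def modelF : Fin 4 → EuclideanSpace ℝ (Fin 4) :=
  ![(√2)⁻¹ • (stdVec 4 1 - stdVec 4 2), (√2)⁻¹ • (stdVec 4 2 - stdVec 4 3), stdVec 4 3,
    (1 / 2 : ℝ) • (stdVec 4 0 - stdVec 4 1 - stdVec 4 2 - stdVec 4 3)]

lemma gram_modelF (i j : Fin 4) : inner ℝ (modelF i) (modelF j) =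
    -Real.cos (Real.pi / (CoxeterMatrix.F₄ i j : ℝ)) := by
  have h2 := inv_sqrt_two_mul_self
  have hM : CoxeterMatrix.F₄ i j = (!![1, 3, 2, 2; 3, 1, 4, 2; 2, 4, 1, 3; 2, 2, 3, 1] :
    Matrix (Fin 4) (Fin 4) ℕ) i j := rfl
  rw [hM]
  clear hM
  set c := (√2)⁻¹ with hc
  fin_cases i <;> fin_cases j <;>
    simp +decide only [modelF, Fin.zero_eta, Fin.mk_one, Fin.reduceFinMk, Matrix.of_apply,
      Matrix.cons_val, inner_sub_left, inner_sub_right, real_inner_smul_left,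
      real_inner_smul_right, inner_stdVec, neg_cos_pi_div_one, neg_cos_pi_div_two,
      neg_cos_pi_div_three, neg_cos_pi_div_four, if_true, if_false, ← hc] <;> linarith

lemma span_modelF : Submodule.span ℝ (Set.range modelF) = ⊤ := by
  have hm : ∀ i, modelF i ∈ Submodule.span ℝ (Set.range modelF) := fun i =>
    Submodule.subset_span ⟨i, rfl⟩
  have h3 : stdVec 4 3 ∈ Submodule.span ℝ (Set.range modelF) := hm 2
  have h2 : stdVec 4 2 ∈ Submodule.span ℝ (Set.range modelF) := by
    have := (Submodule.smul_mem_iff _ inv_sqrt_two_ne_zero).1 (hm 1)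
    exact (Submodule.sub_mem_iff_left _ h3).1 this
  have h1 : stdVec 4 1 ∈ Submodule.span ℝ (Set.range modelF) := by
    have := (Submodule.smul_mem_iff _ inv_sqrt_two_ne_zero).1 (hm 0)
    exact (Submodule.sub_mem_iff_left _ h2).1 this
  have h0 : stdVec 4 0 ∈ Submodule.span ℝ (Set.range modelF) := by
    have := (Submodule.smul_mem_iff _ (by norm_num : (1 / 2 : ℝ) ≠ 0)).1 (hm 3)
    exact (Submodule.sub_mem_iff_left _ h1).1 ((Submodule.sub_mem_iff_left _ h2).1
      ((Submodule.sub_mem_iff_left _ h3).1 this))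
  refine span_eq_top_of_stdVec fun k hk => ?_
  interval_cases k
  exacts [h0, h1, h2, h3]

lemma rootSet_typeF {ε : Fin 4 → Space n} (hε : Orthonormal ℝ ε) (h12 : ε 1 - ε 2 ∈ rootSet G)
    (h23 : ε 2 - ε 3 ∈ rootSet G) (h3 : ε 3 ∈ rootSet G)
    (h : halfRoot ε (halfSigns (false, false, false)) ∈ rootSet G) :
    (∀ i j, i ≠ j → ε i - ε j ∈ rootSet G) ∧ (∀ i, ε i ∈ rootSet G) ∧
      ∀ p, halfRoot ε (halfSigns p) ∈ rootSet G := by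
  have hd := hε.hasUnitDifferences
  have hin := orthonormal_iff_ite.1 hε
  have h2 : ε 2 ∈ rootSet G := by
    refine mem_rootSet_of_reflect h23 h3 (-1) ?_ (by rw [neg_smul, one_smul]; abel)
    simp +decide only [inner_sub_left, inner_sub_right, hin, if_true, if_false]
    norm_num
  have h1 : ε 1 ∈ rootSet G := by
    refine mem_rootSet_of_reflect h12 h2 (-1) ?_ (by rw [neg_smul, one_smul]; abel)
    simp +decide only [inner_sub_left, inner_sub_right, hin, if_true, if_false]
    norm_num
  have hhalf := halfRoot_mem_rootSet hε h1 h2 h3 h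
  have h0 : ε 0 ∈ rootSet G := by
    refine mem_rootSet_of_reflect (hhalf (false, false, false)) (hhalf (true, true, true)) (-1)
      ?_ ?_
    · rw [inner_halfRoot_halfRoot hε, inner_halfRoot_halfRoot hε]
      simp [Fin.sum_univ_four, halfSigns]
      norm_num
    · rw [neg_smul, one_smul, sub_neg_eq_add, halfRoot, halfRoot, ← smul_add,
        ← Finset.sum_add_distrib]
      simp [Fin.sum_univ_four, halfSigns, ← two_smul ℝ, smul_smul]
  -- The reflection in (1, -1, 1, 1)/2 maps `ε 1 - ε 2` here, the first long root that involves the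
  -- coordinate `ε 0`.
  have h03' : ε 0 + ε 3 ∈ rootSet G := by
    refine mem_rootSet_of_reflect (hhalf (false, true, true)) h12 (-2) ?_ ?_
    · rw [inner_halfRoot_halfRoot hε, inner_sub_right, real_inner_comm,
        real_inner_comm (ε 2), inner_basis_halfRoot hε, inner_basis_halfRoot hε]
      simp [Fin.sum_univ_four, halfSigns]
      norm_num
    · rw [halfRoot, smul_smul]
      simp [Fin.sum_univ_four, halfSigns]
      abel
  have h03 : ε 0 - ε 3 ∈ rootSet G := by
    refine mem_rootSet_of_reflect h3 h03' 2 ?_ (by rw [two_smul]; abel)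
    simp +decide only [inner_add_right, hin, if_true, if_false]
    norm_num
  have h32 : ε 3 - ε 2 ∈ rootSet G := by rw [← neg_sub]; exact neg_mem_rootSet h23
  have h21 : ε 2 - ε 1 ∈ rootSet G := by rw [← neg_sub]; exact neg_mem_rootSet h12
  have h02 := sub_trans_mem_rootSet hd (by decide) (by decide) (by decide) h03 h32
  have h01 := sub_trans_mem_rootSet hd (by decide) (by decide) (by decide) h02 h21
  refine ⟨sub_mem_rootSet_of_adjacent hd fun i j hij => ?_, fun i => ?_, hhalf⟩
  · fin_cases i <;> fin_cases j <;> first | exact h01 | exact h12 | exact h23 | simp at hij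
  · fin_cases i
    exacts [h0, h1, h2, h3]

theorem fibresMeetStratum_of_hasCoxeterType_F (h : HasCoxeterType G CoxeterMatrix.F₄) :
    finrank ℝ (fixedSubspace G) + 4 = n ∧
      FibresMeetStratum G (finrank ℝ (fixedSubspace G) + 2) := by
  obtain ⟨α, hgram, hG⟩ := h
  have hα := ne_zero_of_gram hgram
  obtain ⟨T, hT, hε, hfix⟩ := exists_orthonormal_of_model hG hα modelF span_modelF
    fun i j => by rw [hgram, gram_modelF]
  refine ⟨finrank_fixedSubspace_add hε hfix, ?_⟩
  set ε := fun i : Fin 4 => T (EuclideanSpace.single i 1) with hεdef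
  have hroot := mem_rootSet_of_closure hG hα
  have hstd : ∀ k (hk : k < 4), T (stdVec 4 k) = ε ⟨k, hk⟩ := by
    intro k hk
    rw [stdVec_eq hk]
  have e0 : α 0 = (√2)⁻¹ • (ε 1 - ε 2) := by
    rw [← hT]
    simp only [modelF, Matrix.cons_val, map_smul, map_sub]
    rw [hstd 1 (by norm_num), hstd 2 (by norm_num)]
    rfl
  have e1 : α 1 = (√2)⁻¹ • (ε 2 - ε 3) := by
    rw [← hT]
    simp only [modelF, Matrix.cons_val, map_smul, map_sub]
    rw [hstd 2 (by norm_num), hstd 3 (by norm_num)]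
    rfl
  have e2 : α 2 = ε 3 := by
    rw [← hT]
    exact hstd 3 (by norm_num)
  have e3 : α 3 = halfRoot ε (halfSigns (false, false, false)) := by
    rw [← hT]
    simp only [modelF, Matrix.cons_val, map_smul, map_sub]
    rw [hstd 0 (by norm_num), hstd 1 (by norm_num), hstd 2 (by norm_num), hstd 3 (by norm_num),
      halfRoot]
    simp [Fin.sum_univ_four, halfSigns, sub_eq_add_neg]
  have hscale : ∀ v : Space n, (√2)⁻¹ • v ∈ rootSet G → v ∈ rootSet G := by
    intro v hv
    have := smul_mem_rootSet (inv_ne_zero inv_sqrt_two_ne_zero) hv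
    rwa [smul_smul, inv_mul_cancel₀ inv_sqrt_two_ne_zero, one_smul] at this
  obtain ⟨hsub, hone, hhalf⟩ := rootSet_typeF hε (hscale _ (e0 ▸ hroot 0))
    (hscale _ (e1 ▸ hroot 1)) (e2 ▸ hroot 2) (e3 ▸ hroot 3)
  refine fibresMeetStratum_typeF hε hfix hsub hone hhalf fun m hm => ?_
  refine mem_invariantRing_of_generators hG fun i x => ?_
  rw [evalAt_longPowerSum, evalAt_longPowerSum]
  have hd := hε.hasUnitDifferences
  obtain rfl | rfl | rfl | rfl : i = 0 ∨ i = 1 ∨ i = 2 ∨ i = 3 := by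
    fin_cases i <;> simp
  · simp only [e0, hyperplaneReflection_smul _ inv_sqrt_two_ne_zero,
      inner_reflection_sub hd (show (1 : Fin 4) ≠ 2 by decide)]
    exact longPowerSum_swap_one_two m hm _ _ _ _
  · simp only [e1, hyperplaneReflection_smul _ inv_sqrt_two_ne_zero,
      inner_reflection_sub hd (show (2 : Fin 4) ≠ 3 by decide)]
    exact longPowerSum_swap_two_three m hm _ _ _ _
  · simp +decide only [e2, inner_reflection_single hε, if_true, if_false, one_mul, neg_one_mul]
    exact longPowerSum_neg_three m _ _ _ _
  · have hself : (inner ℝ (α 3) (α 3) : ℝ) = 1 := by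
      rw [hgram, CoxeterMatrix.diagonal]
      simp
    have hcoord : ∀ l, (inner ℝ (ε l) (hyperplaneReflection (α 3) x) : ℝ) = inner ℝ (ε l) x -
        (inner ℝ (ε 0) x - inner ℝ (ε 1) x - inner ℝ (ε 2) x - inner ℝ (ε 3) x) *
          (halfSigns (false, false, false) l / 2) := by
      intro l
      have hx : (inner ℝ (α 3) x : ℝ) = 1 / 2 *
          (inner ℝ (ε 0) x - inner ℝ (ε 1) x - inner ℝ (ε 2) x - inner ℝ (ε 3) x) := by
        rw [e3, inner_halfRoot, Fin.sum_univ_four]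
        simp [halfSigns]
        ring
      rw [hyperplaneReflection_apply, hself, inner_sub_right, real_inner_smul_right, hx, e3,
        inner_basis_halfRoot hε]
      ring
    rw [← longPowerSum_half]
    simp only [hcoord, halfSigns, Matrix.cons_val]
    congr 1 <;> simp <;> ring

end ModelF

/-! ### The remaining types -/

section RemainingTypes

variable {n r : ℕ} {G : Subgroup (OrthGroup n)}

lemma neg_cos_pi_div_ne_zero {m : ℕ} (hm : 3 ≤ m) : -Real.cos (Real.pi / (m : ℝ)) ≠ 0 := by
  have hm' : (3 : ℝ) ≤ m := by exact_mod_cast hm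
  refine neg_ne_zero.2 (Real.cos_pos_of_mem_Ioo ⟨?_, ?_⟩).ne'
  · have h1 : 0 ≤ Real.pi / (m : ℝ) := by positivity
    linarith [Real.pi_pos]
  · exact div_lt_div_of_pos_left Real.pi_pos two_pos (by linarith)

lemma isConnectedFamily_of_chain {α : Fin r → Space n}
    (h : ∀ i j : Fin r, (i : ℕ) + 1 = j → inner ℝ (α i) (α j) ≠ (0 : ℝ)) :
    IsConnectedFamily α := by
  intro c hc
  have key : ∀ m : ℕ, ∀ hm : m < r, ∀ h0 : 0 < r, c ⟨m, hm⟩ = c ⟨0, h0⟩ := by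
    intro m
    induction m with
    | zero => intros; rfl
    | succ m ih =>
      intro hm h0
      rw [← ih (by omega) h0]
      exact (hc _ _ (h _ _ rfl)).symm
  intro i j
  exact (key i i.2 (by have := i.2; omega)).trans (key j j.2 _).symm

lemma le_finrank_fixedSubspace_add {α : Fin r → Space n}
    (hG : G = Subgroup.closure (Set.range fun i => hyperplaneReflection (α i)))
    (hα : ∀ i, α i ≠ 0) : n ≤ finrank ℝ (fixedSubspace G) + r := by
  have h2 := Submodule.finrank_add_finrank_orthogonal (Submodule.span ℝ (Set.range α))
  have h3 := finrank_range_le_card (R := ℝ) α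
  rw [← fixedSubspace_eq hG hα, finrank_euclideanSpace_fin] at h2
  rw [Set.finrank, Fintype.card_fin] at h3
  omega

/-- These two values of `k` are the only ones strictly between dim V^G and `n` when the rank is at
most three; in rank four only dim V^G + 2 is left. -/
lemma fibresMeetStratum_of_chain {α : Fin r → Space n} (hR : IsReflectionGroup G)
    (hG : G = Subgroup.closure (Set.range fun i => hyperplaneReflection (α i)))
    (hα : ∀ i, α i ≠ 0)
    (h : ∀ i j : Fin r, (i : ℕ) + 1 = j → inner ℝ (α i) (α j) ≠ (0 : ℝ)) {k : ℕ}
    (hk : finrank ℝ (fixedSubspace G) < k) (hkn : k < n)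
    (hk' : k = finrank ℝ (fixedSubspace G) + 1 ∨ k + 1 = n) : FibresMeetStratum G k := by
  have hconn := isConnectedFamily_of_chain h
  rcases hk' with rfl | hk'
  · exact fibresMeetStratum_finrank_add_one hG hα hconn (by omega)
  · exact fibresMeetStratum_of_add_one_eq hR hG hα hconn hk' hk

lemma fibresMeetStratum_of_orthogonal {α : Fin 2 → Space n}
    (hG : G = Subgroup.closure (Set.range fun i => hyperplaneReflection (α i)))
    (hα : ∀ i, inner ℝ (α i) (α i) = (1 : ℝ)) (h : inner ℝ (α 0) (α 1) = (0 : ℝ)) {k : ℕ}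
    (hk : finrank ℝ (fixedSubspace G) < k) (hkn : k < n) : FibresMeetStratum G k := by
  have hle := le_finrank_fixedSubspace_add hG fun i h0 => by
    have := hα i
    rw [h0, inner_zero_left] at this
    exact zero_ne_one this
  refine fibresMeetStratum_of_orthogonal_pair (hα 0) (hα 1) h ?_ (by omega) (by omega)
  rw [hG]
  congr 2
  funext i
  fin_cases i <;> rfl

lemma inner_self_of_gram {B : Type} {M : CoxeterMatrix B} {α : B → Space n}
    (h : ∀ i j, inner ℝ (α i) (α j) = -Real.cos (Real.pi / (M i j : ℝ))) (i : B) :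
    inner ℝ (α i) (α i) = (1 : ℝ) := by
  rw [h, M.diagonal]
  simp

theorem fibresMeetStratum_of_hasCoxeterType_I {m : ℕ} (hR : IsReflectionGroup G)
    (h : HasCoxeterType G (CoxeterMatrix.I m)) {k : ℕ} (hk : finrank ℝ (fixedSubspace G) < k)
    (hkn : k < n) : FibresMeetStratum G k := by
  obtain ⟨α, hgram, hG⟩ := h
  have hα := ne_zero_of_gram hgram
  have hM : ∀ i j, i ≠ j → CoxeterMatrix.I m i j = m + 2 := fun i j hij => if_neg hij
  rcases Nat.eq_zero_or_pos m with rfl | hm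
  · refine fibresMeetStratum_of_orthogonal hG (inner_self_of_gram hgram) ?_ hk hkn
    rw [hgram, hM 0 1 (by decide)]
    exact neg_cos_pi_div_two
  · have hle := le_finrank_fixedSubspace_add hG hα
    refine fibresMeetStratum_of_chain hR hG hα (fun i j hij => ?_) hk hkn (by omega)
    rw [hgram, hM i j (by rintro rfl; omega)]
    exact neg_cos_pi_div_ne_zero (by omega)

theorem fibresMeetStratum_of_hasCoxeterType_D_two
    (h : HasCoxeterType G (coxeterMatrixD 2)) {k : ℕ} (hk : finrank ℝ (fixedSubspace G) < k)
    (hkn : k < n) : FibresMeetStratum G k := by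
  obtain ⟨α, hgram, hG⟩ := h
  refine fibresMeetStratum_of_orthogonal hG (inner_self_of_gram hgram) ?_ hk hkn
  have hM : coxeterMatrixD 2 0 1 = 2 := by
    simp [coxeterMatrixD, adjD]
  rw [hgram, hM]
  exact neg_cos_pi_div_two

theorem fibresMeetStratum_of_hasCoxeterType_H (hR : IsReflectionGroup G)
    (h : HasCoxeterType G CoxeterMatrix.H₃) {k : ℕ} (hk : finrank ℝ (fixedSubspace G) < k)
    (hkn : k < n) : FibresMeetStratum G k := by
  obtain ⟨α, hgram, hG⟩ := h
  have hα := ne_zero_of_gram hgram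
  have hle := le_finrank_fixedSubspace_add hG hα
  refine fibresMeetStratum_of_chain hR hG hα (fun i j hij => ?_) hk hkn (by omega)
  rw [hgram]
  apply neg_cos_pi_div_ne_zero
  fin_cases i <;> fin_cases j <;> simp [CoxeterMatrix.H₃] at hij ⊢

lemma fibresMeetStratum_of_hasCoxeterType_F₄ (hR : IsReflectionGroup G)
    (h : HasCoxeterType G CoxeterMatrix.F₄) {k : ℕ} (hk : finrank ℝ (fixedSubspace G) < k)
    (hkn : k < n) : FibresMeetStratum G k := by
  obtain ⟨hn, h2⟩ := fibresMeetStratum_of_hasCoxeterType_F h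
  obtain ⟨α, hgram, hG⟩ := h
  by_cases hk2 : k = finrank ℝ (fixedSubspace G) + 2
  · rw [hk2]
    exact h2
  refine fibresMeetStratum_of_chain hR hG (ne_zero_of_gram hgram) (fun i j hij => ?_) hk hkn
    (by omega)
  rw [hgram]
  apply neg_cos_pi_div_ne_zero
  fin_cases i <;> fin_cases j <;> simp [CoxeterMatrix.F₄] at hij ⊢

/-- The two extreme values of `k` are treated uniformly; the type matters only strictly between
them. -/
theorem HasListedType.fibresMeetStratum (hR : IsReflectionGroup G) (h : HasListedType G) {k : ℕ}
    (hk : finrank ℝ (fixedSubspace G) ≤ k) (hkn : k ≤ n) : FibresMeetStratum G k := by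
  rcases hkn.eq_or_lt with rfl | hkn
  · exact fibresMeetStratum_top G
  rcases hk.eq_or_lt with rfl | hk
  · have base : ∀ {B : Type} {M : CoxeterMatrix B}, HasCoxeterType G M →
        FibresMeetStratum G (finrank ℝ (fixedSubspace G)) := fun ⟨_, hgram, hG⟩ =>
      fibresMeetStratum_finrank_fixedSubspace hG (ne_zero_of_gram hgram)
    rcases h with ⟨_, h⟩ | ⟨_, h⟩ | ⟨_, h⟩ | ⟨_, _, h⟩ | h | h <;> exact base h
  obtain ⟨j, rfl⟩ : ∃ j, k = finrank ℝ (fixedSubspace G) + (j + 1) :=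
    ⟨k - finrank ℝ (fixedSubspace G) - 1, by omega⟩
  rcases h with ⟨m, h⟩ | ⟨r, h⟩ | ⟨r, h⟩ | ⟨r, hr, h⟩ | h | h
  · exact fibresMeetStratum_of_hasCoxeterType_I hR h hk hkn
  · exact fibresMeetStratum_of_hasCoxeterType_A h (by omega) hkn.le
  · exact fibresMeetStratum_of_hasCoxeterType_B h (by omega) hkn.le
  · rcases hr.eq_or_lt with rfl | hr
    · exact fibresMeetStratum_of_hasCoxeterType_D_two h hk hkn
    · exact fibresMeetStratum_of_hasCoxeterType_D hr h hkn
  · exact fibresMeetStratum_of_hasCoxeterType_H hR h hk hkn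
  · exact fibresMeetStratum_of_hasCoxeterType_F₄ hR h hk hkn

end RemainingTypes

end Auxiliary

theorem theorem1p2 {n : ℕ} (G : Subgroup (OrthGroup n)) (hG : IsReflectionGroup G)
    (hType : HasListedType G) (k : ℕ) (hk : Module.finrank ℝ (fixedSubspace G) ≤ k)
    (hkn : k ≤ n) (X : Set (Space n)) (hne : X.Nonempty) (hX : IsRealVariety X)
    (hInv : IsInvariantSet G X) (hSparse : IsSparse G k X) :
    (X ∩ stratum G k).Nonempty :=
  (hType.fibresMeetStratum hG hk hkn).nonempty hne hSparse
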